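/- Conventions. $\widehat f(\xi)=\int f(x)e^{-2\pi i x\xi}\,dx$ is the Fourier transform and $\check f$ the inverse Fourier transform (also on $L^2(\mathbb R)$ and on tempered distributions). Let $d\ge 2$ be an integer and fix: - a smooth function $\rho_1:\mathbb R\to\mathbb R$ supported on $[1/2,2]$, and put $\rho(t)=\rho_1(t)\mathbf 1_{t>0}-\rho_1(-t)\mathbf 1_{t<0}$; - a Schwartz function $\Phi_1$ with $\widehat{\Phi_1}=1$ on $3/8\le|\xi|\le 17/8$ and $\widehat{\Phi_1}$ supported on $1/8\le|\xi|\le 19/8$; $R_{\Phi_1}f$ is defined by $\widehat{R_{\Phi_1}f}=\widehat f\,\widehat{\Phi_1}$; - a nonnegative Schwartz function $\phi$ with $\widehat\phi$ supported in $[-1/100,1/100]$ and $\widehat\phi(0)=1$; put $\phi_k(x)=2^{-k}\phi(2^{-k}x)$, $I_{k,n}=[2^kn,2^k(n+1)]$ and $\mathbf 1^*_{k,n}=\mathbf 1_{I_{k,n}}*\phi_k$. For integers $j>0$, $m\ge 0$, $n\in\mathbb Z$ and $f,g\in L^2(\mathbb R)$ let $$\mathcal B_{j,m,n}(f,g)(x)=2^{-(d-1)j/2}\int_{\mathbb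 R}R_{\Phi_1}f\big(2^{-(d-1)j}x-2^mt\big)\,R_{\Phi_1}g\big(x-2^mt^d\big)\,\rho(t)\,dt\;\mathbf 1^*_{(d-1)j+m,n}(x),$$ and for $f_1,f_2\in L^2(\mathbb R)$ and a tempered distribution $f_3$ with $\widehat{f_3}\in L^\infty(\mathbb R)$ let $$\Lambda_{j,m,n}(f_1,f_2,f_3)=\big\langle \mathcal B_{j,m,n}(\check f_1,\check f_2),\check f_3\big\rangle=\int_{\mathbb R}\mathcal B_{j,m,n}(\check f_1,\check f_2)(x)\,\overline{\check f_3(x)}\,dx .$$ Let each of $\mathbf I_1,\mathbf I_2$ be one of the intervals $[1/16,39/16]$, $[-39/16,-1/16]$. Let $\mathcal Q_1$ be the set of functions $q_1(\xi)=a|\xi|^{d/(d-1)}+b\xi$ with $a,b\in\mathbb R$ and $2^{m-100}\le|a|\le 2^{m+100}$. Regard $e^{iq_1}$ as an element of $L^2(\mathbf I_1)$, i.e. as the function $\mathbf 1_{\mathbf I_1}e^{iq_1}$. For $\varepsilon>0$ let $\mathfrak D(\ell)=1/(2\ell)$ if $\ell\ge2$ and $\mathfrak D(1)=1/(2+\varepsilon)$.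 Proposition. For every $\varepsilon>0$ there is a constant $C$, depending only on $d,\varepsilon,\rho_1,\Phi_1,\phi$ (so independent of $j,m,n$), such that $$\big|\Lambda_{j,m,n}(e^{iq_1},f_2,f_3)\big|\le C\,2^{-\mathfrak D(d-1)m/2}\,\|f_2\|_{L^2(\mathbf I_2)}\,\|\widehat{f_3}\|_\infty$$ for all integers $j>0$, $m\ge0$, $n\in\mathbb Z$, all $q_1\in\mathcal Q_1$, all $f_2\in L^2(\mathbf I_2)$ and all $f_3$ with $\widehat{f_3}\in L^\infty(\mathbb R)$. -/

import Mathlib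

open MeasureTheory Set
open scoped FourierTransform SchwartzMap ENNReal ContDiff ComplexConjugate

noncomputable section

namespace CurveBHT

/-- The odd extension `ρ(t) = ρ₁(t) 1_{t>0} - ρ₁(-t) 1_{t<0}` of a bump function `ρ₁`. -/
def oddBump (ρ₁ : ℝ → ℝ) (t : ℝ) : ℝ :=
  if 0 < t then ρ₁ t else if t < 0 then -ρ₁ (-t) else 0

/-- `ρ₁` is a smooth bump function supported on `[1/2, 2]`. -/
def IsBump (ρ₁ : ℝ → ℝ) : Prop :=
  ContDiff ℝ ∞ ρ₁ ∧ Function.support ρ₁ ⊆ Icc (1 / 2) 2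

/-- The Schwartz function `Φ₁` satisfies `Φ₁^ = 1` on `3/8 ≤ |ξ| ≤ 17/8`, and `Φ₁^` is supported
on `1/8 ≤ |ξ| ≤ 19/8`. -/
def IsFreqCutoff (Φ₁ : 𝓢(ℝ, ℂ)) : Prop :=
  (∀ ξ : ℝ, 3 / 8 ≤ |ξ| → |ξ| ≤ 17 / 8 → 𝓕 Φ₁ ξ = 1) ∧
  (∀ ξ : ℝ, 𝓕 Φ₁ ξ ≠ 0 → 1 / 8 ≤ |ξ| ∧ |ξ| ≤ 19 / 8)

/-- `φ` is a nonnegative Schwartz function, `φ^` is supported in `[-1/100, 1/100]`, `φ^(0) = 1`. -/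
def IsSpaceCutoff (φ : 𝓢(ℝ, ℝ)) : Prop :=
  (∀ x, 0 ≤ φ x) ∧
  (∀ ξ : ℝ, 𝓕 (fun x : ℝ => (φ x : ℂ)) ξ ≠ 0 → |ξ| ≤ 1 / 100) ∧
  𝓕 (fun x : ℝ => (φ x : ℂ)) 0 = 1

/-- `φ_k(x) = 2^{-k} φ(2^{-k} x)`. -/
def dilate (φ : 𝓢(ℝ, ℝ)) (k : ℤ) (x : ℝ) : ℝ :=
  (2 : ℝ) ^ (-k) * φ ((2 : ℝ) ^ (-k) * x)

/-- The smooth truncation `1*_{k,n} = 1_{I_{k,n}} * φ_k`, where `I_{k,n} = [2^k n, 2^k (n+1)]`. -/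
def smoothInd (φ : 𝓢(ℝ, ℝ)) (k n : ℤ) (x : ℝ) : ℝ :=
  ∫ y in Icc ((2 : ℝ) ^ k * n) ((2 : ℝ) ^ k * (n + 1)), dilate φ k (x - y)

/-- The smooth Fourier restriction `R_Φ f` of `f ∈ L²`, given by `(R_Φ f)^ = f^ Φ^`. Here `𝓕 f` is
the Fourier transform on `L²`; the product with `𝓕 Φ` is integrable, so that the outer inverse
Fourier transform is the usual integral. -/
def fourierRestrict (Φ : 𝓢(ℝ, ℂ)) (f : Lp (α := ℝ) ℂ 2) : ℝ → ℂ :=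
  𝓕⁻ (fun ξ : ℝ => 𝓕 f ξ * 𝓕 Φ ξ)

/-- The bilinear operator `B_{j,m,n}(f, g)` for `j > 0`. -/
def bilinB (d : ℕ) (ρ₁ : ℝ → ℝ) (Φ₁ : 𝓢(ℝ, ℂ)) (φ : 𝓢(ℝ, ℝ)) (j m : ℕ) (n : ℤ)
    (f g : Lp (α := ℝ) ℂ 2) (x : ℝ) : ℂ :=
  (((2 : ℝ) ^ (-(((d : ℝ) - 1) * j / 2)) : ℝ) : ℂ) *
    (∫ t : ℝ, fourierRestrict Φ₁ f ((2 : ℝ) ^ (-(((d : ℤ) - 1) * j)) * x - 2 ^ m * t) *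
      fourierRestrict Φ₁ g (x - 2 ^ m * t ^ d) * (oddBump ρ₁ t : ℂ)) *
    (smoothInd φ (((d : ℤ) - 1) * j + m) n x : ℂ)

open Classical in
/-- The function in `L^∞(ℝ)` that represents the tempered distribution `u`, if there is one (it is
then unique up to null sets). -/
def linftyRep (u : 𝓢'(ℝ, ℂ)) : ℝ → ℂ :=
  if h : ∃ g : Lp (α := ℝ) ℂ ∞, (g : 𝓢'(ℝ, ℂ)) = u then (h.choose : ℝ → ℂ) else 0

/-- The trilinear form `Λ_{j,m,n}(f₁, f₂, f₃) = ⟨B_{j,m,n}(f₁ˇ, f₂ˇ), f₃ˇ⟩` for `j > 0`, where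
`f₁, f₂ ∈ L²` and `f₃` is a tempered distribution with `f₃ˇ ∈ L^∞` (equivalently `f₃^ ∈ L^∞`). -/
def trilinΛ (d : ℕ) (ρ₁ : ℝ → ℝ) (Φ₁ : 𝓢(ℝ, ℂ)) (φ : 𝓢(ℝ, ℝ)) (j m : ℕ) (n : ℤ)
    (f₁ f₂ : Lp (α := ℝ) ℂ 2) (f₃ : 𝓢'(ℝ, ℂ)) : ℂ :=
  ∫ x : ℝ, bilinB d ρ₁ Φ₁ φ j m n (𝓕⁻ f₁) (𝓕⁻ f₂) x * conj (linftyRep (𝓕⁻ f₃) x)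

/-- The set `Q₁` of the functions `a ξ^{d/(d-1)} + b ξ` with real `a, b` and
`2^{m-100} ≤ |a| ≤ 2^{m+100}`; for `ξ < 0` the power is read as `|ξ|^{d/(d-1)}`. -/
def phasesQ₁ (d m : ℕ) : Set (ℝ → ℝ) :=
  {q | ∃ a b : ℝ, (2 : ℝ) ^ ((m : ℤ) - 100) ≤ |a| ∧ |a| ≤ (2 : ℝ) ^ ((m : ℤ) + 100) ∧
    q = fun ξ => a * |ξ| ^ ((d : ℝ) / ((d : ℝ) - 1)) + b * ξ}

/-- The exponent `𝔇(ℓ)`: `1/(2ℓ)` if `ℓ ≥ 2` and `1/(2+ε)` if `ℓ = 1`. -/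
def decayExp (ε : ℝ) (ℓ : ℕ) : ℝ :=
  if ℓ = 1 then 1 / (2 + ε) else 1 / (2 * ℓ)

/-- `I` is one of the two intervals `[1/16, 39/16]` and `[-39/16, -1/16]`. -/
def IsFreqInterval (I : Set ℝ) : Prop :=
  I = Icc (1 / 16) (39 / 16) ∨ I = Icc (-(39 / 16)) (-(1 / 16))

end CurveBHT

end

/-!
With the phases `e^{iq₁}` inserted, `R_{Φ₁} f₁ˇ` is an explicit oscillatory integral; substituting
`ξ = ± r ^ (d - 1)` makes its phase a polynomial in `r` with a single critical point `p`, so it is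
`e^{-i c p ^ d} A(p)` with `|c| ≈ 2 ^ m`, where van der Corput's estimate bounds `A` and `A'` by
`|c| ^ (-1/2)`, and `A` by `|c| ^ (-1)` once `p` leaves a fixed compact range.

After rescaling `x = 2 ^ m U`, averaging over the curve becomes, with `X = U - t ^ d`, an integral
operator with a kernel `k(X, U)`, and `T T*` reduces its norm to the size of the correlations
`∫ k(X, U) conj (k(X, V)) dX`. The derivative of the phase of this correlation is `c (V - U)` times
a non-degenerate factor times a function of `X` that never vanishes together with its own
derivative. Hence the correlation is at most `|c| ^ (-3/2)` times `1` plus an inverse square root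
of a product of affine functions of `U` and `V`; these singularities are integrable, and summation
over `(U, V)` gives the decay `2 ^ (-m/4)`, which is at least as good as `2 ^ (-𝔇(d - 1) m / 2)`
because `𝔇 ≤ 1/2`.
-/

noncomputable section

namespace CurveBHT

section VanDerCorput

variable {x₁ x₂ : ℝ}

lemma continuousOn_of_hasDerivAt {E : Type*} [NormedAddCommGroup E] [NormedSpace ℝ E]
    {f f' : ℝ → E} {s : Set ℝ} (hf : ∀ x ∈ s, HasDerivAt f (f' x) x) : ContinuousOn f s :=
  fun x hx => (hf x hx).continuousAt.continuousWithinAt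

lemma hasDerivAt_exp_I_mul {θ : ℝ → ℝ} {θ' x : ℝ} (hθ : HasDerivAt θ θ' x) :
    HasDerivAt (fun x => Complex.exp (Complex.I * θ x))
      (Complex.I * θ' * Complex.exp (Complex.I * θ x)) x :=
  (hθ.ofReal_comp.const_mul Complex.I).cexp.congr_deriv (mul_comm _ _)

lemma integral_deriv_mul_exp_mul (hx : x₁ ≤ x₂) {θ θ' : ℝ → ℝ} {v v' : ℝ → ℂ}
    (hθ : ∀ x ∈ Icc x₁ x₂, HasDerivAt θ (θ' x) x) (hθ' : ContinuousOn θ' (Icc x₁ x₂))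
    (hv : ∀ x ∈ Icc x₁ x₂, HasDerivAt v (v' x) x) (hv' : IntervalIntegrable v' volume x₁ x₂) :
    ∫ x in x₁..x₂, Complex.I * θ' x * Complex.exp (Complex.I * θ x) * v x =
      Complex.exp (Complex.I * θ x₂) * v x₂ - Complex.exp (Complex.I * θ x₁) * v x₁ -
        ∫ x in x₁..x₂, Complex.exp (Complex.I * θ x) * v' x := by
  rw [← uIcc_of_le hx] at hθ hθ' hv
  have hexp : ∀ x ∈ uIcc x₁ x₂, HasDerivAt (fun x => Complex.exp (Complex.I * θ x))
      (Complex.I * θ' x * Complex.exp (Complex.I * θ x)) x :=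
    fun x h => hasDerivAt_exp_I_mul (hθ x h)
  have hexp' : IntervalIntegrable (fun x => Complex.I * θ' x * Complex.exp (Complex.I * θ x))
      volume x₁ x₂ :=
    ((continuousOn_const.mul (Complex.continuous_ofReal.comp_continuousOn hθ')).mul
      (continuousOn_of_hasDerivAt hexp)).intervalIntegrable
  rw [intervalIntegral.integral_mul_deriv_eq_deriv_mul hexp hv hexp' hv', sub_sub_cancel]

lemma norm_integral_deriv_mul_exp_mul_le (hx : x₁ ≤ x₂) {θ θ' : ℝ → ℝ} {v v' : ℝ → ℂ}
    (hθ : ∀ x ∈ Icc x₁ x₂, HasDerivAt θ (θ' x) x) (hθ' : ContinuousOn θ' (Icc x₁ x₂))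
    (hv : ∀ x ∈ Icc x₁ x₂, HasDerivAt v (v' x) x) (hv' : IntervalIntegrable v' volume x₁ x₂) :
    ‖∫ x in x₁..x₂, θ' x * (Complex.exp (Complex.I * θ x) * v x)‖ ≤
      ‖v x₁‖ + ‖v x₂‖ + ‖∫ x in x₁..x₂, Complex.exp (Complex.I * θ x) * v' x‖ := by
  have hparts := integral_deriv_mul_exp_mul hx hθ hθ' hv hv'
  simp only [mul_assoc, intervalIntegral.integral_const_mul] at hparts
  have hnorm := congrArg norm hparts
  rw [norm_mul, Complex.norm_I, one_mul] at hnorm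
  rw [hnorm]
  refine (norm_sub_le _ _).trans (add_le_add_left ((norm_sub_le _ _).trans_eq ?_) _)
  simp only [norm_mul, Complex.norm_exp_I_mul_ofReal, one_mul, add_comm]

variable {μ ℓ : ℝ}

lemma abs_div_sq_add_sq_le (hμ : 0 < μ) (t : ℝ) : |t / (t ^ 2 + μ ^ 2)| ≤ 1 / (2 * μ) := by
  have hpos : 0 < t ^ 2 + μ ^ 2 := by positivity
  rw [abs_div, abs_of_pos hpos, div_le_div_iff₀ hpos (by positivity)]
  nlinarith [sq_nonneg (|t| - μ), sq_abs t]

lemma sq_div_sq_add_sq_le (hμ : 0 < μ) (hℓ : 0 < ℓ) {t d : ℝ} (h : ℓ ≤ |t| + d) :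
    μ ^ 2 / (t ^ 2 + μ ^ 2) ≤ μ / (2 * ℓ) + μ ^ 2 / ℓ * (d / (t ^ 2 + μ ^ 2)) := by
  have hpos : 0 < t ^ 2 + μ ^ 2 := by positivity
  have hstat := abs_div_sq_add_sq_le hμ t
  rw [abs_div, abs_of_pos hpos] at hstat
  calc μ ^ 2 / (t ^ 2 + μ ^ 2) ≤ μ ^ 2 / (t ^ 2 + μ ^ 2) * ((|t| + d) / ℓ) :=
        le_mul_of_one_le_right (by positivity) ((one_le_div hℓ).2 h)
    _ = μ ^ 2 / ℓ * (|t| / (t ^ 2 + μ ^ 2)) + μ ^ 2 / ℓ * (d / (t ^ 2 + μ ^ 2)) := by ring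
    _ ≤ μ ^ 2 / ℓ * (1 / (2 * μ)) + μ ^ 2 / ℓ * (d / (t ^ 2 + μ ^ 2)) := by gcongr
    _ = _ := by field_simp

lemma hasDerivAt_div_sq_add_sq (hμ : 0 < μ) {D : ℝ → ℝ} {D' x : ℝ} (hD : HasDerivAt D D' x) :
    HasDerivAt (fun x => D x / (D x ^ 2 + μ ^ 2))
      (D' * (μ ^ 2 - D x ^ 2) / (D x ^ 2 + μ ^ 2) ^ 2) x := by
  refine (hD.div ((hD.fun_pow 2).add_const (μ ^ 2)) (by positivity)).congr_deriv ?_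
  congr 1
  push_cast
  ring

lemma abs_deriv_div_sq_add_sq_le (hμ : 0 < μ) {d : ℝ} (hd : 0 ≤ d) (t : ℝ) :
    |d * (μ ^ 2 - t ^ 2) / (t ^ 2 + μ ^ 2) ^ 2| ≤ d / (t ^ 2 + μ ^ 2) := by
  have hpos : 0 < t ^ 2 + μ ^ 2 := by positivity
  have hdiff : |μ ^ 2 - t ^ 2| ≤ t ^ 2 + μ ^ 2 := by
    rw [abs_le]; constructor <;> nlinarith [sq_nonneg t, sq_nonneg μ]
  rw [abs_div, abs_of_pos (pow_pos hpos 2), abs_mul, abs_of_nonneg hd]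
  calc d * |μ ^ 2 - t ^ 2| / (t ^ 2 + μ ^ 2) ^ 2
      ≤ d * (t ^ 2 + μ ^ 2) / (t ^ 2 + μ ^ 2) ^ 2 := by gcongr
    _ = _ := by field_simp

variable {D D' : ℝ → ℝ}

lemma continuousOn_deriv_div_sq_add_sq (hμ : 0 < μ)
    (hD : ∀ x ∈ Icc x₁ x₂, HasDerivAt D (D' x) x) (hD' : ContinuousOn D' (Icc x₁ x₂)) :
    ContinuousOn (fun x => D' x / (D x ^ 2 + μ ^ 2)) (Icc x₁ x₂) :=
  hD'.div (((continuousOn_of_hasDerivAt hD).pow 2).add continuousOn_const)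
    fun x _ => by positivity

lemma integral_deriv_div_sq_add_sq_le (hx : x₁ ≤ x₂) (hμ : 0 < μ)
    (hD : ∀ x ∈ Icc x₁ x₂, HasDerivAt D (D' x) x) (hD' : ContinuousOn D' (Icc x₁ x₂)) :
    ∫ x in x₁..x₂, D' x / (D x ^ 2 + μ ^ 2) ≤ Real.pi / μ := by
  have hcont := continuousOn_deriv_div_sq_add_sq hμ hD hD'
  rw [← uIcc_of_le hx] at hcont hD
  have harctan : ∀ x ∈ uIcc x₁ x₂, HasDerivAt (fun x => Real.arctan (D x / μ) / μ)
      (D' x / (D x ^ 2 + μ ^ 2)) x := fun x h => by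
    refine (((hD x h).div_const μ).arctan.div_const μ).congr_deriv ?_
    field_simp
    ring
  rw [intervalIntegral.integral_eq_sub_of_hasDerivAt harctan hcont.intervalIntegrable, ← sub_div]
  gcongr
  linarith [Real.arctan_lt_pi_div_two (D x₂ / μ), Real.neg_pi_div_two_lt_arctan (D x₁ / μ)]

lemma norm_integral_le_of_norm_le_add_mul_deriv_div {E : Type*} [NormedAddCommGroup E]
    [NormedSpace ℝ E] (hx : x₁ ≤ x₂) (hμ : 0 < μ)
    (hD : ∀ x ∈ Icc x₁ x₂, HasDerivAt D (D' x) x) (hD' : ContinuousOn D' (Icc x₁ x₂))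
    {F : ℝ → E} {k m : ℝ} (hm : 0 ≤ m)
    (hF : ∀ x ∈ Icc x₁ x₂, ‖F x‖ ≤ k + m * (D' x / (D x ^ 2 + μ ^ 2))) :
    ‖∫ x in x₁..x₂, F x‖ ≤ k * (x₂ - x₁) + m * (Real.pi / μ) := by
  have hw : IntervalIntegrable (fun x => m * (D' x / (D x ^ 2 + μ ^ 2))) volume x₁ x₂ := by
    have hcont := continuousOn_deriv_div_sq_add_sq hμ hD hD'
    rw [← uIcc_of_le hx] at hcont
    exact hcont.intervalIntegrable.const_mul m
  calc ‖∫ x in x₁..x₂, F x‖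
      ≤ ∫ x in x₁..x₂, (k + m * (D' x / (D x ^ 2 + μ ^ 2))) :=
        intervalIntegral.norm_integral_le_of_norm_le hx
          (.of_forall fun x h => hF x (Ioc_subset_Icc_self h)) (intervalIntegrable_const.add hw)
    _ = k * (x₂ - x₁) + m * ∫ x in x₁..x₂, D' x / (D x ^ 2 + μ ^ 2) := by
        rw [intervalIntegral.integral_add intervalIntegrable_const hw,
          intervalIntegral.integral_const_mul, intervalIntegral.integral_const, smul_eq_mul,
          mul_comm k]
    _ ≤ _ := by gcongr; exact integral_deriv_div_sq_add_sq_le hx hμ hD hD'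

variable {N Q : ℝ} {θ θ' : ℝ → ℝ} {a q : ℝ → ℂ}

lemma norm_integral_deriv_mul_exp_mul_div_sq_add_sq_le (hx : x₁ ≤ x₂) (hμ : 0 < μ)
    (hθ : ∀ x ∈ Icc x₁ x₂, HasDerivAt θ (θ' x) x) (hθ' : ContinuousOn θ' (Icc x₁ x₂))
    (hD : ∀ x ∈ Icc x₁ x₂, HasDerivAt D (D' x) x) (hD' : ContinuousOn D' (Icc x₁ x₂))
    (hD0 : ∀ x ∈ Icc x₁ x₂, 0 ≤ D' x) (hq : ∀ x ∈ Icc x₁ x₂, DifferentiableAt ℝ q x)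
    (hqQ : ∀ x ∈ Icc x₁ x₂, ‖q x‖ ≤ Q) (hqQ' : ∀ x ∈ Icc x₁ x₂, ‖deriv q x‖ ≤ Q) :
    ‖∫ x in x₁..x₂, θ' x * (Complex.exp (Complex.I * θ x) *
        (q x * (D x / (D x ^ 2 + μ ^ 2) : ℝ)))‖ ≤
      Q / (2 * μ) * (x₂ - x₁ + 2) + Q * (Real.pi / μ) := by
  set G : ℝ → ℝ := fun x => D x / (D x ^ 2 + μ ^ 2)
  set G' : ℝ → ℝ := fun x => D' x * (μ ^ 2 - D x ^ 2) / (D x ^ 2 + μ ^ 2) ^ 2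
  set w : ℝ → ℝ := fun x => D' x / (D x ^ 2 + μ ^ 2)
  have hQ : 0 ≤ Q := (norm_nonneg _).trans (hqQ x₁ (left_mem_Icc.2 hx))
  have hG : ∀ x ∈ Icc x₁ x₂, HasDerivAt G (G' x) x :=
    fun x h => hasDerivAt_div_sq_add_sq hμ (hD x h)
  have hv : ∀ x ∈ Icc x₁ x₂, HasDerivAt (fun x => q x * (G x : ℂ))
      (deriv q x * G x + q x * G' x) x :=
    fun x h => (hq x h).hasDerivAt.mul (hG x h).ofReal_comp
  have hv_le : ∀ x ∈ Icc x₁ x₂, ‖q x * (G x : ℂ)‖ ≤ Q / (2 * μ) := fun x h => by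
    rw [norm_mul, Complex.norm_real, div_eq_mul_one_div]
    exact mul_le_mul (hqQ x h) (abs_div_sq_add_sq_le hμ _) (norm_nonneg _) hQ
  have hv'_le : ∀ x ∈ Icc x₁ x₂, ‖deriv q x * G x + q x * G' x‖ ≤ Q / (2 * μ) + Q * w x :=
    fun x h => by
    refine norm_add_le_of_le ?_ ?_
    · rw [norm_mul, Complex.norm_real, div_eq_mul_one_div]
      exact mul_le_mul (hqQ' x h) (abs_div_sq_add_sq_le hμ _) (norm_nonneg _) hQ
    · rw [norm_mul, Complex.norm_real]
      exact mul_le_mul (hqQ x h) (abs_deriv_div_sq_add_sq_le hμ (hD0 x h) _) (norm_nonneg _) hQ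
  have hv'_int : IntervalIntegrable (fun x => deriv q x * G x + q x * G' x) volume x₁ x₂ := by
    have hderiv : EqOn (deriv fun x => q x * (G x : ℂ))
        (fun x => deriv q x * G x + q x * G' x) (Icc x₁ x₂) := fun x h => (hv x h).deriv
    have hw := (continuousOn_deriv_div_sq_add_sq hμ hD hD').const_mul Q
    rw [intervalIntegrable_iff_integrableOn_Icc_of_le hx, ← integrableOn_congr_fun hderiv
      measurableSet_Icc]
    refine ((continuousOn_const (c := Q / (2 * μ))).add hw).integrableOn_Icc.mono'
      (measurable_deriv _).aestronglyMeasurable ?_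
    filter_upwards [ae_restrict_mem measurableSet_Icc] with x h
    exact (congrArg norm (hderiv h)).trans_le (hv'_le x h)
  refine (norm_integral_deriv_mul_exp_mul_le hx hθ hθ' hv hv'_int).trans ?_
  have hrem := norm_integral_le_of_norm_le_add_mul_deriv_div
    (F := fun x => Complex.exp (Complex.I * θ x) * (deriv q x * G x + q x * G' x)) hx hμ hD hD' hQ
    fun x h => by rw [norm_mul, Complex.norm_exp_I_mul_ofReal, one_mul]; exact hv'_le x h
  linarith [hv_le x₁ (left_mem_Icc.2 hx), hv_le x₂ (right_mem_Icc.2 hx)]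

lemma norm_integral_mul_sq_div_sq_add_sq_le (hx : x₁ ≤ x₂) (hμ : 0 < μ) (hℓ : 0 < ℓ)
    (hD : ∀ x ∈ Icc x₁ x₂, HasDerivAt D (D' x) x) (hD' : ContinuousOn D' (Icc x₁ x₂))
    (hlow : ∀ x ∈ Icc x₁ x₂, ℓ ≤ |D x| + D' x) (haQ : ∀ x ∈ Icc x₁ x₂, ‖a x‖ ≤ Q) :
    ‖∫ x in x₁..x₂, a x * (μ ^ 2 / (D x ^ 2 + μ ^ 2) : ℝ)‖ ≤
      Q * (μ / (2 * ℓ)) * (x₂ - x₁) + Q * (μ ^ 2 / ℓ) * (Real.pi / μ) := by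
  have hQ : 0 ≤ Q := (norm_nonneg _).trans (haQ x₁ (left_mem_Icc.2 hx))
  refine norm_integral_le_of_norm_le_add_mul_deriv_div hx hμ hD hD' (by positivity) fun x h => ?_
  rw [norm_mul, Complex.norm_real, Real.norm_of_nonneg (by positivity)]
  calc ‖a x‖ * (μ ^ 2 / (D x ^ 2 + μ ^ 2))
      ≤ Q * (μ / (2 * ℓ) + μ ^ 2 / ℓ * (D' x / (D x ^ 2 + μ ^ 2))) := by
        gcongr
        exacts [haQ x h, sq_div_sq_add_sq_le hμ hℓ (hlow x h)]
    _ = _ := by ring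

lemma norm_integral_exp_mul_le_of_deriv_nonneg (hx : x₁ ≤ x₂) (hN : N ≠ 0) (hℓ : 0 < ℓ)
    (hθ : ∀ x ∈ Icc x₁ x₂, HasDerivAt θ (θ' x) x) (hθ' : ContinuousOn θ' (Icc x₁ x₂))
    (hD : ∀ x ∈ Icc x₁ x₂, HasDerivAt D (D' x) x) (hD' : ContinuousOn D' (Icc x₁ x₂))
    (hD0 : ∀ x ∈ Icc x₁ x₂, 0 ≤ D' x) (hq : ∀ x ∈ Icc x₁ x₂, DifferentiableAt ℝ q x)
    (ha : ContinuousOn a (Icc x₁ x₂)) (hfac : ∀ x ∈ Icc x₁ x₂, (θ' x : ℂ) * q x = N * D x * a x)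
    (haQ : ∀ x ∈ Icc x₁ x₂, ‖a x‖ ≤ Q) (hqQ : ∀ x ∈ Icc x₁ x₂, ‖q x‖ ≤ Q)
    (hqQ' : ∀ x ∈ Icc x₁ x₂, ‖deriv q x‖ ≤ Q) (hlow : ∀ x ∈ Icc x₁ x₂, ℓ ≤ |D x| + |D' x|) :
    ‖∫ x in x₁..x₂, Complex.exp (Complex.I * θ x) * a x‖
      ≤ Q * (x₂ - x₁ + 8) / √(|N| * ℓ) := by
  have hN' : 0 < |N| := abs_pos.2 hN
  have hNC : (N : ℂ) ≠ 0 := by exact_mod_cast hN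
  have hQ : 0 ≤ Q := (norm_nonneg _).trans (hqQ x₁ (left_mem_Icc.2 hx))
  have hL : 0 ≤ x₂ - x₁ := sub_nonneg.2 hx
  obtain ⟨μ, hμ, rfl⟩ : ∃ μ, 0 < μ ∧ ℓ = |N| * μ ^ 2 :=
    ⟨√(ℓ / |N|), by positivity, by rw [Real.sq_sqrt (by positivity)]; field_simp⟩
  have hsqrt : √(|N| * (|N| * μ ^ 2)) = |N| * μ := by
    rw [← mul_assoc, Real.sqrt_mul' _ (sq_nonneg μ), Real.sqrt_mul_self hN'.le, Real.sqrt_sq hμ.le]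
  set F₁ : ℝ → ℂ := fun x => θ' x * (Complex.exp (Complex.I * θ x) *
    (q x * (D x / (D x ^ 2 + μ ^ 2) : ℝ)))
  set F₂ : ℝ → ℂ := fun x => Complex.exp (Complex.I * θ x) * a x * (μ ^ 2 / (D x ^ 2 + μ ^ 2) : ℝ)
  have hF₁ := norm_integral_deriv_mul_exp_mul_div_sq_add_sq_le hx hμ hθ hθ' hD hD' hD0 hq hqQ hqQ'
  have hF₂ : ‖∫ x in x₁..x₂, F₂ x‖ ≤ _ := norm_integral_mul_sq_div_sq_add_sq_le hx hμ hℓ hD hD'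
    (fun x h => by simpa only [abs_of_nonneg (hD0 x h)] using hlow x h)
    (fun x h => by simpa only [norm_mul, Complex.norm_exp_I_mul_ofReal, one_mul] using haQ x h)
  -- `1 = D² / (D² + μ²) + μ² / (D² + μ²)`, and the first part of the integrand contains `θ'`
  have hsplit : ∫ x in x₁..x₂, Complex.exp (Complex.I * θ x) * a x =
      (N : ℂ)⁻¹ * (∫ x in x₁..x₂, F₁ x) + ∫ x in x₁..x₂, F₂ x := by
    have hDc := continuousOn_of_hasDerivAt hD
    have hθc := continuousOn_of_hasDerivAt hθ
    have hqc : ContinuousOn q (Icc x₁ x₂) :=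
      continuousOn_of_hasDerivAt fun x h => (hq x h).hasDerivAt
    have hpos : ∀ x ∈ Icc x₁ x₂, D x ^ 2 + μ ^ 2 ≠ 0 := fun x _ => by positivity
    rw [← uIcc_of_le hx] at ha hqc hDc hθc hθ' hpos hfac
    rw [← intervalIntegral.integral_const_mul, ← intervalIntegral.integral_add
      (ContinuousOn.intervalIntegrable (by fun_prop (disch := assumption)))
      (ContinuousOn.intervalIntegrable (by fun_prop (disch := assumption)))]
    refine intervalIntegral.integral_congr fun x h => ?_
    have hD₀ : (D x : ℂ) ^ 2 + (μ : ℂ) ^ 2 ≠ 0 := by exact_mod_cast hpos x h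
    simp only [F₁, F₂]
    push_cast
    field_simp
    linear_combination -(D x : ℂ) * hfac x h
  rw [hsplit, hsqrt]
  calc _ ≤ |N|⁻¹ * (Q / (2 * μ) * (x₂ - x₁ + 2) + Q * (Real.pi / μ)) +
        (Q * (μ / (2 * (|N| * μ ^ 2))) * (x₂ - x₁) +
          Q * (μ ^ 2 / (|N| * μ ^ 2)) * (Real.pi / μ)) := by
        refine norm_add_le_of_le ?_ hF₂
        rw [norm_mul, norm_inv, Complex.norm_real, Real.norm_eq_abs]
        gcongr
    _ = Q * ((x₂ - x₁) + (1 + 2 * Real.pi)) / (|N| * μ) := by field_simp; ring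
    _ ≤ Q * (x₂ - x₁ + 8) / (|N| * μ) := by
        gcongr
        linarith [Real.pi_lt_d2]

/- A van der Corput estimate in which `D = θ' q / (N a)` takes the part of the derivative of the
phase: the bound only asks that `D` and `D'` do not vanish together. -/
theorem norm_integral_exp_mul_le (hx : x₁ ≤ x₂) (hN : N ≠ 0) (hℓ : 0 < ℓ)
    (hθ : ∀ x ∈ Icc x₁ x₂, HasDerivAt θ (θ' x) x) (hθ' : ContinuousOn θ' (Icc x₁ x₂))
    (hD : ∀ x ∈ Icc x₁ x₂, HasDerivAt D (D' x) x) (hD' : ContinuousOn D' (Icc x₁ x₂))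
    (hD0 : (∀ x ∈ Icc x₁ x₂, 0 ≤ D' x) ∨ (∀ x ∈ Icc x₁ x₂, D' x ≤ 0))
    (hq : ∀ x ∈ Icc x₁ x₂, DifferentiableAt ℝ q x) (ha : ContinuousOn a (Icc x₁ x₂))
    (hfac : ∀ x ∈ Icc x₁ x₂, (θ' x : ℂ) * q x = N * D x * a x)
    (haQ : ∀ x ∈ Icc x₁ x₂, ‖a x‖ ≤ Q) (hqQ : ∀ x ∈ Icc x₁ x₂, ‖q x‖ ≤ Q)
    (hqQ' : ∀ x ∈ Icc x₁ x₂, ‖deriv q x‖ ≤ Q) (hlow : ∀ x ∈ Icc x₁ x₂, ℓ ≤ |D x| + |D' x|) :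
    ‖∫ x in x₁..x₂, Complex.exp (Complex.I * θ x) * a x‖
      ≤ Q * (x₂ - x₁ + 8) / √(|N| * ℓ) := by
  rcases hD0 with hD0 | hD0
  · exact norm_integral_exp_mul_le_of_deriv_nonneg hx hN hℓ hθ hθ' hD hD' hD0 hq ha hfac haQ hqQ
      hqQ' hlow
  · rw [← abs_neg N]
    refine norm_integral_exp_mul_le_of_deriv_nonneg (D := -D) (D' := -D') hx (neg_ne_zero.2 hN) hℓ
      hθ hθ' (fun x h => (hD x h).neg) hD'.neg (fun x h => neg_nonneg.2 (hD0 x h)) hq ha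
      (fun x h => ?_) haQ hqQ hqQ' (fun x h => by simpa using hlow x h)
    simpa using hfac x h

end VanDerCorput

section MonomialPhase

lemma exists_bound_of_contDiffOn {E F : Type*} [NormedAddCommGroup E] [NormedSpace ℝ E]
    [NormedAddCommGroup F] [NormedSpace ℝ F] {f : E → F} {U K : Set E} (hU : IsOpen U)
    (hf : ContDiffOn ℝ 1 f U) (hK : IsCompact K) (hKU : K ⊆ U) :
    ∃ C : ℝ, 0 ≤ C ∧ ∀ p ∈ K, ‖f p‖ ≤ C ∧ ‖fderiv ℝ f p‖ ≤ C := by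
  obtain ⟨C₁, h₁⟩ := hK.exists_bound_of_continuousOn (hf.continuousOn.mono hKU)
  obtain ⟨C₂, h₂⟩ := hK.exists_bound_of_continuousOn
    ((hf.continuousOn_fderiv_of_isOpen hU le_rfl).mono hKU)
  exact ⟨max 0 (max C₁ C₂), le_max_left _ _, fun p hp =>
    ⟨(h₁ p hp).trans ((le_max_left _ _).trans (le_max_right _ _)),
      (h₂ p hp).trans ((le_max_right _ _).trans (le_max_right _ _))⟩⟩

/-- A polynomial phase with a single critical point `r = ρ` in `r > 0`, normalised to vanish there;
up to a linear change of variables it is `r ^ (n + 1)` plus a multiple of `r ^ n`. -/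
def monoPhase (n : ℕ) (r ρ : ℝ) : ℝ := n * r ^ (n + 1) - (n + 1) * ρ * r ^ n + ρ ^ (n + 1)

/-- The oscillatory integral over `[r₁, r₂]` with amplitude `a` and phase `c` times `monoPhase`, as
a function of the critical point `ρ` of the phase. -/
def oscInt (n : ℕ) (a : ℝ → ℂ) (r₁ r₂ c ρ : ℝ) : ℂ :=
  ∫ r in r₁..r₂, Complex.exp (Complex.I * (c * monoPhase n r ρ : ℝ)) * a r

/-- The polynomial `(r ^ n - ρ ^ n) / (r - ρ)`. -/
def geomQuot (n : ℕ) (r ρ : ℝ) : ℝ := ∑ i ∈ Finset.range n, r ^ i * ρ ^ (n - 1 - i)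

lemma geomQuot_mul (n : ℕ) (r ρ : ℝ) : geomQuot n r ρ * (r - ρ) = r ^ n - ρ ^ n :=
  (Commute.all r ρ).geom_sum₂_mul n

lemma contDiff_geomQuot (n : ℕ) : ContDiff ℝ ∞ fun p : ℝ × ℝ => geomQuot n p.1 p.2 := by
  unfold geomQuot; fun_prop

lemma hasDerivAt_monoPhase_left (n : ℕ) (r ρ : ℝ) :
    HasDerivAt (fun r => monoPhase n r ρ) (n * (n + 1) * r ^ (n - 1) * (r - ρ)) r := by
  unfold monoPhase
  have h := (((hasDerivAt_pow (n + 1) r).const_mul (n : ℝ)).sub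
    ((hasDerivAt_pow n r).const_mul ((n + 1) * ρ))).add_const (ρ ^ (n + 1))
  refine h.congr_deriv ?_
  rcases n with _ | n
  · simp
  · push_cast [Nat.add_sub_cancel]; ring

lemma hasDerivAt_monoPhase_right (n : ℕ) (r ρ : ℝ) :
    HasDerivAt (fun ρ => monoPhase n r ρ) ((n + 1) * (ρ ^ n - r ^ n)) ρ := by
  unfold monoPhase
  have h := (((hasDerivAt_id ρ).const_mul ((n : ℝ) + 1)).mul_const (r ^ n)).const_sub
    (n * r ^ (n + 1)) |>.add (hasDerivAt_pow (n + 1) ρ)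
  refine h.congr_deriv ?_
  push_cast [Nat.add_sub_cancel]
  ring

variable {n : ℕ} {a : ℝ → ℂ} {r₁ r₂ : ℝ}

lemma contDiffOn_div_pow {k : WithTop ℕ∞} (ha : ContDiffOn ℝ k a (Ioi 0)) {c : ℂ} (hc : c ≠ 0)
    (i : ℕ) : ContDiffOn ℝ k (fun r : ℝ => a r / (c * (r : ℂ) ^ i)) (Ioi 0) := by
  have hofReal : ContDiff ℝ k fun r : ℝ => (r : ℂ) := Complex.ofRealCLM.contDiff
  simp only [div_eq_mul_inv]
  refine ha.mul ((contDiff_const.mul (hofReal.pow i)).contDiffOn.inv fun r hr => ?_)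
  exact mul_ne_zero hc (pow_ne_zero _ (Complex.ofReal_ne_zero.2 (ne_of_gt hr)))

lemma exists_bound_amplitude (hr₁ : 0 < r₁) (hn : n ≠ 0) (ha : ContDiffOn ℝ 1 a (Ioi 0)) :
    ∃ C : ℝ, 0 ≤ C ∧ ∀ r ∈ Icc r₁ r₂, ‖a r‖ ≤ C ∧
      ‖a r / (n * (n + 1) * (r : ℂ) ^ (n - 1))‖ ≤ C ∧
      ‖deriv (fun r : ℝ => a r / (n * (n + 1) * (r : ℂ) ^ (n - 1))) r‖ ≤ C := by
  have hsub : Icc r₁ r₂ ⊆ Ioi 0 := fun r hr => hr₁.trans_le hr.1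
  have hc : (n * (n + 1) : ℂ) ≠ 0 :=
    mul_ne_zero (Nat.cast_ne_zero.2 hn) (by exact_mod_cast n.succ_ne_zero)
  obtain ⟨C₁, hC₁, h₁⟩ := exists_bound_of_contDiffOn isOpen_Ioi ha isCompact_Icc hsub
  obtain ⟨C₂, hC₂, h₂⟩ := exists_bound_of_contDiffOn isOpen_Ioi
    (contDiffOn_div_pow ha hc (n - 1)) isCompact_Icc hsub
  refine ⟨C₁ + C₂, by positivity, fun r hr => ⟨?_, ?_, ?_⟩⟩
  · linarith [(h₁ r hr).1]
  · linarith [(h₂ r hr).1]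
  · rw [norm_deriv_eq_norm_fderiv]; linarith [(h₂ r hr).2]

lemma differentiableAt_div_pow (ha : ContDiffOn ℝ 1 a (Ioi 0)) (hn : n ≠ 0) {r : ℝ} (hr : 0 < r) :
    DifferentiableAt ℝ (fun r : ℝ => a r / (n * (n + 1) * (r : ℂ) ^ (n - 1))) r :=
  have hc : (n * (n + 1) : ℂ) ≠ 0 :=
    mul_ne_zero (Nat.cast_ne_zero.2 hn) (by exact_mod_cast n.succ_ne_zero)
  ((contDiffOn_div_pow ha hc (n - 1)).differentiableOn one_ne_zero).differentiableAt
    (Ioi_mem_nhds hr)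

lemma deriv_phase_mul_div_pow (hn : n ≠ 0) {r : ℝ} (hr : 0 < r) (c ρ : ℝ) :
    ((c * (n * (n + 1) * r ^ (n - 1) * (r - ρ)) : ℝ) : ℂ) *
      (a r / (n * (n + 1) * (r : ℂ) ^ (n - 1))) = c * (r - ρ : ℝ) * a r := by
  have hr0 : (r : ℂ) ≠ 0 := Complex.ofReal_ne_zero.2 hr.ne'
  have hn0 : (n : ℂ) ≠ 0 := Nat.cast_ne_zero.2 hn
  have hn1 : (n + 1 : ℂ) ≠ 0 := by exact_mod_cast n.succ_ne_zero
  push_cast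
  field_simp

lemma exists_norm_oscInt_le (hr₁ : 0 < r₁) (hr : r₁ ≤ r₂) (hn : n ≠ 0)
    (ha : ContDiffOn ℝ 1 a (Ioi 0)) :
    ∃ K : ℝ, 0 ≤ K ∧ ∀ c : ℝ, c ≠ 0 → ∀ ρ, ‖oscInt n a r₁ r₂ c ρ‖ ≤ K / √|c| := by
  obtain ⟨C, hC, hbound⟩ := exists_bound_amplitude (r₂ := r₂) hr₁ hn ha
  have hL : 0 ≤ r₂ - r₁ := sub_nonneg.2 hr
  refine ⟨C * (r₂ - r₁ + 8), by positivity, fun c hc ρ => ?_⟩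
  rw [← mul_one |c|]
  exact norm_integral_exp_mul_le (D := fun r => r - ρ) (D' := fun _ => 1) hr hc one_pos
    (fun r _ => (hasDerivAt_monoPhase_left n r ρ).const_mul c) (by fun_prop)
    (fun r _ => (hasDerivAt_id r).sub_const ρ) continuousOn_const (Or.inl fun _ _ => zero_le_one)
    (fun r h => differentiableAt_div_pow ha hn (hr₁.trans_le h.1))
    (ha.continuousOn.mono fun r h => hr₁.trans_le h.1)
    (fun r h => deriv_phase_mul_div_pow hn (hr₁.trans_le h.1) c ρ)
    (fun r h => (hbound r h).1) (fun r h => (hbound r h).2.1) (fun r h => (hbound r h).2.2)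
    fun r _ => by simp

lemma hasDerivAt_div_sub {q : ℝ → ℂ} {r ρ : ℝ} (hq : DifferentiableAt ℝ q r) (hρ : r - ρ ≠ 0) :
    HasDerivAt (fun r => q r / (r - ρ : ℝ))
      (deriv q r / (r - ρ : ℝ) - q r / ((r - ρ : ℝ) : ℂ) ^ 2) r := by
  have hne : ((r - ρ : ℝ) : ℂ) ≠ 0 := Complex.ofReal_ne_zero.2 hρ
  refine (hq.hasDerivAt.div ((hasDerivAt_id r).sub_const ρ).ofReal_comp hne).congr_deriv ?_
  simp only [id, Complex.ofReal_one]
  field_simp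

lemma norm_div_sub_le {z : ℂ} {C η r ρ : ℝ} (hη : 0 < η) (hsep : η ≤ |r - ρ|) (hz : ‖z‖ ≤ C)
    (i : ℕ) : ‖z / ((r - ρ : ℝ) : ℂ) ^ i‖ ≤ C / η ^ i := by
  have hC : 0 ≤ C := (norm_nonneg _).trans hz
  rw [norm_div, norm_pow, Complex.norm_real, Real.norm_eq_abs]
  gcongr

lemma norm_integral_deriv_mul_exp_mul_div_sub_le (hr : r₁ ≤ r₂) {θ θ' : ℝ → ℝ} {q : ℝ → ℂ}
    {C η ρ : ℝ} (hη : 0 < η) (hsep : ∀ r ∈ Icc r₁ r₂, η ≤ |r - ρ|)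
    (hθ : ∀ r ∈ Icc r₁ r₂, HasDerivAt θ (θ' r) r) (hθ' : ContinuousOn θ' (Icc r₁ r₂))
    (hq : ∀ r ∈ Icc r₁ r₂, DifferentiableAt ℝ q r) (hqC : ∀ r ∈ Icc r₁ r₂, ‖q r‖ ≤ C)
    (hqC' : ∀ r ∈ Icc r₁ r₂, ‖deriv q r‖ ≤ C) :
    ‖∫ r in r₁..r₂, θ' r * (Complex.exp (Complex.I * θ r) * (q r / (r - ρ : ℝ)))‖ ≤
      2 * (C / η) + (C / η + C / η ^ 2) * (r₂ - r₁) := by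
  set v' : ℝ → ℂ := fun r => deriv q r / (r - ρ : ℝ) - q r / ((r - ρ : ℝ) : ℂ) ^ 2
  have hv : ∀ r ∈ Icc r₁ r₂, HasDerivAt (fun r => q r / (r - ρ : ℝ)) (v' r) r := fun r h =>
    hasDerivAt_div_sub (hq r h) (abs_pos.1 (hη.trans_le (hsep r h)))
  have hv_le : ∀ r ∈ Icc r₁ r₂, ‖q r / (r - ρ : ℝ)‖ ≤ C / η := fun r h => by
    simpa only [pow_one] using norm_div_sub_le hη (hsep r h) (hqC r h) 1
  have hv'_le : ∀ r ∈ Icc r₁ r₂, ‖v' r‖ ≤ C / η + C / η ^ 2 := fun r h =>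
    norm_sub_le_of_le (by simpa only [pow_one] using norm_div_sub_le hη (hsep r h) (hqC' r h) 1)
      (norm_div_sub_le hη (hsep r h) (hqC r h) 2)
  have hv'_int : IntervalIntegrable v' volume r₁ r₂ := by
    have hderiv : EqOn (deriv fun r => q r / (r - ρ : ℝ)) v' (Icc r₁ r₂) :=
      fun r h => (hv r h).deriv
    rw [intervalIntegrable_iff_integrableOn_Icc_of_le hr,
      ← integrableOn_congr_fun hderiv measurableSet_Icc]
    refine Measure.integrableOn_of_bounded (M := C / η + C / η ^ 2) measure_Icc_lt_top.ne
      (measurable_deriv _).aestronglyMeasurable ?_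
    filter_upwards [ae_restrict_mem measurableSet_Icc] with r h
    exact (congrArg norm (hderiv h)).trans_le (hv'_le r h)
  have hrem := intervalIntegral.norm_integral_le_of_norm_le_const (a := r₁) (b := r₂)
    (f := fun r => Complex.exp (Complex.I * θ r) * v' r) (C := C / η + C / η ^ 2) fun r h => by
      rw [uIoc_of_le hr] at h
      rw [norm_mul, Complex.norm_exp_I_mul_ofReal, one_mul]
      exact hv'_le r (Ioc_subset_Icc_self h)
  rw [abs_of_nonneg (sub_nonneg.2 hr)] at hrem
  refine (norm_integral_deriv_mul_exp_mul_le hr hθ hθ' hv hv'_int).trans ?_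
  linarith [hv_le r₁ (left_mem_Icc.2 hr), hv_le r₂ (right_mem_Icc.2 hr)]

lemma exists_norm_oscInt_le_of_notMem (hr₁ : 0 < r₁) (hr : r₁ ≤ r₂) (hn : n ≠ 0)
    (ha : ContDiffOn ℝ 1 a (Ioi 0)) :
    ∃ K : ℝ, 0 ≤ K ∧ ∀ c : ℝ, c ≠ 0 → ∀ ρ, ρ ∉ Icc (r₁ / 2) (2 * r₂) →
      ‖oscInt n a r₁ r₂ c ρ‖ ≤ K / |c| := by
  obtain ⟨C, hC, hbound⟩ := exists_bound_amplitude (r₂ := r₂) hr₁ hn ha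
  have hL : 0 ≤ r₂ - r₁ := sub_nonneg.2 hr
  have hη : 0 < r₁ / 2 := by positivity
  refine ⟨2 * (C / (r₁ / 2)) + (C / (r₁ / 2) + C / (r₁ / 2) ^ 2) * (r₂ - r₁), by positivity,
    fun c hc ρ hρ => ?_⟩
  have hsep : ∀ r ∈ Icc r₁ r₂, r₁ / 2 ≤ |r - ρ| := fun r h => by
    rw [mem_Icc, not_and_or, not_le, not_le] at hρ
    rw [le_abs]
    rcases hρ with hlt | hgt
    · exact Or.inl (by linarith [h.1])
    · exact Or.inr (by linarith [h.1, h.2])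
  have hparts := norm_integral_deriv_mul_exp_mul_div_sub_le hr hη hsep
    (fun r _ => (hasDerivAt_monoPhase_left n r ρ).const_mul c) (by fun_prop)
    (fun r h => differentiableAt_div_pow ha hn (hr₁.trans_le h.1))
    (fun r h => (hbound r h).2.1) (fun r h => (hbound r h).2.2)
  have hosc : ∫ r in r₁..r₂, ((c * (n * (n + 1) * r ^ (n - 1) * (r - ρ)) : ℝ) : ℂ) *
      (Complex.exp (Complex.I * (c * monoPhase n r ρ : ℝ)) *
        (a r / (n * (n + 1) * (r : ℂ) ^ (n - 1)) / (r - ρ : ℝ))) =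
      c * oscInt n a r₁ r₂ c ρ := by
    rw [oscInt, ← intervalIntegral.integral_const_mul]
    refine intervalIntegral.integral_congr fun r h => ?_
    rw [uIcc_of_le hr] at h
    have hrρ : ((r - ρ : ℝ) : ℂ) ≠ 0 :=
      Complex.ofReal_ne_zero.2 (abs_pos.1 (hη.trans_le (hsep r h)))
    have hfac := deriv_phase_mul_div_pow (a := a) hn (hr₁.trans_le h.1) c ρ
    rw [mul_left_comm, mul_div_assoc', hfac]
    field_simp
  rw [hosc, norm_mul, Complex.norm_real, Real.norm_eq_abs] at hparts
  exact (le_div_iff₀' (abs_pos.2 hc)).2 hparts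

lemma hasDerivAt_oscInt (n : ℕ) (c ρ : ℝ) (ha : ContinuousOn a (uIcc r₁ r₂)) :
    HasDerivAt (oscInt n a r₁ r₂ c)
      (∫ r in r₁..r₂, Complex.exp (Complex.I * (c * monoPhase n r ρ : ℝ)) *
        (Complex.I * (c * ((n + 1) * (ρ ^ n - r ^ n)) : ℝ)) * a r) ρ := by
  set F : ℝ → ℝ → ℂ := fun ρ r => Complex.exp (Complex.I * (c * monoPhase n r ρ : ℝ)) * a r
  set F' : ℝ → ℝ → ℂ := fun ρ r => Complex.exp (Complex.I * (c * monoPhase n r ρ : ℝ)) *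
    (Complex.I * (c * ((n + 1) * (ρ ^ n - r ^ n)) : ℝ)) * a r
  set S : Set (ℝ × ℝ) := Icc (ρ - 1) (ρ + 1) ×ˢ uIcc r₁ r₂
  have ha' : ContinuousOn (fun p : ℝ × ℝ => a p.2) S := ha.comp continuousOn_snd fun p hp => hp.2
  have hexp : Continuous fun p : ℝ × ℝ =>
      Complex.exp (Complex.I * (c * monoPhase n p.2 p.1 : ℝ)) := by unfold monoPhase; fun_prop
  have hF : ContinuousOn (fun p : ℝ × ℝ => F p.1 p.2) S := hexp.continuousOn.mul ha'
  have hF' : ContinuousOn (fun p : ℝ × ℝ => F' p.1 p.2) S :=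
    (hexp.mul (by fun_prop)).continuousOn.mul ha'
  have hslice : ∀ {G : ℝ → ℝ → ℂ} {x : ℝ}, ContinuousOn (fun p : ℝ × ℝ => G p.1 p.2) S →
      x ∈ Icc (ρ - 1) (ρ + 1) → IntervalIntegrable (G x) volume r₁ r₂ := fun {G x} hG hx =>
    ContinuousOn.intervalIntegrable
      (hG.comp (f := fun r => (x, r)) (by fun_prop) fun r hr => ⟨hx, hr⟩)
  have hmem : Icc (ρ - 1) (ρ + 1) ∈ nhds ρ := Icc_mem_nhds (by linarith) (by linarith)
  obtain ⟨B, hB⟩ := (isCompact_Icc.prod isCompact_uIcc).exists_bound_of_continuousOn hF'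
  refine (intervalIntegral.hasDerivAt_integral_of_dominated_loc_of_deriv_le
    (F := F) (F' := F') (bound := fun _ => B) hmem ?_ (hslice hF (mem_of_mem_nhds hmem))
    (hslice hF' (mem_of_mem_nhds hmem)).aestronglyMeasurable_restrict_uIoc
    (.of_forall fun r hr x hx => hB (x, r) ⟨hx, uIoc_subset_uIcc hr⟩) (by simp)
    (.of_forall fun r _ x _ => ?_)).2
  · filter_upwards [hmem] with x hx using (hslice hF hx).aestronglyMeasurable_restrict_uIoc
  · exact (((((hasDerivAt_monoPhase_right n r x).const_mul c).ofReal_comp).const_mul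
      Complex.I).cexp).mul_const (a r)

lemma continuous_oscInt (n : ℕ) (c : ℝ) (ha : ContinuousOn a (uIcc r₁ r₂)) :
    Continuous (oscInt n a r₁ r₂ c) :=
  continuous_iff_continuousAt.2 fun ρ => (hasDerivAt_oscInt n c ρ ha).continuousAt

lemma integral_deriv_phase_mul_exp_mul (hr : r₁ ≤ r₂) (c ρ : ℝ) {v : ℝ → ℂ} {U : Set ℝ}
    (hU : IsOpen U) (hsub : Icc r₁ r₂ ⊆ U) (hv : ContDiffOn ℝ 1 v U) (hv₁ : v r₁ = 0)
    (hv₂ : v r₂ = 0) :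
    ∫ r in r₁..r₂, Complex.I * (c * (n * (n + 1) * r ^ (n - 1) * (r - ρ)) : ℝ) *
      Complex.exp (Complex.I * (c * monoPhase n r ρ : ℝ)) * v r =
      -oscInt n (deriv v) r₁ r₂ c ρ := by
  have hderiv : ∀ r ∈ Icc r₁ r₂, HasDerivAt v (deriv v r) r := fun r h =>
    ((hv.differentiableOn one_ne_zero).differentiableAt (hU.mem_nhds (hsub h))).hasDerivAt
  have hcont := (hv.continuousOn_deriv_of_isOpen hU le_rfl).mono hsub
  rw [← uIcc_of_le hr] at hcont
  rw [integral_deriv_mul_exp_mul hr (fun r _ => (hasDerivAt_monoPhase_left n r ρ).const_mul c)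
    (by fun_prop) hderiv hcont.intervalIntegrable, hv₁, hv₂, mul_zero, mul_zero, sub_zero,
    zero_sub, oscInt]

/- The factor `ρ ^ n - r ^ n` that differentiation in `ρ` produces vanishes at the critical point,
so an integration by parts absorbs it and the large factor `c`. -/
lemma deriv_oscInt (hr₁ : 0 < r₁) (hr : r₁ ≤ r₂) (hn : n ≠ 0) (ha : ContDiffOn ℝ 1 a (Ioi 0))
    (ha₁ : a r₁ = 0) (ha₂ : a r₂ = 0) (c ρ : ℝ) :
    deriv (oscInt n a r₁ r₂ c) ρ = ∑ i ∈ Finset.range n, (ρ : ℂ) ^ (n - 1 - i) *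
      oscInt n (deriv fun r : ℝ => (r : ℂ) ^ i * (a r / (n * (r : ℂ) ^ (n - 1)))) r₁ r₂ c ρ := by
  have hsub : uIcc r₁ r₂ ⊆ Ioi 0 := fun r h => hr₁.trans_le (uIcc_of_le hr ▸ h).1
  have hn0 : (n : ℂ) ≠ 0 := Nat.cast_ne_zero.2 hn
  have hofReal : ContDiff ℝ 1 fun r : ℝ => (r : ℂ) := Complex.ofRealCLM.contDiff
  set b : ℝ → ℂ := fun r => a r / (n * (r : ℂ) ^ (n - 1)) with hb_def
  have hb : ∀ i, ContDiffOn ℝ 1 (fun r : ℝ => (r : ℂ) ^ i * b r) (Ioi 0) := fun i =>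
    (hofReal.pow i).contDiffOn.mul (contDiffOn_div_pow ha hn0 (n - 1))
  set X : ℝ → ℂ := fun r => Complex.I * (c * (n * (n + 1) * r ^ (n - 1) * (r - ρ)) : ℝ) *
    Complex.exp (Complex.I * (c * monoPhase n r ρ : ℝ)) with hX_def
  have hparts : ∀ i, oscInt n
      (deriv fun r : ℝ => (r : ℂ) ^ i * (a r / (n * (r : ℂ) ^ (n - 1)))) r₁ r₂ c ρ =
      -∫ r in r₁..r₂, X r * ((r : ℂ) ^ i * b r) := fun i => by
    rw [integral_deriv_phase_mul_exp_mul hr c ρ isOpen_Ioi (uIcc_of_le hr ▸ hsub) (hb i)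
      (by simp [hb_def, ha₁]) (by simp [hb_def, ha₂]), neg_neg]
  have hX : Continuous X := by simp only [hX_def, monoPhase]; fun_prop
  rw [(hasDerivAt_oscInt n c ρ (ha.continuousOn.mono hsub)).deriv]
  simp only [hparts, mul_neg, ← intervalIntegral.integral_const_mul, Finset.sum_neg_distrib]
  have hint : ∀ i, IntervalIntegrable
      (fun r : ℝ => (ρ : ℂ) ^ (n - 1 - i) * (X r * ((r : ℂ) ^ i * b r))) volume r₁ r₂ := fun i =>
    (continuousOn_const.mul
      (hX.continuousOn.mul ((hb i).continuousOn.mono hsub))).intervalIntegrable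
  rw [← intervalIntegral.integral_finsetSum fun i _ => hint i, ← intervalIntegral.integral_neg]
  refine intervalIntegral.integral_congr fun r h => ?_
  have hr0 : (r : ℂ) ≠ 0 := Complex.ofReal_ne_zero.2 (ne_of_gt (hsub h))
  have hgeom := (Commute.all (r : ℂ) ρ).geom_sum₂_mul n
  have hsum : ∑ i ∈ Finset.range n, (ρ : ℂ) ^ (n - 1 - i) * (X r * ((r : ℂ) ^ i * b r)) =
      X r * b r * ∑ i ∈ Finset.range n, (r : ℂ) ^ i * (ρ : ℂ) ^ (n - 1 - i) := by
    rw [Finset.mul_sum]; exact Finset.sum_congr rfl fun i _ => by ring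
  have hXb : X r * b r = Complex.I * c * (n + 1) * (r - ρ) *
      Complex.exp (Complex.I * (c * monoPhase n r ρ : ℝ)) * a r := by
    simp only [hX_def, hb_def]; push_cast; field_simp
  rw [hsum, hXb]
  push_cast
  linear_combination Complex.exp (Complex.I * (c * monoPhase n r ρ)) * Complex.I * c * (n + 1) *
    a r * hgeom

lemma exists_norm_deriv_oscInt_le (hr₁ : 0 < r₁) (hr : r₁ ≤ r₂) (hn : n ≠ 0)
    (ha : ContDiffOn ℝ 2 a (Ioi 0)) (ha₁ : a r₁ = 0) (ha₂ : a r₂ = 0) (R : ℝ) :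
    ∃ K : ℝ, 0 ≤ K ∧ ∀ c : ℝ, c ≠ 0 → ∀ ρ, |ρ| ≤ R →
      ‖deriv (oscInt n a r₁ r₂ c) ρ‖ ≤ K / √|c| := by
  have hofReal : ContDiff ℝ 2 fun r : ℝ => (r : ℂ) := Complex.ofRealCLM.contDiff
  have hamp : ∀ i, ContDiffOn ℝ 1
      (deriv fun r : ℝ => (r : ℂ) ^ i * (a r / (n * (r : ℂ) ^ (n - 1)))) (Ioi 0) := fun i =>
    ((hofReal.pow i).contDiffOn.mul
      (contDiffOn_div_pow ha (Nat.cast_ne_zero.2 hn) (n - 1))).deriv_of_isOpen isOpen_Ioi le_rfl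
  choose K hK hK_le using fun i => exists_norm_oscInt_le hr₁ hr hn (hamp i)
  refine ⟨∑ i ∈ Finset.range n, |R| ^ (n - 1 - i) * K i,
    Finset.sum_nonneg fun i _ => mul_nonneg (by positivity) (hK i), fun c hc ρ hρ => ?_⟩
  rw [deriv_oscInt hr₁ hr hn (ha.of_le one_le_two) ha₁ ha₂, Finset.sum_div]
  refine norm_sum_le_of_le _ fun i _ => ?_
  rw [norm_mul, norm_pow, Complex.norm_real, Real.norm_eq_abs, mul_div_assoc]
  refine mul_le_mul ?_ (hK_le i c hc ρ) (norm_nonneg _) (by positivity)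
  exact pow_le_pow_left₀ (abs_nonneg ρ) (hρ.trans (le_abs_self R)) _

end MonomialPhase

section RootKernel

/-- The root `u ^ (1 / (n + 1))`; note the shift of the index. -/
def nthRoot (n : ℕ) (u : ℝ) : ℝ := u ^ (((n + 1 : ℕ) : ℝ)⁻¹)

variable {n : ℕ} {u v : ℝ}

lemma nthRoot_pow (hu : 0 ≤ u) : nthRoot n u ^ (n + 1) = u :=
  Real.rpow_inv_natCast_pow hu n.succ_ne_zero

lemma pow_nthRoot (hu : 0 ≤ u) : nthRoot n (u ^ (n + 1)) = u :=
  Real.pow_rpow_inv_natCast hu n.succ_ne_zero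

lemma nthRoot_pos (hu : 0 < u) : 0 < nthRoot n u := Real.rpow_pos_of_pos hu _

lemma nthRoot_le_nthRoot (hu : 0 ≤ u) (huv : u ≤ v) : nthRoot n u ≤ nthRoot n v :=
  Real.rpow_le_rpow hu huv (by positivity)

lemma continuous_nthRoot (n : ℕ) : Continuous (nthRoot n) :=
  Real.continuous_rpow_const (by positivity)

lemma contDiffOn_nthRoot (n : ℕ) : ContDiffOn ℝ 1 (nthRoot n) (Ioi 0) := fun _ hu =>
  (Real.contDiffAt_rpow_const_of_ne (ne_of_gt hu)).contDiffWithinAt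

lemma hasDerivAt_nthRoot (hu : 0 < u) :
    HasDerivAt (nthRoot n) (1 / ((n + 1) * nthRoot n u ^ n)) u := by
  have hroot := nthRoot_pos (n := n) hu
  refine (Real.hasDerivAt_rpow_const (Or.inl hu.ne')).congr_deriv ?_
  rw [Real.rpow_sub hu, Real.rpow_one]
  change _ * (nthRoot n u / u) = _
  nth_rewrite 2 [← nthRoot_pow (n := n) hu.le]
  push_cast
  rw [pow_succ]
  field_simp

lemma nthRoot_mem_Icc_iff (hu : 0 < u) :
    nthRoot n u ∈ Icc (1 / 2 : ℝ) 2 ↔ u ∈ Icc ((1 / 2 : ℝ) ^ (n + 1)) (2 ^ (n + 1)) := by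
  have hroot := (nthRoot_pos (n := n) hu).le
  conv_rhs => rw [← nthRoot_pow (n := n) hu.le]
  exact and_congr (pow_le_pow_iff_left₀ (by norm_num) hroot n.succ_ne_zero).symm
    (pow_le_pow_iff_left₀ hroot zero_le_two n.succ_ne_zero).symm

/-- The range of `X` for which the root of `U - X` lies in `[1 / 2, 2]`. -/
def rootDomain (n : ℕ) (U : ℝ) : Set ℝ := {X | X < U ∧ nthRoot n (U - X) ∈ Icc (1 / 2 : ℝ) 2}

lemma rootDomain_eq_Icc (n : ℕ) (U : ℝ) :
    rootDomain n U = Icc (U - 2 ^ (n + 1)) (U - (1 / 2) ^ (n + 1)) := by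
  have hpow : (0 : ℝ) < (1 / 2) ^ (n + 1) := by positivity
  ext X
  constructor
  · rintro ⟨hXU, hX⟩
    rw [nthRoot_mem_Icc_iff (sub_pos.2 hXU)] at hX
    exact ⟨by linarith [hX.2], by linarith [hX.1]⟩
  · rintro ⟨hlow, hup⟩
    have hXU : X < U := by linarith
    exact ⟨hXU, (nthRoot_mem_Icc_iff (sub_pos.2 hXU)).2 ⟨by linarith, by linarith⟩⟩

/-- The affine function `κ (s - (δ U + β))` of the root `s = (U - X) ^ (1 / (n + 1))`. -/
def rootArg (n : ℕ) (κ δ β X U : ℝ) : ℝ := κ * (nthRoot n (U - X) - (δ * U + β))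

variable {κ δ β U V X : ℝ}

lemma continuous_rootArg (n : ℕ) (κ δ β U : ℝ) : Continuous fun X => rootArg n κ δ β X U :=
  (((continuous_nthRoot n).comp (continuous_const.sub continuous_id)).sub
    continuous_const).const_mul κ

lemma hasDerivAt_nthRoot_sub (hXU : X < U) : HasDerivAt (fun X => nthRoot n (U - X))
    (-(1 / ((n + 1) * nthRoot n (U - X) ^ n))) X :=
  ((hasDerivAt_nthRoot (sub_pos.2 hXU)).comp X ((hasDerivAt_id X).const_sub U)).congr_deriv
    (by ring)

lemma hasDerivAt_rootArg (hXU : X < U) : HasDerivAt (fun X => rootArg n κ δ β X U)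
    (κ * -(1 / ((n + 1) * nthRoot n (U - X) ^ n))) X :=
  ((hasDerivAt_nthRoot_sub hXU).sub_const _).const_mul κ

lemma hasDerivAt_rootArg_pow (hXU : X < U) :
    HasDerivAt (fun X => rootArg n κ δ β X U ^ (n + 1))
      (-(κ * (rootArg n κ δ β X U / nthRoot n (U - X)) ^ n)) X := by
  have hroot := nthRoot_pos (n := n) (sub_pos.2 hXU)
  refine ((hasDerivAt_rootArg hXU).fun_pow (n + 1)).congr_deriv ?_
  rw [Nat.add_sub_cancel, div_pow]
  push_cast
  field_simp

lemma one_div_mul_pow_le {r : ℝ} (hr : 1 / 2 ≤ r) : 1 / ((n + 1) * r ^ n) ≤ 2 ^ n := by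
  have hr₀ : 0 < r := by linarith
  rw [div_le_iff₀ (by positivity)]
  calc (1 : ℝ) ≤ (n + 1) * (2 * r) ^ n :=
        one_le_mul_of_one_le_of_one_le (by linarith [(Nat.cast_nonneg n : (0 : ℝ) ≤ n)])
          (one_le_pow₀ (by linarith))
    _ = _ := by rw [mul_pow]; ring

lemma abs_deriv_nthRoot_sub_le (hX : X ∈ rootDomain n U) :
    |-(1 / ((n + 1) * nthRoot n (U - X) ^ n))| ≤ 2 ^ n := by
  have hroot := nthRoot_pos (n := n) (sub_pos.2 hX.1)
  rw [abs_neg, abs_of_pos (by positivity)]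
  exact one_div_mul_pow_le hX.2.1

lemma geomQuot_pos (hn : n ≠ 0) (hu : 0 < u) (hv : 0 < v) : 0 < geomQuot n u v :=
  Finset.sum_pos (fun i _ => by positivity) ⟨0, Finset.mem_range.2 (Nat.pos_of_ne_zero hn)⟩

lemma mul_geomQuot_succ (n : ℕ) (u v : ℝ) :
    u * geomQuot (n + 1) v u = ∑ i ∈ Finset.range (n + 1), v ^ i * u ^ (n + 1 - i) := by
  rw [geomQuot, Finset.mul_sum]
  refine Finset.sum_congr rfl fun i hi => ?_
  rw [show n + 1 - i = n + 1 - 1 - i + 1 by have := Finset.mem_range.1 hi; omega, pow_succ]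
  ring

/-- The sum `s (s ^ n + s ^ (n - 1) t + ⋯ + t ^ n)` formed with the roots `s` of `U - X` and `t` of
`V - X`. -/
def rootSum (n : ℕ) (U V X : ℝ) : ℝ :=
  nthRoot n (U - X) * geomQuot (n + 1) (nthRoot n (V - X)) (nthRoot n (U - X))

lemma abs_rootSum_le (hU : X ∈ rootDomain n U) (hV : X ∈ rootDomain n V) :
    |rootSum n U V X| ≤ (n + 1) * 2 ^ (n + 1) := by
  have hs := nthRoot_pos (n := n) (sub_pos.2 hU.1)
  have ht := nthRoot_pos (n := n) (sub_pos.2 hV.1)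
  rw [rootSum, abs_of_pos (mul_pos hs (geomQuot_pos n.succ_ne_zero ht hs)), mul_geomQuot_succ]
  calc ∑ i ∈ Finset.range (n + 1), nthRoot n (V - X) ^ i * nthRoot n (U - X) ^ (n + 1 - i)
      ≤ ∑ i ∈ Finset.range (n + 1), (2 : ℝ) ^ i * 2 ^ (n + 1 - i) :=
        Finset.sum_le_sum fun i _ => mul_le_mul (pow_le_pow_left₀ ht.le hV.2.2 _)
          (pow_le_pow_left₀ hs.le hU.2.2 _) (by positivity) (by positivity)
    _ = ∑ _i ∈ Finset.range (n + 1), (2 : ℝ) ^ (n + 1) := Finset.sum_congr rfl fun i hi => by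
        rw [← pow_add, Nat.add_sub_cancel' (Finset.mem_range.1 hi).le]
    _ = _ := by simp

lemma contDiffOn_rootSum (n : ℕ) (U V : ℝ) :
    ContDiffOn ℝ 1 (rootSum n U V) (Iio U ∩ Iio V) := by
  have hroot (W : ℝ) : ContDiffOn ℝ 1 (fun X => nthRoot n (W - X)) (Iio W) :=
    (contDiffOn_nthRoot n).comp (contDiff_const.sub contDiff_id).contDiffOn
      fun X hX => mem_Ioi.2 (sub_pos.2 hX)
  have hs := (hroot U).mono (inter_subset_left (t := Iio V))
  have ht := (hroot V).mono (inter_subset_right (s := Iio U))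
  exact hs.mul (((contDiff_geomQuot (n + 1)).of_le (by simp)).comp_contDiffOn (ht.prodMk hs))

lemma antitoneOn_rootSum_add_id (n : ℕ) (U V : ℝ) :
    AntitoneOn (fun X => rootSum n U V X + X) (Iio U ∩ Iio V) := by
  intro X _ Y hY hXY
  have hs := nthRoot_pos (n := n) (sub_pos.2 hY.1)
  have ht := nthRoot_pos (n := n) (sub_pos.2 hY.2)
  have hUX : 0 ≤ U - X := sub_nonneg.2 (hXY.trans (le_of_lt hY.1))
  have hs_le : nthRoot n (U - Y) ≤ nthRoot n (U - X) :=
    nthRoot_le_nthRoot (sub_pos.2 hY.1).le (by linarith)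
  have ht_le : nthRoot n (V - Y) ≤ nthRoot n (V - X) :=
    nthRoot_le_nthRoot (sub_pos.2 hY.2).le (by linarith)
  have ht_nonneg : 0 ≤ nthRoot n (V - X) := ht.le.trans ht_le
  simp only [rootSum, mul_geomQuot_succ, Finset.sum_range_succ', pow_zero, one_mul, Nat.sub_zero,
    nthRoot_pow hUX, nthRoot_pow (sub_pos.2 hY.1).le, sub_add_cancel, add_assoc]
  gcongr

lemma deriv_rootSum_le (hU : X < U) (hV : X < V) : deriv (rootSum n U V) X ≤ -1 := by
  have hopen : IsOpen (Iio U ∩ Iio V) := isOpen_Iio.inter isOpen_Iio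
  have hdiff : DifferentiableAt ℝ (rootSum n U V) X :=
    ((contDiffOn_rootSum n U V).differentiableOn one_ne_zero).differentiableAt
      (hopen.mem_nhds ⟨hU, hV⟩)
  have hsum := (antitoneOn_rootSum_add_id n U V).derivWithin_nonpos (x := X)
  rw [derivWithin_of_isOpen hopen ⟨hU, hV⟩, deriv_fun_add hdiff differentiableAt_fun_id,
    deriv_id''] at hsum
  linarith

lemma div_le_abs_sub_add_abs_mul {α δ S S' C : ℝ} (hC : 1 ≤ C) (hS : |S| ≤ C) (hS' : S' ≤ -1) :
    |α| / C ≤ |δ * S - α| + |δ * S'| := by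
  have hα : |α| ≤ |δ * S - α| + |δ| * |S| := by
    rw [← abs_mul, abs_sub_comm]
    linarith [abs_sub_abs_le_abs_sub α (δ * S)]
  have hδ : |δ| ≤ |δ * S'| := by
    rw [abs_mul]
    exact le_mul_of_one_le_right (abs_nonneg _) (by rw [abs_of_nonpos (by linarith)]; linarith)
  rw [div_le_iff₀ (one_pos.trans_le hC)]
  calc |α| ≤ |δ * S - α| * C + |δ * S'| * C :=
        hα.trans (add_le_add (le_mul_of_one_le_right (abs_nonneg _) hC) (by gcongr))
    _ = _ := by ring

/-- The kernel `1_{X < U} exp (-i c p ^ (n + 1)) A(p) b(s)`, where `s = (U - X) ^ (1 / (n + 1))` and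
`p = κ (s - (δ U + β))`, of the operator to which the `T T*` argument is applied. -/
def rootKernel (n : ℕ) (b : ℝ → ℝ) (A : ℝ → ℂ) (c κ δ β X U : ℝ) : ℂ :=
  if X < U then
    Complex.exp (Complex.I * (-c * rootArg n κ δ β X U ^ (n + 1) : ℝ)) *
      (A (rootArg n κ δ β X U) * b (nthRoot n (U - X)))
  else 0

variable {b : ℝ → ℝ} {A : ℝ → ℂ} {c : ℝ}

/-- The phase `-c (p ^ (n + 1) - p' ^ (n + 1))` of the product `k(X, U) conj k(X, V)` of two values
of `rootKernel`. -/
def kernelPhase (n : ℕ) (c κ δ β U V X : ℝ) : ℝ :=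
  -c * (rootArg n κ δ β X U ^ (n + 1) - rootArg n κ δ β X V ^ (n + 1))

/-- The derivative of `kernelPhase` in `X`. -/
def kernelPhaseDeriv (n : ℕ) (c κ δ β U V X : ℝ) : ℝ :=
  c * κ * ((rootArg n κ δ β X U / nthRoot n (U - X)) ^ n -
    (rootArg n κ δ β X V / nthRoot n (V - X)) ^ n)

lemma hasDerivAt_kernelPhase (hU : X < U) (hV : X < V) :
    HasDerivAt (kernelPhase n c κ δ β U V) (kernelPhaseDeriv n c κ δ β U V X) X :=
  (((hasDerivAt_rootArg_pow hU).sub (hasDerivAt_rootArg_pow hV)).const_mul (-c)).congr_deriv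
    (by unfold kernelPhaseDeriv; ring)

lemma continuousOn_kernelPhaseDeriv (n : ℕ) (c κ δ β U V : ℝ) :
    ContinuousOn (kernelPhaseDeriv n c κ δ β U V) (Iio U ∩ Iio V) := by
  have hquot (W : ℝ) : ContinuousOn (fun X => (rootArg n κ δ β X W / nthRoot n (W - X)) ^ n)
      (Iio W) :=
    (((continuous_rootArg n κ δ β W).continuousOn).div
      ((continuous_nthRoot n).comp (continuous_const.sub continuous_id)).continuousOn
      fun X hX => (nthRoot_pos (sub_pos.2 hX)).ne').pow n
  exact continuousOn_const.mul (((hquot U).mono inter_subset_left).sub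
    ((hquot V).mono inter_subset_right))

/- With `s`, `t` the two roots and `p`, `p'` the two values of `rootArg`, the difference
`(p / s) ^ n - (p' / t) ^ n` contains the factor `p / s - p' / t`, and `s t (p / s - p' / t)` is
`κ (δ s (V - U) - (δ U + β) (t - s))`. Since `t ^ (n + 1) - s ^ (n + 1) = V - U`, a factor `V - U`
splits off. -/
lemma kernelPhaseDeriv_mul (hU : X < U) (hV : X < V) :
    kernelPhaseDeriv n c κ δ β U V X * (nthRoot n (U - X) * nthRoot n (V - X) *
        geomQuot (n + 1) (nthRoot n (V - X)) (nthRoot n (U - X))) =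
      c * κ ^ 2 * (V - U) * (δ * rootSum n U V X - (δ * U + β)) *
        geomQuot n (rootArg n κ δ β X U / nthRoot n (U - X))
          (rootArg n κ δ β X V / nthRoot n (V - X)) := by
  have hs := nthRoot_pos (n := n) (sub_pos.2 hU)
  have ht := nthRoot_pos (n := n) (sub_pos.2 hV)
  have hpow := geomQuot_mul (n + 1) (nthRoot n (V - X)) (nthRoot n (U - X))
  rw [nthRoot_pow (sub_pos.2 hU).le, nthRoot_pow (sub_pos.2 hV).le] at hpow
  unfold kernelPhaseDeriv rootSum
  have hquot := geomQuot_mul n (rootArg n κ δ β X U / nthRoot n (U - X))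
    (rootArg n κ δ β X V / nthRoot n (V - X))
  rw [← hquot]
  have hdiff : (rootArg n κ δ β X U / nthRoot n (U - X) - rootArg n κ δ β X V / nthRoot n (V - X)) *
      (nthRoot n (U - X) * nthRoot n (V - X)) = κ * (δ * (V - U) * nthRoot n (U - X) -
        (δ * U + β) * (nthRoot n (V - X) - nthRoot n (U - X))) := by
    unfold rootArg
    field_simp
    ring
  generalize geomQuot n (rootArg n κ δ β X U / nthRoot n (U - X))
    (rootArg n κ δ β X V / nthRoot n (V - X)) = R at *
  linear_combination
    (c * κ * R * geomQuot (n + 1) (nthRoot n (V - X)) (nthRoot n (U - X))) * hdiff -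
    c * κ ^ 2 * R * (δ * U + β) * hpow

/-- The quotient of `b(s) b(t)` by the non-degenerate factor of `kernelPhaseDeriv`, as a function of
`(s, t, p, p')`. -/
def phaseQuot (n : ℕ) (b : ℝ → ℝ) (y : ℝ × ℝ × ℝ × ℝ) : ℝ :=
  b y.1 * b y.2.1 * (y.1 * y.2.1 * geomQuot (n + 1) y.2.1 y.1) *
    (geomQuot n (y.2.2.1 / y.1) (y.2.2.2 / y.2.1))⁻¹

/-- The open positive orthant of `ℝ⁴`. -/
def orthant : Set (ℝ × ℝ × ℝ × ℝ) := Ioi 0 ×ˢ Ioi 0 ×ˢ Ioi 0 ×ˢ Ioi 0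

lemma isOpen_orthant : IsOpen orthant :=
  isOpen_Ioi.prod (isOpen_Ioi.prod (isOpen_Ioi.prod isOpen_Ioi))

lemma contDiffOn_phaseQuot (hn : n ≠ 0) (hb : ContDiffOn ℝ 1 b (Ioi 0)) :
    ContDiffOn ℝ 1 (phaseQuot n b) orthant := by
  have hs : ContDiffOn ℝ 1 (fun y : ℝ × ℝ × ℝ × ℝ => y.1) orthant := contDiff_fst.contDiffOn
  have ht : ContDiffOn ℝ 1 (fun y : ℝ × ℝ × ℝ × ℝ => y.2.1) orthant :=
    ContDiff.contDiffOn (by fun_prop)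
  have hp : ContDiffOn ℝ 1 (fun y : ℝ × ℝ × ℝ × ℝ => y.2.2.1) orthant :=
    ContDiff.contDiffOn (by fun_prop)
  have hp' : ContDiffOn ℝ 1 (fun y : ℝ × ℝ × ℝ × ℝ => y.2.2.2) orthant :=
    ContDiff.contDiffOn (by fun_prop)
  have hgeom (k : ℕ) : ContDiff ℝ 1 fun p : ℝ × ℝ => geomQuot k p.1 p.2 :=
    (contDiff_geomQuot k).of_le (by simp)
  have hquot : ContDiffOn ℝ 1 (fun y : ℝ × ℝ × ℝ × ℝ =>
      geomQuot n (y.2.2.1 / y.1) (y.2.2.2 / y.2.1)) orthant :=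
    (hgeom n).comp_contDiffOn ((hp.div hs fun y hy => hy.1.ne').prodMk
      (hp'.div ht fun y hy => hy.2.1.ne'))
  exact (((hb.comp hs fun y hy => hy.1).mul (hb.comp ht fun y hy => hy.2.1)).mul
    ((hs.mul ht).mul ((hgeom (n + 1)).comp_contDiffOn (ht.prodMk hs)))).mul
    (hquot.inv fun y hy => (geomQuot_pos hn (div_pos hy.2.2.1 hy.1)
      (div_pos hy.2.2.2 hy.2.1)).ne')

/-- The curve `X ↦ (s, t, p, p')` of the two roots and the two values of `rootArg`. -/
def rootCurve (n : ℕ) (κ δ β U V X : ℝ) : ℝ × ℝ × ℝ × ℝ :=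
  (nthRoot n (U - X), nthRoot n (V - X), rootArg n κ δ β X U, rootArg n κ δ β X V)

/-- The points `X` of `rootDomain n U` at which `rootArg` has a value in `[R₁, R₂]`. -/
def rootArgDomain (n : ℕ) (κ δ β R₁ R₂ U : ℝ) : Set ℝ :=
  rootDomain n U ∩ {X | rootArg n κ δ β X U ∈ Icc R₁ R₂}

variable {R₁ R₂ κ₀ : ℝ}

lemma kernelPhaseDeriv_mul_phaseQuot (hn : n ≠ 0) (hU : X < U) (hV : X < V)
    (hpU : 0 < rootArg n κ δ β X U) (hpV : 0 < rootArg n κ δ β X V) (b : ℝ → ℝ) :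
    kernelPhaseDeriv n c κ δ β U V X * phaseQuot n b (rootCurve n κ δ β U V X) =
      c * κ ^ 2 * (V - U) * (δ * rootSum n U V X - (δ * U + β)) *
        (b (nthRoot n (U - X)) * b (nthRoot n (V - X))) := by
  have hgeom := geomQuot_pos hn (div_pos hpU (nthRoot_pos (n := n) (sub_pos.2 hU)))
    (div_pos hpV (nthRoot_pos (n := n) (sub_pos.2 hV)))
  unfold phaseQuot rootCurve
  rw [← div_eq_mul_inv, ← mul_div_assoc, div_eq_iff hgeom.ne']
  linear_combination b (nthRoot n (U - X)) * b (nthRoot n (V - X)) *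
    kernelPhaseDeriv_mul (n := n) (c := c) (κ := κ) (δ := δ) (β := β) hU hV

lemma exists_hasDerivAt_rootCurve (hκ : |κ| ≤ κ₀) (hU : X ∈ rootDomain n U)
    (hV : X ∈ rootDomain n V) : ∃ y' : ℝ × ℝ × ℝ × ℝ, ‖y'‖ ≤ 2 ^ n * (1 + κ₀) ∧
      HasDerivAt (rootCurve n κ δ β U V) y' X := by
  have hκ₀ : 0 ≤ κ₀ := (abs_nonneg κ).trans hκ
  refine ⟨_, ?_, (hasDerivAt_nthRoot_sub hU.1).prodMk ((hasDerivAt_nthRoot_sub hV.1).prodMk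
    ((hasDerivAt_rootArg hU.1).prodMk (hasDerivAt_rootArg hV.1)))⟩
  have hpow : (0 : ℝ) < 2 ^ n := by positivity
  have hroot {y : ℝ} (hy : |y| ≤ 2 ^ n) : |y| ≤ 2 ^ n * (1 + κ₀) := by nlinarith
  have harg {y : ℝ} (hy : |y| ≤ 2 ^ n) : |κ * y| ≤ 2 ^ n * (1 + κ₀) := by
    rw [abs_mul]
    calc |κ| * |y| ≤ κ₀ * 2 ^ n := by gcongr
      _ ≤ _ := by nlinarith
  have hsU := abs_deriv_nthRoot_sub_le hU
  have hsV := abs_deriv_nthRoot_sub_le hV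
  exact max_le (hroot hsU) (max_le (hroot hsV) (max_le (harg hsU) (harg hsV)))

lemma exists_bound_phaseQuot (hn : n ≠ 0) (hb : ContDiffOn ℝ 1 b (Ioi 0)) (hR₁ : 0 < R₁) (R₂ : ℝ)
    (hκ₀ : 0 ≤ κ₀) : ∃ C : ℝ, 0 ≤ C ∧ ∀ {κ δ β U V X : ℝ}, |κ| ≤ κ₀ →
      X ∈ rootArgDomain n κ δ β R₁ R₂ U → X ∈ rootArgDomain n κ δ β R₁ R₂ V →
      DifferentiableAt ℝ (fun X => phaseQuot n b (rootCurve n κ δ β U V X)) X ∧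
        |phaseQuot n b (rootCurve n κ δ β U V X)| ≤ C ∧
        |deriv (fun X => phaseQuot n b (rootCurve n κ δ β U V X)) X| ≤ C := by
  have hcompact : IsCompact (Icc (1 / 2 : ℝ) 2 ×ˢ Icc (1 / 2 : ℝ) 2 ×ˢ Icc R₁ R₂ ×ˢ Icc R₁ R₂) :=
    isCompact_Icc.prod (isCompact_Icc.prod (isCompact_Icc.prod isCompact_Icc))
  have hsub : Icc (1 / 2 : ℝ) 2 ×ˢ Icc (1 / 2 : ℝ) 2 ×ˢ Icc R₁ R₂ ×ˢ Icc R₁ R₂ ⊆ orthant :=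
    fun y hy => ⟨one_half_pos.trans_le hy.1.1, one_half_pos.trans_le hy.2.1.1,
      hR₁.trans_le hy.2.2.1.1, hR₁.trans_le hy.2.2.2.1⟩
  have hsmooth := contDiffOn_phaseQuot hn hb
  obtain ⟨C, hC, hbound⟩ := exists_bound_of_contDiffOn isOpen_orthant hsmooth hcompact hsub
  refine ⟨C * (2 ^ n * (1 + κ₀)) + C, by positivity, ?_⟩
  intro κ δ β U V X hκ hU hV
  obtain ⟨y', hy', hcurve⟩ := exists_hasDerivAt_rootCurve (δ := δ) (β := β) hκ hU.1 hV.1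
  have hmem : rootCurve n κ δ β U V X ∈ _ := hsub ⟨hU.1.2, hV.1.2, hU.2, hV.2⟩
  obtain ⟨hval, hfderiv⟩ := hbound (rootCurve n κ δ β U V X) ⟨hU.1.2, hV.1.2, hU.2, hV.2⟩
  have hcomp : HasDerivAt (fun X => phaseQuot n b (rootCurve n κ δ β U V X)) _ X :=
    ((hsmooth.differentiableOn one_ne_zero).differentiableAt
      (isOpen_orthant.mem_nhds hmem)).hasFDerivAt.comp_hasDerivAt X hcurve
  refine ⟨hcomp.differentiableAt, hval.trans (le_add_of_nonneg_left (by positivity)), ?_⟩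
  rw [← Real.norm_eq_abs, hcomp.deriv]
  exact ((ContinuousLinearMap.le_opNorm _ _).trans
    (mul_le_mul hfderiv hy' (norm_nonneg _) hC)).trans (le_add_of_nonneg_right hC)

lemma norm_deriv_mul_mul_le {f g h : ℝ → ℂ} {x B B' C : ℝ} (hf : DifferentiableAt ℝ f x)
    (hg : DifferentiableAt ℝ g x) (hh : DifferentiableAt ℝ h x) (hfB : ‖f x‖ ≤ B)
    (hgB : ‖g x‖ ≤ B) (hhC : ‖h x‖ ≤ C) (hfB' : ‖deriv f x‖ ≤ B') (hgB' : ‖deriv g x‖ ≤ B')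
    (hhC' : ‖deriv h x‖ ≤ C) :
    ‖deriv (fun y => f y * g y * h y) x‖ ≤ (2 * B' * B + B ^ 2) * C := by
  have hB : 0 ≤ B := (norm_nonneg _).trans hfB
  have hB' : 0 ≤ B' := (norm_nonneg _).trans hfB'
  rw [deriv_fun_mul (hf.fun_mul hg) hh, deriv_fun_mul hf hg]
  calc _ ≤ (‖deriv f x‖ * ‖g x‖ + ‖f x‖ * ‖deriv g x‖) * ‖h x‖ +
        ‖f x‖ * ‖g x‖ * ‖deriv h x‖ := by
        refine norm_add_le_of_le ?_ (by rw [norm_mul, norm_mul])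
        rw [norm_mul]
        gcongr
        exact norm_add_le_of_le (norm_mul_le _ _) (norm_mul_le _ _)
    _ ≤ (B' * B + B * B') * C + B * B * C := by gcongr
    _ = _ := by ring

lemma differentiable_conj (hA : Differentiable ℝ A) : Differentiable ℝ fun p => conj (A p) :=
  fun p => (hA p).star

lemma norm_deriv_conj (A : ℝ → ℂ) (p : ℝ) : ‖deriv (fun p => conj (A p)) p‖ = ‖deriv A p‖ := by
  change ‖deriv (fun p => star (A p)) p‖ = _
  rw [deriv.star, norm_star]

lemma norm_deriv_comp_rootArg_le {B : ℝ} (hA : Differentiable ℝ A) (hκ : |κ| ≤ κ₀)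
    (hX : X ∈ rootDomain n U) (hB : ‖deriv A (rootArg n κ δ β X U)‖ ≤ B) :
    DifferentiableAt ℝ (fun X => A (rootArg n κ δ β X U)) X ∧
      ‖deriv (fun X => A (rootArg n κ δ β X U)) X‖ ≤ 2 ^ n * κ₀ * B := by
  have hcomp : HasDerivAt (fun X => A (rootArg n κ δ β X U)) _ X :=
    (hA _).hasDerivAt.scomp X (hasDerivAt_rootArg hX.1)
  refine ⟨hcomp.differentiableAt, ?_⟩
  rw [hcomp.deriv, norm_smul, Real.norm_eq_abs, abs_mul]
  rw [mul_comm _ κ₀]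
  have hκ₀ : 0 ≤ κ₀ := (abs_nonneg κ).trans hκ
  have hroot := abs_deriv_nthRoot_sub_le hX
  gcongr

lemma norm_deriv_mul_conj_mul_phaseQuot_le {B C : ℝ} (hA : Differentiable ℝ A)
    (hAB : ∀ p ∈ Icc R₁ R₂, ‖A p‖ ≤ B ∧ ‖deriv A p‖ ≤ B) (hκ₀ : |κ| ≤ κ₀)
    (hU : X ∈ rootArgDomain n κ δ β R₁ R₂ U) (hV : X ∈ rootArgDomain n κ δ β R₁ R₂ V)
    (hP : DifferentiableAt ℝ (fun X => phaseQuot n b (rootCurve n κ δ β U V X)) X)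
    (hPC : |phaseQuot n b (rootCurve n κ δ β U V X)| ≤ C)
    (hPC' : |deriv (fun X => phaseQuot n b (rootCurve n κ δ β U V X)) X| ≤ C) :
    DifferentiableAt ℝ (fun X => A (rootArg n κ δ β X U) * conj (A (rootArg n κ δ β X V)) *
        (phaseQuot n b (rootCurve n κ δ β U V X) : ℂ)) X ∧
      ‖deriv (fun X => A (rootArg n κ δ β X U) * conj (A (rootArg n κ δ β X V)) *
        (phaseQuot n b (rootCurve n κ δ β U V X) : ℂ)) X‖
        ≤ (2 * (2 ^ n * κ₀) + 1) * B ^ 2 * C := by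
  obtain ⟨hAU, hAU'⟩ := norm_deriv_comp_rootArg_le hA hκ₀ hU.1 (hAB _ hU.2).2
  obtain ⟨hAV, hAV'⟩ := norm_deriv_comp_rootArg_le (differentiable_conj hA) hκ₀ hV.1
    ((norm_deriv_conj A _).trans_le (hAB _ hV.2).2)
  have hPder := hP.hasDerivAt.ofReal_comp
  refine ⟨(hAU.fun_mul hAV).fun_mul hPder.differentiableAt, ?_⟩
  refine (norm_deriv_mul_mul_le (C := C) hAU hAV hPder.differentiableAt (hAB _ hU.2).1
    ((RCLike.norm_conj _).trans_le (hAB _ hV.2).1) ?_ hAU' hAV' ?_).trans_eq (by ring)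
  · rwa [Complex.norm_real]
  · rwa [hPder.deriv, Complex.norm_real]

lemma norm_mul_conj_mul_ofReal_le {z w : ℂ} {r B C : ℝ} (hz : ‖z‖ ≤ B) (hw : ‖w‖ ≤ B)
    (hr : |r| ≤ C) : ‖z * conj w * (r : ℂ)‖ ≤ B ^ 2 * C := by
  rw [norm_mul, norm_mul, RCLike.norm_conj, Complex.norm_real, sq]
  have hB : 0 ≤ B := (norm_nonneg z).trans hz
  gcongr
  exact hr

lemma continuousOn_comp_rootArg_mul (hA : Continuous A) (hb : ContinuousOn b (Ioi 0)) :
    ContinuousOn (fun X => A (rootArg n κ δ β X U) * conj (A (rootArg n κ δ β X V)) *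
      ((b (nthRoot n (U - X)) * b (nthRoot n (V - X)) : ℝ) : ℂ)) (Iio U ∩ Iio V) := by
  have hA' W := hA.comp (continuous_rootArg n κ δ β W)
  have hb' (W : ℝ) : ContinuousOn (fun X => b (nthRoot n (W - X))) (Iio W) :=
    hb.comp ((continuous_nthRoot n).comp (by fun_prop)).continuousOn
      fun X hX => nthRoot_pos (sub_pos.2 hX)
  exact ((hA' U).mul (Complex.continuous_conj.comp (hA' V))).continuousOn.mul
    (Complex.continuous_ofReal.comp_continuousOn
      (((hb' U).mono inter_subset_left).mul ((hb' V).mono inter_subset_right)))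

lemma mul_deriv_rootSum_nonneg_or_nonpos (δ : ℝ) {S : Set ℝ} (hS : S ⊆ Iio U ∩ Iio V) :
    (∀ X ∈ S, 0 ≤ δ * deriv (rootSum n U V) X) ∨ ∀ X ∈ S, δ * deriv (rootSum n U V) X ≤ 0 := by
  have hderiv X (hX : X ∈ S) : deriv (rootSum n U V) X ≤ 0 :=
    (deriv_rootSum_le (hS hX).1 (hS hX).2).trans (by norm_num)
  rcases le_total 0 δ with hδ | hδ
  · exact Or.inr fun X hX => mul_nonpos_of_nonneg_of_nonpos hδ (hderiv X hX)
  · exact Or.inl fun X hX => mul_nonneg_of_nonpos_of_nonpos hδ (hderiv X hX)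

lemma hasDerivAt_mul_rootSum_sub (δ α : ℝ) (hU : X < U) (hV : X < V) :
    HasDerivAt (fun X => δ * rootSum n U V X - α) (δ * deriv (rootSum n U V) X) X :=
  (((contDiffOn_rootSum n U V).differentiableOn one_ne_zero).differentiableAt
    ((isOpen_Iio.inter isOpen_Iio).mem_nhds ⟨hU, hV⟩)).hasDerivAt.const_mul δ |>.sub_const α

/- `phaseQuot` plays the part of the amplitude quotient and `rootSum` that of the derivative of the
phase in `norm_integral_exp_mul_le`. -/
lemma norm_integral_kernelPhase_le {B C₀ C₁ x₁ x₂ : ℝ} (hn : n ≠ 0)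
    (hb : ContDiffOn ℝ 1 b (Ioi 0)) (hbC₀ : ∀ r ∈ Icc (1 / 2 : ℝ) 2, |b r| ≤ C₀) (hR₁ : 0 < R₁)
    (hA : Differentiable ℝ A) (hAB : ∀ p ∈ Icc R₁ R₂, ‖A p‖ ≤ B ∧ ‖deriv A p‖ ≤ B)
    (hc : c ≠ 0) (hκ : κ ≠ 0) (hκκ₀ : |κ| ≤ κ₀) (hUV : U ≠ V) (hα : δ * U + β ≠ 0) (hx : x₁ ≤ x₂)
    (hsub : Icc x₁ x₂ ⊆ rootArgDomain n κ δ β R₁ R₂ U ∩ rootArgDomain n κ δ β R₁ R₂ V)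
    (hquot : ∀ X ∈ Icc x₁ x₂,
      DifferentiableAt ℝ (fun X => phaseQuot n b (rootCurve n κ δ β U V X)) X ∧
        |phaseQuot n b (rootCurve n κ δ β U V X)| ≤ C₁ ∧
        |deriv (fun X => phaseQuot n b (rootCurve n κ δ β U V X)) X| ≤ C₁) :
    ‖∫ X in x₁..x₂, Complex.exp (Complex.I * kernelPhase n c κ δ β U V X) *
        (A (rootArg n κ δ β X U) * conj (A (rootArg n κ δ β X V)) *
          (b (nthRoot n (U - X)) * b (nthRoot n (V - X)) : ℝ))‖
      ≤ B ^ 2 * (C₀ ^ 2 + (2 * (2 ^ n * κ₀) + 1) * C₁) * (x₂ - x₁ + 8) /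
        √(|c * κ ^ 2 * (V - U)| * (|δ * U + β| / ((n + 1) * 2 ^ (n + 1)))) := by
  have hU X (hX : X ∈ Icc x₁ x₂) := (hsub hX).1
  have hV X (hX : X ∈ Icc x₁ x₂) := (hsub hX).2
  have hdom : Icc x₁ x₂ ⊆ Iio U ∩ Iio V := fun X hX => ⟨(hU X hX).1.1, (hV X hX).1.1⟩
  have hC₁ : 0 ≤ C₁ := (abs_nonneg _).trans (hquot x₁ (left_mem_Icc.2 hx)).2.1
  have hκ₀ : 0 ≤ 2 * (2 ^ n * κ₀) := mul_nonneg zero_le_two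
    (mul_nonneg (by positivity) ((abs_nonneg κ).trans hκκ₀))
  have hq X (hX : X ∈ Icc x₁ x₂) := norm_deriv_mul_conj_mul_phaseQuot_le hA hAB hκκ₀ (hU X hX)
    (hV X hX) (hquot X hX).1 (hquot X hX).2.1 (hquot X hX).2.2
  refine norm_integral_exp_mul_le (D := fun X => δ * rootSum n U V X - (δ * U + β))
    (D' := fun X => δ * deriv (rootSum n U V) X)
    (q := fun X => A (rootArg n κ δ β X U) * conj (A (rootArg n κ δ β X V)) *
      (phaseQuot n b (rootCurve n κ δ β U V X) : ℂ)) hx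
    (mul_ne_zero (mul_ne_zero hc (pow_ne_zero _ hκ)) (sub_ne_zero.2 hUV.symm))
    (div_pos (abs_pos.2 hα) (by positivity))
    (fun X hX => hasDerivAt_kernelPhase (hdom hX).1 (hdom hX).2)
    ((continuousOn_kernelPhaseDeriv n c κ δ β U V).mono hdom)
    (fun X hX => hasDerivAt_mul_rootSum_sub δ _ (hdom hX).1 (hdom hX).2)
    (continuousOn_const.mul (((contDiffOn_rootSum n U V).continuousOn_deriv_of_isOpen
      (isOpen_Iio.inter isOpen_Iio) le_rfl).mono hdom))
    (mul_deriv_rootSum_nonneg_or_nonpos δ hdom) (fun X hX => (hq X hX).1)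
    ((continuousOn_comp_rootArg_mul hA.continuous hb.continuousOn).mono hdom)
    (fun X hX => ?_) (fun X hX => ?_) (fun X hX => ?_) (fun X hX => (hq X hX).2.trans ?_)
    (fun X hX => ?_)
  · have hfac := congrArg Complex.ofReal (kernelPhaseDeriv_mul_phaseQuot (c := c) hn (hdom hX).1
      (hdom hX).2 (hR₁.trans_le (hU X hX).2.1) (hR₁.trans_le (hV X hX).2.1) b)
    push_cast at hfac ⊢
    linear_combination (A (rootArg n κ δ β X U) * conj (A (rootArg n κ δ β X V))) * hfac
  · refine (norm_mul_conj_mul_ofReal_le (C := C₀ ^ 2) (hAB _ (hU X hX).2).1 (hAB _ (hV X hX).2).1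
      ?_).trans (by gcongr; exact le_add_of_nonneg_right (by positivity))
    rw [abs_mul, sq]
    exact mul_le_mul (hbC₀ _ (hU X hX).1.2) (hbC₀ _ (hV X hX).1.2) (abs_nonneg _)
      ((abs_nonneg _).trans (hbC₀ _ (hU X hX).1.2))
  · refine (norm_mul_conj_mul_ofReal_le (hAB _ (hU X hX).2).1 (hAB _ (hV X hX).2).1
      (hquot X hX).2.1).trans ?_
    gcongr
    nlinarith [sq_nonneg C₀, mul_nonneg hκ₀ hC₁]
  · rw [mul_comm _ (B ^ 2), mul_assoc]
    gcongr
    exact le_add_of_nonneg_left (sq_nonneg C₀)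
  · exact div_le_abs_sub_add_abs_mul (one_le_mul_of_one_le_of_one_le
      (by linarith [(Nat.cast_nonneg n : (0 : ℝ) ≤ n)]) (one_le_pow₀ one_le_two))
      (abs_rootSum_le (hU X hX).1 (hV X hX).1) (deriv_rootSum_le (hdom hX).1 (hdom hX).2)

lemma exists_norm_integral_kernelPhase_le (hn : n ≠ 0) (hb : ContDiffOn ℝ 1 b (Ioi 0))
    (hR₁ : 0 < R₁) (R₂ : ℝ) (hκ₀ : 0 ≤ κ₀) :
    ∃ K : ℝ, 0 ≤ K ∧ ∀ {A : ℝ → ℂ} {B c κ δ β U V x₁ x₂ : ℝ}, Differentiable ℝ A →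
      (∀ p ∈ Icc R₁ R₂, ‖A p‖ ≤ B ∧ ‖deriv A p‖ ≤ B) → c ≠ 0 → κ ≠ 0 → |κ| ≤ κ₀ → U ≠ V →
      δ * U + β ≠ 0 → x₁ ≤ x₂ →
      Icc x₁ x₂ ⊆ rootArgDomain n κ δ β R₁ R₂ U ∩ rootArgDomain n κ δ β R₁ R₂ V →
      ‖∫ X in x₁..x₂, Complex.exp (Complex.I * kernelPhase n c κ δ β U V X) *
          (A (rootArg n κ δ β X U) * conj (A (rootArg n κ δ β X V)) *
            (b (nthRoot n (U - X)) * b (nthRoot n (V - X)) : ℝ))‖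
        ≤ K * B ^ 2 * (x₂ - x₁ + 8) / √(|c * κ ^ 2 * (V - U)| * |δ * U + β|) := by
  obtain ⟨C₀, hbC₀⟩ := isCompact_Icc.exists_bound_of_continuousOn
    (hb.continuousOn.mono fun r (hr : r ∈ Icc (1 / 2 : ℝ) 2) => one_half_pos.trans_le hr.1)
  obtain ⟨C₁, hC₁, hquot⟩ := exists_bound_phaseQuot (b := b) hn hb hR₁ R₂ hκ₀
  refine ⟨(C₀ ^ 2 + (2 * (2 ^ n * κ₀) + 1) * C₁) * √((n + 1) * 2 ^ (n + 1)), by positivity, ?_⟩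
  intro A B c κ δ β U V x₁ x₂ hA hAB hc hκ hκκ₀ hUV hα hx hsub
  refine (norm_integral_kernelPhase_le hn hb hbC₀ hR₁ hA hAB hc hκ hκκ₀ hUV hα hx hsub fun X hX =>
    hquot hκκ₀ (hsub hX).1 (hsub hX).2).trans_eq ?_
  rw [← mul_div_assoc, Real.sqrt_div (by positivity), div_div_eq_mul_div]
  ring

lemma rootKernel_eq_zero (hb : Function.support b ⊆ Icc (1 / 2) 2) (A : ℝ → ℂ) (c κ δ β : ℝ)
    (hX : X ∉ rootDomain n U) : rootKernel n b A c κ δ β X U = 0 := by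
  unfold rootKernel
  split_ifs with hXU
  · rw [Function.notMem_support.1 fun hs => hX ⟨hXU, hb hs⟩, Complex.ofReal_zero, mul_zero,
      mul_zero]
  · rfl

lemma norm_rootKernel_le (n : ℕ) (b : ℝ → ℝ) (A : ℝ → ℂ) (c κ δ β X U : ℝ) :
    ‖rootKernel n b A c κ δ β X U‖ ≤ ‖A (rootArg n κ δ β X U)‖ * |b (nthRoot n (U - X))| := by
  unfold rootKernel
  split_ifs
  · rw [norm_mul, norm_mul, Complex.norm_exp_I_mul_ofReal, Complex.norm_real, one_mul,
      Real.norm_eq_abs]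
  · rw [norm_zero]
    positivity

lemma norm_rootKernel_le_mul {B C : ℝ} (hA : ‖A (rootArg n κ δ β X U)‖ ≤ B)
    (hb : ∀ s, |b s| ≤ C) : ‖rootKernel n b A c κ δ β X U‖ ≤ B * C :=
  (norm_rootKernel_le n b A c κ δ β X U).trans
    (mul_le_mul hA (hb _) (abs_nonneg _) ((norm_nonneg _).trans hA))

lemma measurable_rootKernel (n : ℕ) (hb : Measurable b) (hA : Continuous A) (c κ δ β : ℝ) :
    Measurable fun p : ℝ × ℝ => rootKernel n b A c κ δ β p.1 p.2 := by
  have hroot := continuous_nthRoot n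
  have harg : Continuous fun p : ℝ × ℝ => rootArg n κ δ β p.1 p.2 := by unfold rootArg; fun_prop
  have hb' : Measurable fun p : ℝ × ℝ => (b (nthRoot n (p.2 - p.1)) : ℂ) :=
    Complex.measurable_ofReal.comp (hb.comp (by fun_prop))
  exact Measurable.ite (measurableSet_lt measurable_fst measurable_snd)
    ((Continuous.measurable (by fun_prop)).mul
      ((Continuous.measurable (by fun_prop)).mul hb')) measurable_const

lemma continuous_of_continuousOn_Ioi (hb : ContinuousOn b (Ioi 0))
    (hbs : Function.support b ⊆ Icc (1 / 2) 2) : Continuous b :=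
  hb.continuous_of_tsupport_subset isOpen_Ioi
    ((closure_minimal hbs isClosed_Icc).trans fun _ hs => one_half_pos.trans_le hs.1)

lemma exists_abs_le_of_continuousOn_Ioi (hb : ContinuousOn b (Ioi 0))
    (hbs : Function.support b ⊆ Icc (1 / 2) 2) : ∃ C, 0 ≤ C ∧ ∀ s, |b s| ≤ C := by
  obtain ⟨C, hC⟩ := (HasCompactSupport.of_support_subset_isCompact isCompact_Icc
    hbs).exists_bound_of_continuous (continuous_of_continuousOn_Ioi hb hbs)
  exact ⟨C, (norm_nonneg (b 0)).trans (hC 0), hC⟩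

lemma rootKernel_mul_conj (A : ℝ → ℂ) (b : ℝ → ℝ) (c κ δ β : ℝ) (hU : X < U) (hV : X < V) :
    rootKernel n b A c κ δ β X U * conj (rootKernel n b A c κ δ β X V) =
      Complex.exp (Complex.I * kernelPhase n c κ δ β U V X) *
        (A (rootArg n κ δ β X U) * conj (A (rootArg n κ δ β X V)) *
          (b (nthRoot n (U - X)) * b (nthRoot n (V - X)) : ℝ)) := by
  have hexp : Complex.exp (Complex.I * kernelPhase n c κ δ β U V X) =
      Complex.exp (Complex.I * (-c * rootArg n κ δ β X U ^ (n + 1) : ℝ)) *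
        Complex.exp (-Complex.I * (-c * rootArg n κ δ β X V ^ (n + 1) : ℝ)) := by
    rw [← Complex.exp_add, kernelPhase]
    congr 1
    push_cast
    ring
  simp only [rootKernel, if_pos hU, if_pos hV, map_mul, Complex.conj_ofReal, ← Complex.exp_conj,
    Complex.conj_I, hexp]
  push_cast
  ring

lemma isCompact_rootArgDomain (n : ℕ) (κ δ β R₁ R₂ U : ℝ) :
    IsCompact (rootArgDomain n κ δ β R₁ R₂ U) := by
  unfold rootArgDomain
  rw [rootDomain_eq_Icc]
  exact isCompact_Icc.inter_right (isClosed_Icc.preimage (continuous_rootArg n κ δ β U))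

lemma ordConnected_rootArgDomain (n : ℕ) (κ δ β R₁ R₂ U : ℝ) :
    (rootArgDomain n κ δ β R₁ R₂ U).OrdConnected := by
  refine ⟨fun x hx z hz y hy => ?_⟩
  have hy' : y ∈ rootDomain n U := by
    have hord : (rootDomain n U).OrdConnected := rootDomain_eq_Icc n U ▸ ordConnected_Icc
    exact hord.out hx.1 hz.1 hy
  have hyz : nthRoot n (U - z) ≤ nthRoot n (U - y) :=
    nthRoot_le_nthRoot (sub_pos.2 hz.1.1).le (by linarith [hy.2])
  have hxy : nthRoot n (U - y) ≤ nthRoot n (U - x) :=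
    nthRoot_le_nthRoot (sub_pos.2 hy'.1).le (by linarith [hy.1])
  refine ⟨hy', ?_⟩
  rcases le_total 0 κ with hκ | hκ
  · exact ⟨hz.2.1.trans (mul_le_mul_of_nonneg_left (by linarith) hκ),
      (mul_le_mul_of_nonneg_left (by linarith) hκ).trans hx.2.2⟩
  · exact ⟨hx.2.1.trans (mul_le_mul_of_nonpos_left (by linarith) hκ),
      (mul_le_mul_of_nonpos_left (by linarith) hκ).trans hz.2.2⟩

lemma volume_real_rootDomain_le (n : ℕ) (U : ℝ) : volume.real (rootDomain n U) ≤ 2 ^ (n + 1) := by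
  rw [rootDomain_eq_Icc, Measure.real, Real.volume_Icc]
  exact ENNReal.toReal_le_of_le_ofReal (by positivity) (ENNReal.ofReal_le_ofReal
    (by linarith [pow_pos (one_half_pos (α := ℝ)) (n + 1)]))

lemma exists_norm_setIntegral_rootKernel_le (hn : n ≠ 0) (hb : ContDiffOn ℝ 1 b (Ioi 0))
    (hR₁ : 0 < R₁) (R₂ : ℝ) (hκ₀ : 0 ≤ κ₀) :
    ∃ K : ℝ, 0 ≤ K ∧ ∀ {A : ℝ → ℂ} {B c κ δ β U V : ℝ}, Differentiable ℝ A →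
      (∀ p ∈ Icc R₁ R₂, ‖A p‖ ≤ B ∧ ‖deriv A p‖ ≤ B) → c ≠ 0 → κ ≠ 0 → |κ| ≤ κ₀ → U ≠ V →
      δ * U + β ≠ 0 →
      ‖∫ X in rootArgDomain n κ δ β R₁ R₂ U ∩ rootArgDomain n κ δ β R₁ R₂ V,
          rootKernel n b A c κ δ β X U * conj (rootKernel n b A c κ δ β X V)‖
        ≤ K * B ^ 2 / √(|c * κ ^ 2 * (V - U)| * |δ * U + β|) := by
  obtain ⟨K, hK, hbound⟩ := exists_norm_integral_kernelPhase_le (b := b) hn hb hR₁ R₂ hκ₀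
  refine ⟨K * (2 ^ (n + 1) + 8), by positivity, ?_⟩
  intro A B c κ δ β U V hA hAB hc hκ hκκ₀ hUV hα
  set T := rootArgDomain n κ δ β R₁ R₂ U ∩ rootArgDomain n κ δ β R₁ R₂ V
  have hcompact : IsCompact T :=
    (isCompact_rootArgDomain n κ δ β R₁ R₂ U).inter (isCompact_rootArgDomain n κ δ β R₁ R₂ V)
  have hord : T.OrdConnected :=
    (ordConnected_rootArgDomain n κ δ β R₁ R₂ U).inter (ordConnected_rootArgDomain n κ δ β R₁ R₂ V)
  rcases T.eq_empty_or_nonempty with hempty | hne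
  · rw [hempty, setIntegral_empty, norm_zero]
    positivity
  have hT := eq_Icc_of_connected_compact ⟨hne, hord.isPreconnected⟩ hcompact
  have hx : sInf T ≤ sSup T := nonempty_Icc.1 (hT ▸ hne)
  have hlen : sSup T - sInf T ≤ 2 ^ (n + 1) := by
    have hdom (X : ℝ) (hX : X ∈ T) := rootDomain_eq_Icc n U ▸ hX.1.1
    linarith [(hdom _ (hcompact.sInf_mem hne)).1, (hdom _ (hcompact.sSup_mem hne)).2,
      pow_pos (one_half_pos (α := ℝ)) (n + 1)]
  rw [setIntegral_congr_fun hcompact.measurableSet fun X hX =>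
    rootKernel_mul_conj A b c κ δ β hX.1.1.1 hX.2.1.1, hT, integral_Icc_eq_integral_Ioc,
    ← intervalIntegral.integral_of_le hx]
  refine (hbound hA hAB hc hκ hκκ₀ hUV hα hx hT.ge).trans ?_
  rw [mul_right_comm K]
  gcongr

lemma integrable_rootKernel_mul_conj {B C : ℝ} (hb : ContinuousOn b (Ioi 0))
    (hbs : Function.support b ⊆ Icc (1 / 2) 2) (hbC : ∀ s, |b s| ≤ C) (hA : Continuous A)
    (hAB : ∀ p, ‖A p‖ ≤ B) (c κ δ β U V : ℝ) :
    Integrable fun X => rootKernel n b A c κ δ β X U * conj (rootKernel n b A c κ δ β X V) := by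
  have hmeas (W : ℝ) : Measurable fun X => rootKernel n b A c κ δ β X W :=
    (measurable_rootKernel n (continuous_of_continuousOn_Ioi hb hbs).measurable hA c κ δ β).comp
      measurable_prodMk_right
  have hsupp : Function.support (fun X => rootKernel n b A c κ δ β X U *
      conj (rootKernel n b A c κ δ β X V)) ⊆ rootDomain n U := fun X hX => by
    by_contra hXU
    exact hX (by simp only [rootKernel_eq_zero hbs A c κ δ β hXU, zero_mul])
  rw [← integrableOn_iff_integrable_of_support_subset hsupp]
  refine Measure.integrableOn_of_bounded (M := B * C * (B * C)) ?_
    ((hmeas U).mul (Complex.continuous_conj.measurable.comp (hmeas V))).aestronglyMeasurable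
    (Filter.Eventually.of_forall fun X => ?_)
  · rw [rootDomain_eq_Icc]
    exact measure_Icc_lt_top.ne
  · rw [norm_mul, RCLike.norm_conj]
    have hU := norm_rootKernel_le_mul (c := c) (hAB (rootArg n κ δ β X U)) hbC
    exact mul_le_mul hU (norm_rootKernel_le_mul (hAB _) hbC) (norm_nonneg _)
      ((norm_nonneg _).trans hU)

lemma norm_rootKernel_mul_conj_le {B B' C : ℝ} (hbs : Function.support b ⊆ Icc (1 / 2) 2)
    (hbC : ∀ s, |b s| ≤ C) (hAB : ∀ p, ‖A p‖ ≤ B) (hAB' : ∀ p ∉ Icc R₁ R₂, ‖A p‖ ≤ B')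
    (hB' : 0 ≤ B')
    (hX : X ∉ rootArgDomain n κ δ β R₁ R₂ U ∩ rootArgDomain n κ δ β R₁ R₂ V) :
    ‖rootKernel n b A c κ δ β X U * conj (rootKernel n b A c κ δ β X V)‖ ≤ B * B' * C ^ 2 := by
  have hB : 0 ≤ B := (norm_nonneg _).trans (hAB 0)
  have hC : 0 ≤ C := (abs_nonneg _).trans (hbC 0)
  have hlarge (W : ℝ) := norm_rootKernel_le_mul (c := c) (hAB (rootArg n κ δ β X W)) hbC
  have hsmall {W : ℝ} (hW : X ∉ rootArgDomain n κ δ β R₁ R₂ W) :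
      ‖rootKernel n b A c κ δ β X W‖ ≤ B' * C := by
    by_cases hdom : X ∈ rootDomain n W
    · exact norm_rootKernel_le_mul (hAB' _ fun hp => hW ⟨hdom, hp⟩) hbC
    · rw [rootKernel_eq_zero hbs A c κ δ β hdom, norm_zero]
      positivity
  rw [norm_mul, RCLike.norm_conj]
  rcases not_and_or.1 hX with hU | hV
  · exact (mul_le_mul (hsmall hU) (hlarge V) (norm_nonneg _) (by positivity)).trans_eq (by ring)
  · exact (mul_le_mul (hlarge U) (hsmall hV) (norm_nonneg _) (by positivity)).trans_eq (by ring)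

lemma norm_integral_le_norm_setIntegral_add {α E : Type*} [MeasurableSpace α]
    [NormedAddCommGroup E] [NormedSpace ℝ E] {μ : Measure α} {f : α → E} {S T : Set α} {M : ℝ}
    (hf : Integrable f μ) (hT : MeasurableSet T) (hTS : T ⊆ S) (hS : μ S ≠ ⊤)
    (hzero : ∀ x ∉ S, f x = 0) (hM : ∀ x ∉ T, ‖f x‖ ≤ M) (hM₀ : 0 ≤ M) :
    ‖∫ x, f x ∂μ‖ ≤ ‖∫ x in T, f x ∂μ‖ + M * μ.real S := by
  rw [← setIntegral_eq_integral_of_forall_compl_eq_zero hzero,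
    ← integral_inter_add_sdiff hT hf.integrableOn, inter_eq_self_of_subset_right hTS]
  refine norm_add_le_of_le le_rfl ((norm_setIntegral_le_of_norm_le_const
    ((measure_mono sdiff_subset).trans_lt hS.lt_top) fun x hx => hM x hx.2).trans ?_)
  exact mul_le_mul_of_nonneg_left (measureReal_mono sdiff_subset hS) hM₀

lemma exists_norm_integral_rootKernel_mul_conj_le (hn : n ≠ 0) (hb : ContDiffOn ℝ 1 b (Ioi 0))
    (hbs : Function.support b ⊆ Icc (1 / 2) 2) (hR₁ : 0 < R₁) (R₂ : ℝ) (hκ₀ : 0 ≤ κ₀) :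
    ∃ K : ℝ, 0 ≤ K ∧ ∀ {A : ℝ → ℂ} {B B' c κ δ β U V : ℝ}, Differentiable ℝ A →
      (∀ p, ‖A p‖ ≤ B) → (∀ p ∈ Icc R₁ R₂, ‖deriv A p‖ ≤ B) → (∀ p ∉ Icc R₁ R₂, ‖A p‖ ≤ B') →
      0 ≤ B' → c ≠ 0 → κ ≠ 0 → |κ| ≤ κ₀ → U ≠ V → δ * U + β ≠ 0 →
      ‖∫ X, rootKernel n b A c κ δ β X U * conj (rootKernel n b A c κ δ β X V)‖
        ≤ K * (B ^ 2 / √(|c * κ ^ 2 * (V - U)| * |δ * U + β|) + B * B') := by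
  obtain ⟨K, hK, hbound⟩ := exists_norm_setIntegral_rootKernel_le (b := b) hn hb hR₁ R₂ hκ₀
  obtain ⟨C, hC, hbC⟩ := exists_abs_le_of_continuousOn_Ioi hb.continuousOn hbs
  refine ⟨K + C ^ 2 * 2 ^ (n + 1), by positivity, ?_⟩
  intro A B B' c κ δ β U V hA hAB hAd hAB' hB' hc hκ hκκ₀ hUV hα
  have hB : 0 ≤ B := (norm_nonneg _).trans (hAB 0)
  refine (norm_integral_le_norm_setIntegral_add
    (integrable_rootKernel_mul_conj hb.continuousOn hbs hbC hA.continuous hAB c κ δ β U V)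
    ((isCompact_rootArgDomain n κ δ β R₁ R₂ U).inter
      (isCompact_rootArgDomain n κ δ β R₁ R₂ V)).measurableSet
    (inter_subset_left.trans inter_subset_left) (S := rootDomain n U) ?_ (fun X hX => ?_)
    (fun X hX => norm_rootKernel_mul_conj_le hbs hbC hAB hAB' hB' hX) (by positivity)).trans ?_
  · rw [rootDomain_eq_Icc]
    exact measure_Icc_lt_top.ne
  · rw [rootKernel_eq_zero hbs A c κ δ β hX, zero_mul]
  · have hin := hbound hA (fun p hp => ⟨hAB p, hAd p hp⟩) hc hκ hκκ₀ hUV hα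
    have hout : B * B' * C ^ 2 * volume.real (rootDomain n U) ≤ B * B' * C ^ 2 * 2 ^ (n + 1) := by
      gcongr
      exact volume_real_rootDomain_le n U
    refine (add_le_add hin hout).trans (le_of_sub_nonneg ?_)
    rw [mul_div_assoc, show ∀ x : ℝ, (K + C ^ 2 * 2 ^ (n + 1)) * (x + B * B') -
      (K * x + B * B' * C ^ 2 * 2 ^ (n + 1)) = K * (B * B') + C ^ 2 * 2 ^ (n + 1) * x by
        intro x; ring]
    positivity

lemma exists_norm_integral_rootKernel_oscInt_le (hn : n ≠ 0) {a : ℝ → ℂ}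
    (ha : ContDiffOn ℝ 2 a (Ioi 0)) {r₁ r₂ : ℝ} (hr₁ : 0 < r₁) (hr : r₁ ≤ r₂) (ha₁ : a r₁ = 0)
    (ha₂ : a r₂ = 0) (hb : ContDiffOn ℝ 1 b (Ioi 0)) (hbs : Function.support b ⊆ Icc (1 / 2) 2)
    {κ₁ : ℝ} (hκ₁ : 0 < κ₁) (κ₂ : ℝ) :
    ∃ C : ℝ, 0 ≤ C ∧ ∀ c κ δ β U V : ℝ, c ≠ 0 → κ₁ ≤ |κ| → |κ| ≤ κ₂ → U ≠ V → δ * U + β ≠ 0 →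
      ‖∫ X, rootKernel n b (oscInt n a r₁ r₂ c) c κ δ β X U *
        conj (rootKernel n b (oscInt n a r₁ r₂ c) c κ δ β X V)‖ ≤
      C / (|c| * √|c|) * (1 + 1 / √(|V - U| * |δ * U + β|)) := by
  have ha' : ContDiffOn ℝ 1 a (Ioi 0) := ha.of_le one_le_two
  have hsub : uIcc r₁ r₂ ⊆ Ioi 0 := fun r h => hr₁.trans_le (uIcc_of_le hr ▸ h).1
  obtain ⟨C₁, hC₁, hamp⟩ := exists_norm_oscInt_le hr₁ hr hn ha'
  obtain ⟨C₂, hC₂, hfar⟩ := exists_norm_oscInt_le_of_notMem hr₁ hr hn ha'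
  obtain ⟨C₃, hC₃, hderiv⟩ := exists_norm_deriv_oscInt_le hr₁ hr hn ha ha₁ ha₂ (2 * r₂)
  obtain ⟨K, hK, hbound⟩ := exists_norm_integral_rootKernel_mul_conj_le hn hb hbs
    (half_pos hr₁) (2 * r₂) (le_max_right κ₂ 0)
  refine ⟨K * ((C₁ + C₃) ^ 2 / κ₁ + (C₁ + C₃) * C₂), by positivity, ?_⟩
  intro c κ δ β U V hc hκκ₁ hκκ₂ hUV hα
  have hc' : 0 < |c| := abs_pos.2 hc
  have hα' : 0 < √(|V - U| * |δ * U + β|) :=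
    Real.sqrt_pos.2 (mul_pos (abs_pos.2 (sub_ne_zero.2 hUV.symm)) (abs_pos.2 hα))
  refine (hbound (B := (C₁ + C₃) / √|c|) (B' := C₂ / |c|)
    (fun ρ => (hasDerivAt_oscInt n c ρ (ha.continuousOn.mono hsub)).differentiableAt)
    (fun ρ => (hamp c hc ρ).trans (by gcongr; linarith))
    (fun ρ hρ => (hderiv c hc ρ ?_).trans (by gcongr; linarith)) (hfar c hc) (by positivity) hc
    (abs_pos.1 (hκ₁.trans_le hκκ₁)) (hκκ₂.trans (le_max_left _ _)) hUV hα).trans ?_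
  · rw [abs_of_pos ((half_pos hr₁).trans_le hρ.1)]
    exact hρ.2
  · have hsqrt : √(|c * κ ^ 2 * (V - U)| * |δ * U + β|) =
        √|c| * |κ| * √(|V - U| * |δ * U + β|) := by
      rw [abs_mul, abs_mul, abs_pow, mul_assoc, Real.sqrt_mul (by positivity),
        Real.sqrt_mul (by positivity), Real.sqrt_sq (abs_nonneg _)]
    rw [hsqrt, div_pow, Real.sq_sqrt hc'.le]
    set z := √(|V - U| * |δ * U + β|)
    calc _ ≤ K * ((C₁ + C₃) ^ 2 / |c| / (√|c| * κ₁ * z) + (C₁ + C₃) / √|c| * (C₂ / |c|)) := by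
          gcongr
      _ = K / (|c| * √|c|) * ((C₁ + C₃) ^ 2 / κ₁ * (1 / z) + (C₁ + C₃) * C₂) := by
          field_simp
      _ ≤ K / (|c| * √|c|) * (((C₁ + C₃) ^ 2 / κ₁ + (C₁ + C₃) * C₂) * (1 + 1 / z)) := by
          have hz : 0 ≤ 1 / z := by positivity
          have hP : 0 ≤ (C₁ + C₃) ^ 2 / κ₁ := by positivity
          have hQ : 0 ≤ (C₁ + C₃) * C₂ := by positivity
          gcongr
          nlinarith [mul_nonneg hQ hz]
      _ = _ := by ring

end RootKernel

section TTStar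

variable {α β : Type*} [MeasurableSpace α] [MeasurableSpace β] {ν : Measure α} {μ : Measure β}

lemma integral_norm_mul_norm_le {f g : β → ℂ} (hf : MemLp f 2 μ) (hg : MemLp g 2 μ) :
    ∫ x, ‖f x‖ * ‖g x‖ ∂μ ≤ √(∫ x, ‖f x‖ ^ 2 ∂μ) * √(∫ x, ‖g x‖ ^ 2 ∂μ) := by
  have h := integral_mul_norm_le_Lp_mul_Lq Real.HolderConjugate.two_two
    (f := f) (g := g) (by simpa using hf) (by simpa using hg)
  simpa only [Real.rpow_two, ← Real.sqrt_eq_rpow] using h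

lemma integrable_mul_of_integral_norm_le [SFinite μ] {H : α → ℂ} {F : α × β → ℂ} {B : ℝ}
    (hH : Integrable H ν) (hF : AEStronglyMeasurable F (ν.prod μ))
    (hFi : ∀ x, Integrable (fun y => F (x, y)) μ) (hFB : ∀ x, ∫ y, ‖F (x, y)‖ ∂μ ≤ B) :
    Integrable (fun q : α × β => H q.1 * F q) (ν.prod μ) := by
  have hmeas : AEStronglyMeasurable (fun q : α × β => H q.1 * F q) (ν.prod μ) :=
    hH.1.comp_fst.mul hF
  rw [integrable_prod_iff hmeas]
  refine ⟨.of_forall fun x => (hFi x).const_mul (H x), ?_⟩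
  refine (hH.norm.mul_const B).mono' hmeas.norm.integral_prod_right'
    (.of_forall fun x => ?_)
  simp only [norm_mul, integral_const_mul]
  rw [norm_norm, Real.norm_of_nonneg (integral_nonneg fun y => norm_nonneg _)]
  gcongr
  exact hFB x

variable {k : β → α → ℂ} {B : ℝ} {H : α → ℂ} {G : β → ℂ}

lemma integrable_mul_kernel [SFinite ν] [SFinite μ] (hk : Measurable fun p : β × α => k p.1 p.2)
    (hk₂ : ∀ U, MemLp (fun X => k X U) 2 μ) (hkB : ∀ U, ∫ X, ‖k X U‖ ^ 2 ∂μ ≤ B)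
    (hH : Integrable H ν) (hG : MemLp G 2 μ) :
    Integrable (fun q : α × β => H q.1 * (k q.2 q.1 * G q.2)) (ν.prod μ) := by
  refine integrable_mul_of_integral_norm_le (F := fun q => k q.2 q.1 * G q.2)
    (B := √B * √(∫ X, ‖G X‖ ^ 2 ∂μ)) hH
    ((hk.comp measurable_swap).aestronglyMeasurable.mul hG.1.comp_snd)
    (fun U => (hk₂ U).integrable_mul hG) fun U => ?_
  simp only [norm_mul]
  exact (integral_norm_mul_norm_le (hk₂ U) hG).trans (by gcongr; exact hkB U)

lemma integrable_mul_kernel_mul_conj [SFinite ν] [SFinite μ]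
    (hk : Measurable fun p : β × α => k p.1 p.2)
    (hk₂ : ∀ U, MemLp (fun X => k X U) 2 μ) (hkB : ∀ U, ∫ X, ‖k X U‖ ^ 2 ∂μ ≤ B)
    (hH : Integrable H ν) :
    Integrable (fun q : (α × α) × β => H q.1.1 * conj (H q.1.2) *
      (k q.2 q.1.1 * conj (k q.2 q.1.2))) ((ν.prod ν).prod μ) := by
  refine integrable_mul_of_integral_norm_le (B := √B * √B)
    (H := fun p : α × α => H p.1 * conj (H p.2))
    (F := fun q => k q.2 q.1.1 * conj (k q.2 q.1.2))
    (hH.mul_prod (Complex.conjCLE.integrable_comp_iff.2 hH)) ?_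
    (fun p => (hk₂ p.1).integrable_mul (hk₂ p.2).star) fun p => ?_
  · exact ((hk.comp (measurable_snd.prodMk (measurable_fst.comp measurable_fst))).mul
      (Complex.continuous_conj.measurable.comp
        (hk.comp (measurable_snd.prodMk (measurable_snd.comp measurable_fst))))
      ).aestronglyMeasurable
  · simp only [norm_mul, RCLike.norm_conj]
    refine (integral_norm_mul_norm_le (hk₂ p.1) (hk₂ p.2)).trans ?_
    gcongr
    exacts [hkB p.1, hkB p.2]

lemma integral_mul_integral_kernel_mul [SFinite ν] [SFinite μ]
    (hk : Measurable fun p : β × α => k p.1 p.2)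
    (hk₂ : ∀ U, MemLp (fun X => k X U) 2 μ) (hkB : ∀ U, ∫ X, ‖k X U‖ ^ 2 ∂μ ≤ B)
    (hH : Integrable H ν) (hG : MemLp G 2 μ) :
    ∫ U, H U * ∫ X, k X U * G X ∂μ ∂ν = ∫ X, G X * ∫ U, H U * k X U ∂ν ∂μ := by
  simp_rw [← integral_const_mul]
  rw [integral_integral_swap (integrable_mul_kernel hk hk₂ hkB hH hG)]
  simp only [mul_comm, mul_left_comm]

lemma integral_mul_mul_conj_self [SFinite ν] (H f : α → ℂ) :
    (∫ U, H U * f U ∂ν) * conj (∫ U, H U * f U ∂ν) =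
      ∫ p : α × α, H p.1 * conj (H p.2) * (f p.1 * conj (f p.2)) ∂(ν.prod ν) := by
  rw [← integral_conj, ← integral_prod_mul (fun U => H U * f U) fun V => conj (H V * f V)]
  simp only [map_mul, mul_mul_mul_comm]

lemma memLp_two_integral_kernel [SFinite ν] [SFinite μ]
    (hk : Measurable fun p : β × α => k p.1 p.2)
    (hk₂ : ∀ U, MemLp (fun X => k X U) 2 μ) (hkB : ∀ U, ∫ X, ‖k X U‖ ^ 2 ∂μ ≤ B)
    (hH : Integrable H ν) : MemLp (fun X => ∫ U, H U * k X U ∂ν) 2 μ := by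
  have hmeas : AEStronglyMeasurable (fun X => ∫ U, H U * k X U ∂ν) μ :=
    AEStronglyMeasurable.integral_prod_right' (f := fun q : β × α => H q.2 * k q.1 q.2)
      (hH.1.comp_snd.mul hk.aestronglyMeasurable)
  have hint := (integrable_mul_kernel_mul_conj hk hk₂ hkB hH).integral_prod_right
  simp_rw [← integral_mul_mul_conj_self] at hint
  rw [memLp_two_iff_integrable_sq_norm hmeas]
  simpa only [norm_mul, RCLike.norm_conj, ← sq] using hint.norm

lemma integral_sq_norm_integral_kernel_le [SFinite ν] [SFinite μ]
    (hk : Measurable fun p : β × α => k p.1 p.2)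
    (hk₂ : ∀ U, MemLp (fun X => k X U) 2 μ) (hkB : ∀ U, ∫ X, ‖k X U‖ ^ 2 ∂μ ≤ B)
    (hH : Integrable H ν) :
    ∫ X, ‖∫ U, H U * k X U ∂ν‖ ^ 2 ∂μ ≤
      ∫ p : α × α, ‖H p.1‖ * ‖H p.2‖ * ‖∫ X, k X p.1 * conj (k X p.2) ∂μ‖ ∂(ν.prod ν) := by
  have hsq : ((∫ X, ‖∫ U, H U * k X U ∂ν‖ ^ 2 ∂μ : ℝ) : ℂ) = ∫ p : α × α,
      H p.1 * conj (H p.2) * ∫ X, k X p.1 * conj (k X p.2) ∂μ ∂(ν.prod ν) := by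
    simp_rw [← integral_complex_ofReal, ← Complex.normSq_eq_norm_sq, ← Complex.mul_conj,
      integral_mul_mul_conj_self, ← integral_const_mul]
    exact (integral_integral_swap (integrable_mul_kernel_mul_conj hk hk₂ hkB hH)).symm
  calc ∫ X, ‖∫ U, H U * k X U ∂ν‖ ^ 2 ∂μ
      = ‖((∫ X, ‖∫ U, H U * k X U ∂ν‖ ^ 2 ∂μ : ℝ) : ℂ)‖ := by
        rw [Complex.norm_real, Real.norm_of_nonneg (integral_nonneg fun X => sq_nonneg _)]
    _ ≤ _ := by
        rw [hsq]
        refine (norm_integral_le_integral_norm _).trans_eq ?_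
        simp only [norm_mul, RCLike.norm_conj]

/-- The `T T*` inequality, for the operator `T G U = ∫ X, k X U * G X`. -/
theorem sq_norm_integral_mul_integral_kernel_le [SFinite ν] [SFinite μ]
    (hk : Measurable fun p : β × α => k p.1 p.2)
    (hk₂ : ∀ U, MemLp (fun X => k X U) 2 μ) (hkB : ∀ U, ∫ X, ‖k X U‖ ^ 2 ∂μ ≤ B)
    (hH : Integrable H ν) (hG : MemLp G 2 μ) :
    ‖∫ U, H U * ∫ X, k X U * G X ∂μ ∂ν‖ ^ 2 ≤ (∫ X, ‖G X‖ ^ 2 ∂μ) *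
      ∫ p : α × α, ‖H p.1‖ * ‖H p.2‖ * ‖∫ X, k X p.1 * conj (k X p.2) ∂μ‖ ∂(ν.prod ν) := by
  have hCS := integral_norm_mul_norm_le hG (memLp_two_integral_kernel hk hk₂ hkB hH)
  rw [integral_mul_integral_kernel_mul hk hk₂ hkB hH hG]
  calc ‖∫ X, G X * ∫ U, H U * k X U ∂ν ∂μ‖ ^ 2
      ≤ (√(∫ X, ‖G X‖ ^ 2 ∂μ) * √(∫ X, ‖∫ U, H U * k X U ∂ν‖ ^ 2 ∂μ)) ^ 2 := by
        gcongr
        refine (norm_integral_le_integral_norm _).trans ?_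
        simpa only [norm_mul] using hCS
    _ = (∫ X, ‖G X‖ ^ 2 ∂μ) * ∫ X, ‖∫ U, H U * k X U ∂ν‖ ^ 2 ∂μ := by
        rw [mul_pow, Real.sq_sqrt (integral_nonneg fun X => sq_nonneg _),
          Real.sq_sqrt (integral_nonneg fun X => sq_nonneg _)]
    _ ≤ _ := by
        gcongr
        exact integral_sq_norm_integral_kernel_le hk hk₂ hkB hH

end TTStar

section Summation

lemma integrable_mul_comp_neg_add {f g : ℝ → ℝ} (hf : Integrable f) (hg : Integrable g) :
    Integrable (fun p : ℝ × ℝ => f p.1 * g (-p.1 + p.2)) (volume.prod volume) :=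
  (measurePreserving_prod_neg_add volume volume).integrable_comp_of_integrable (hf.mul_prod hg)

lemma integral_mul_comp_neg_add {f g : ℝ → ℝ} (hf : Integrable f) (hg : Integrable g) :
    ∫ p : ℝ × ℝ, f p.1 * g (-p.1 + p.2) ∂(volume.prod volume) = (∫ x, f x) * ∫ x, g x := by
  have hmp := measurePreserving_prod_neg_add (volume : Measure ℝ) (volume : Measure ℝ)
  have hmap := integral_map (f := fun z : ℝ × ℝ => f z.1 * g z.2) hmp.measurable.aemeasurable
    (by rw [hmp.map_eq]; exact (hf.mul_prod hg).1)
  rw [← integral_prod_mul f g, ← hmap, hmp.map_eq]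

/-- The truncated singularity `|z|^{-1/2} 1_{|z| ≤ L}`; at `z = 0` its value is `0`. -/
def truncInvSqrt (L z : ℝ) : ℝ := (Icc (-L) L).indicator (fun z => 1 / √|z|) z

lemma truncInvSqrt_nonneg (L z : ℝ) : 0 ≤ truncInvSqrt L z :=
  indicator_nonneg (fun _ _ => by positivity) _

lemma integrableOn_inv_sqrt_abs (L : ℝ) : IntegrableOn (fun z : ℝ => 1 / √|z|) (Icc (-L) L) := by
  have hpos : IntegrableOn (fun z : ℝ => 1 / √|z|) (Icc 0 L) := by
    have h := (intervalIntegral.intervalIntegrable_rpow' (a := 0) (b := L)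
      (by norm_num : (-1 : ℝ) < -(1 / 2))).1
    rw [integrableOn_Icc_iff_integrableOn_Ioc]
    refine h.congr_fun (fun z hz => ?_) measurableSet_Ioc
    simp only [abs_of_pos hz.1, Real.sqrt_eq_rpow, Real.rpow_neg hz.1.le, one_div]
  have hneg : IntegrableOn (fun z : ℝ => 1 / √|z|) (Icc (-L) 0) := by
    rw [← (Measure.measurePreserving_neg (volume : Measure ℝ)).integrableOn_comp_preimage
      (Homeomorph.neg ℝ).measurableEmbedding] at hpos
    simpa [Function.comp_def] using hpos
  refine (hneg.union hpos).mono_set fun z hz => ?_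
  exact (le_total z 0).imp (fun h => ⟨hz.1, h⟩) fun h => ⟨h, hz.2⟩

lemma integrable_truncInvSqrt (L : ℝ) : Integrable (truncInvSqrt L) :=
  (integrable_indicator_iff measurableSet_Icc).2 (integrableOn_inv_sqrt_abs L)

lemma integral_comp_affine (f : ℝ → ℝ) (δ β : ℝ) :
    ∫ x, f (δ * x + β) = |δ|⁻¹ * ∫ x, f x := by
  rw [Measure.integral_comp_mul_left (fun y => f (y + β)) δ, integral_add_right_eq_self f β,
    abs_inv, smul_eq_mul]

lemma mul_inv_sqrt_le_add_truncInvSqrt {w : ℝ} (hw₀ : 0 ≤ w) (hw₁ : w ≤ 1) (z : ℝ) :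
    w * (1 / √|z|) ≤ w + truncInvSqrt 1 z := by
  rcases le_or_gt |z| 1 with h | h
  · rw [truncInvSqrt, indicator_of_mem (show z ∈ Icc (-1) 1 from abs_le.1 h)]
    calc w * (1 / √|z|) ≤ 1 * (1 / √|z|) := by gcongr
      _ ≤ w + 1 / √|z| := by linarith
  · have hinv : 1 / √|z| ≤ 1 := by
      rw [div_le_one (Real.sqrt_pos.2 (by linarith))]
      exact Real.one_le_sqrt.2 h.le
    calc w * (1 / √|z|) ≤ w * 1 := by gcongr
      _ ≤ w + truncInvSqrt 1 z := by linarith [truncInvSqrt_nonneg 1 z]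

lemma ae_fst_ne_snd : ∀ᵐ p : ℝ × ℝ ∂(volume.prod volume), p.1 ≠ p.2 := by
  have hmp := measurePreserving_prod_neg_add (volume : Measure ℝ) (volume : Measure ℝ)
  have hne := (Measure.quasiMeasurePreserving_snd.comp hmp.quasiMeasurePreserving).ae
    (Measure.ae_ne volume 0)
  filter_upwards [hne] with p hp heq
  exact hp (by simp [heq])

lemma ae_mul_fst_add_ne_zero {δ : ℝ} (hδ : δ ≠ 0) (β : ℝ) :
    ∀ᵐ p : ℝ × ℝ ∂(volume.prod volume), δ * p.1 + β ≠ 0 := by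
  have hne := (Measure.quasiMeasurePreserving_fst (μ := (volume : Measure ℝ))
    (ν := (volume : Measure ℝ))).ae (Measure.ae_ne volume (-β / δ))
  filter_upwards [hne] with p hp heq
  exact hp (by field_simp; linarith)

lemma mul_mul_le_of_le_one_add_inv_sqrt {w y j D L z α : ℝ} (hw₀ : 0 ≤ w) (hw₁ : w ≤ 1)
    (hy₁ : y ≤ 1) (hD : 0 ≤ D) (hj₀ : 0 ≤ j) (hj : j ≤ D * (1 + 1 / √(|z| * |α|)))
    (hjL : z ∉ Icc (-L) L → j = 0) :
    w * y * j ≤ D * (w * (Icc (-L) L).indicator (fun _ => 1) z +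
      (w + truncInvSqrt 1 α) * truncInvSqrt L z) := by
  by_cases hz : z ∈ Icc (-L) L
  · have hsplit : 1 / √(|z| * |α|) = 1 / √|α| * (1 / √|z|) := by
      rw [Real.sqrt_mul (abs_nonneg _)]
      ring
    rw [truncInvSqrt.eq_1 L z, indicator_of_mem hz, indicator_of_mem hz]
    calc w * y * j ≤ w * 1 * (D * (1 + 1 / √(|z| * |α|))) := by gcongr
      _ = D * (w * 1 + w * (1 / √|α|) * (1 / √|z|)) := by rw [hsplit]; ring
      _ ≤ _ := by
        gcongr
        exact mul_inv_sqrt_le_add_truncInvSqrt hw₀ hw₁ α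
  · rw [hjL hz, truncInvSqrt.eq_1 L z, indicator_of_notMem hz, indicator_of_notMem hz]
    simp

lemma integral_norm_mul_norm_mul_norm_le {δ β D L : ℝ} {H : ℝ → ℂ} {J : ℝ → ℝ → ℂ}
    (hδ : δ ≠ 0) (hD : 0 ≤ D) (hH : Integrable H) (hH₁ : ∀ᵐ x, ‖H x‖ ≤ 1)
    (hJ₀ : ∀ U V, V - U ∉ Icc (-L) L → J U V = 0)
    (hJ : ∀ U V, U ≠ V → δ * U + β ≠ 0 →
      ‖J U V‖ ≤ D * (1 + 1 / √(|V - U| * |δ * U + β|))) :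
    ∫ p : ℝ × ℝ, ‖H p.1‖ * ‖H p.2‖ * ‖J p.1 p.2‖ ∂(volume.prod volume) ≤
      D * ((∫ x, ‖H x‖) * (∫ x, (Icc (-L) L).indicator (fun _ => 1) x) +
        ((∫ x, ‖H x‖) + |δ|⁻¹ * ∫ x, truncInvSqrt 1 x) * ∫ x, truncInvSqrt L x) := by
  set g : ℝ → ℝ := (Icc (-L) L).indicator fun _ => 1
  set f : ℝ → ℝ := fun x => ‖H x‖ + truncInvSqrt 1 (δ * x + β) with hf_def
  have hg : Integrable g :=
    (integrable_indicator_iff measurableSet_Icc).2 (integrableOn_const (by simp))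
  have hT : Integrable fun x => truncInvSqrt 1 (δ * x + β) :=
    ((integrable_truncInvSqrt 1).comp_add_right β).comp_mul_left' hδ
  have hf : Integrable f := hH.norm.add hT
  have hHg := integrable_mul_comp_neg_add hH.norm hg
  have hfT := integrable_mul_comp_neg_add hf (integrable_truncInvSqrt L)
  have hmajorant : ∀ᵐ p : ℝ × ℝ ∂(volume.prod volume), ‖H p.1‖ * ‖H p.2‖ * ‖J p.1 p.2‖ ≤
      D * (‖H p.1‖ * g (-p.1 + p.2) + f p.1 * truncInvSqrt L (-p.1 + p.2)) := by
    filter_upwards [ae_fst_ne_snd, ae_mul_fst_add_ne_zero hδ β,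
      Measure.quasiMeasurePreserving_fst.ae hH₁, Measure.quasiMeasurePreserving_snd.ae hH₁]
      with p hp hp' hH_fst hH_snd
    rw [neg_add_eq_sub]
    exact mul_mul_le_of_le_one_add_inv_sqrt (norm_nonneg _) hH_fst hH_snd hD
      (norm_nonneg _) (hJ p.1 p.2 hp hp') fun h => by rw [hJ₀ p.1 p.2 h, norm_zero]
  refine (integral_mono_of_nonneg (.of_forall fun p => by positivity)
    ((hHg.add hfT).const_mul D) hmajorant).trans_eq ?_
  rw [integral_const_mul, integral_add' hHg hfT, integral_mul_comp_neg_add hH.norm hg,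
    integral_mul_comp_neg_add hf (integrable_truncInvSqrt L), hf_def, integral_add hH.norm hT,
    integral_comp_affine]

lemma exists_integral_norm_mul_norm_mul_norm_le (L : ℝ) :
    ∃ C : ℝ, 0 ≤ C ∧ ∀ {δ β D : ℝ} {H : ℝ → ℂ} {J : ℝ → ℝ → ℂ}, δ ≠ 0 → 0 ≤ D →
      Integrable H → (∀ᵐ x, ‖H x‖ ≤ 1) → (∀ U V, V - U ∉ Icc (-L) L → J U V = 0) →
      (∀ U V, U ≠ V → δ * U + β ≠ 0 → ‖J U V‖ ≤ D * (1 + 1 / √(|V - U| * |δ * U + β|))) →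
      ∫ p : ℝ × ℝ, ‖H p.1‖ * ‖H p.2‖ * ‖J p.1 p.2‖ ∂(volume.prod volume) ≤
        C * D * ((∫ x, ‖H x‖) + |δ|⁻¹) := by
  set g₀ := ∫ x, (Icc (-L) L).indicator (fun _ => (1 : ℝ)) x
  set T := ∫ x, truncInvSqrt L x
  set T₁ := ∫ x, truncInvSqrt 1 x
  have hg₀ : 0 ≤ g₀ := integral_nonneg (indicator_nonneg fun _ _ => zero_le_one)
  have hT : 0 ≤ T := integral_nonneg (truncInvSqrt_nonneg L)
  have hT₁ : 0 ≤ T₁ := integral_nonneg (truncInvSqrt_nonneg 1)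
  refine ⟨g₀ + T * (1 + T₁), by positivity, ?_⟩
  intro δ β D H J hδ hD hH hH₁ hJ₀ hJ
  refine (integral_norm_mul_norm_mul_norm_le hδ hD hH hH₁ hJ₀ hJ).trans ?_
  set w := ∫ x, ‖H x‖
  have hw : 0 ≤ w := integral_nonneg fun x => norm_nonneg _
  have hrest : 0 ≤ D * (g₀ * |δ|⁻¹ + T * |δ|⁻¹ + T * T₁ * w) := by positivity
  linarith

end Summation

section RootOperator

variable {n : ℕ} {b : ℝ → ℝ} {A : ℝ → ℂ} {c κ δ β : ℝ}

lemma norm_rootKernel_le_indicator {B C : ℝ} (hA : ∀ p, ‖A p‖ ≤ B) (hb : ∀ s, |b s| ≤ C)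
    (hbs : Function.support b ⊆ Icc (1 / 2) 2) (X U : ℝ) :
    ‖rootKernel n b A c κ δ β X U‖ ≤ (rootDomain n U).indicator (fun _ => B * C) X := by
  by_cases hX : X ∈ rootDomain n U
  · rw [indicator_of_mem hX]
    exact norm_rootKernel_le_mul (hA _) hb
  · rw [rootKernel_eq_zero hbs A c κ δ β hX, indicator_of_notMem hX, norm_zero]

lemma measurableSet_rootDomain (n : ℕ) (U : ℝ) : MeasurableSet (rootDomain n U) := by
  rw [rootDomain_eq_Icc]
  exact measurableSet_Icc

lemma volume_rootDomain_lt_top (n : ℕ) (U : ℝ) : volume (rootDomain n U) < ⊤ := by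
  rw [rootDomain_eq_Icc]
  exact measure_Icc_lt_top

lemma memLp_rootKernel {B C : ℝ} (hAc : Continuous A) (hA : ∀ p, ‖A p‖ ≤ B) (hbm : Measurable b)
    (hb : ∀ s, |b s| ≤ C) (hbs : Function.support b ⊆ Icc (1 / 2) 2) (U : ℝ) :
    MemLp (fun X => rootKernel n b A c κ δ β X U) 2 := by
  refine (memLp_indicator_const 2 (measurableSet_rootDomain n U) (B * C)
    (.inr (volume_rootDomain_lt_top n U).ne)).of_le ?_ (.of_forall fun X => ?_)
  · exact ((measurable_rootKernel n hbm hAc c κ δ β).comp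
      (measurable_id.prodMk measurable_const)).aestronglyMeasurable
  · exact (norm_rootKernel_le_indicator hA hb hbs X U).trans (Real.le_norm_self _)

lemma integral_sq_norm_rootKernel_le {B C : ℝ} (hA : ∀ p, ‖A p‖ ≤ B) (hb : ∀ s, |b s| ≤ C)
    (hbs : Function.support b ⊆ Icc (1 / 2) 2) (U : ℝ) :
    ∫ X, ‖rootKernel n b A c κ δ β X U‖ ^ 2 ≤ 2 ^ (n + 1) * (B * C) ^ 2 := by
  have hdom : Integrable ((rootDomain n U).indicator fun _ => (B * C) ^ 2) :=
    (integrable_indicator_iff (measurableSet_rootDomain n U)).2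
      (integrableOn_const (volume_rootDomain_lt_top n U).ne)
  calc ∫ X, ‖rootKernel n b A c κ δ β X U‖ ^ 2
      ≤ ∫ X, (rootDomain n U).indicator (fun _ => (B * C) ^ 2) X := by
        refine integral_mono_of_nonneg (.of_forall fun X => sq_nonneg _) hdom
          (.of_forall fun X => ?_)
        have h := norm_rootKernel_le_indicator (n := n) (c := c) (κ := κ) (δ := δ) (β := β)
          hA hb hbs X U
        by_cases hX : X ∈ rootDomain n U
        · simp only [indicator_of_mem hX] at h ⊢
          gcongr
        · simp [rootKernel_eq_zero hbs A c κ δ β hX, indicator_of_notMem hX]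
    _ = volume.real (rootDomain n U) * (B * C) ^ 2 := by
        rw [integral_indicator_const _ (measurableSet_rootDomain n U), smul_eq_mul]
    _ ≤ 2 ^ (n + 1) * (B * C) ^ 2 := by
        gcongr
        exact volume_real_rootDomain_le n U

lemma integral_rootKernel_mul_conj_eq_zero (hbs : Function.support b ⊆ Icc (1 / 2) 2) {U V : ℝ}
    (hUV : V - U ∉ Icc (-2 ^ (n + 1)) (2 ^ (n + 1))) :
    ∫ X, rootKernel n b A c κ δ β X U * conj (rootKernel n b A c κ δ β X V) = 0 := by
  refine integral_eq_zero_of_ae (.of_forall fun X => ?_)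
  have hpow : (0 : ℝ) < (1 / 2) ^ (n + 1) := by positivity
  by_cases hU : X ∈ rootDomain n U
  · have hV : X ∉ rootDomain n V := fun hV => by
      rw [rootDomain_eq_Icc] at hU hV
      exact hUV ⟨by linarith [hU.1, hV.2], by linarith [hU.2, hV.1]⟩
    simp [rootKernel_eq_zero hbs A c κ δ β hV]
  · simp [rootKernel_eq_zero hbs A c κ δ β hU]

theorem exists_sq_norm_integral_mul_integral_rootKernel_le (hn : n ≠ 0) {a : ℝ → ℂ} {r₁ r₂ : ℝ}
    (ha : ContDiffOn ℝ 2 a (Ioi 0)) (hr₁ : 0 < r₁) (hr : r₁ ≤ r₂) (ha₁ : a r₁ = 0)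
    (ha₂ : a r₂ = 0) (hb : ContDiffOn ℝ 1 b (Ioi 0)) (hbs : Function.support b ⊆ Icc (1 / 2) 2)
    {κ₁ : ℝ} (hκ₁ : 0 < κ₁) (κ₂ : ℝ) :
    ∃ C : ℝ, 0 ≤ C ∧ ∀ {c κ δ β : ℝ} {H G : ℝ → ℂ}, c ≠ 0 → κ₁ ≤ |κ| → |κ| ≤ κ₂ → δ ≠ 0 →
      Integrable H → (∀ᵐ x, ‖H x‖ ≤ 1) → MemLp G 2 →
      Integrable (fun U => H U * ∫ X, rootKernel n b (oscInt n a r₁ r₂ c) c κ δ β X U * G X) ∧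
      ‖∫ U, H U * ∫ X, rootKernel n b (oscInt n a r₁ r₂ c) c κ δ β X U * G X‖ ^ 2 ≤
        C / (|c| * √|c|) * ((∫ x, ‖H x‖) + |δ|⁻¹) * ∫ x, ‖G x‖ ^ 2 := by
  obtain ⟨Cb, -, hCb⟩ := exists_abs_le_of_continuousOn_Ioi hb.continuousOn hbs
  obtain ⟨K, -, hK⟩ := exists_norm_oscInt_le hr₁ hr hn (ha.of_le (by norm_num))
  obtain ⟨CJ, hCJ, hJ⟩ :=
    exists_norm_integral_rootKernel_oscInt_le hn ha hr₁ hr ha₁ ha₂ hb hbs hκ₁ κ₂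
  obtain ⟨CS, hCS, hS⟩ := exists_integral_norm_mul_norm_mul_norm_le (2 ^ (n + 1))
  refine ⟨CS * CJ, by positivity, ?_⟩
  intro c κ δ β H G hc hcκ hκ hδ hH hH₁ hG
  have hbm : Measurable b := (continuous_of_continuousOn_Ioi hb.continuousOn hbs).measurable
  have hac : ContinuousOn a (uIcc r₁ r₂) := by
    rw [uIcc_of_le hr]
    exact ha.continuousOn.mono fun r hr => hr₁.trans_le hr.1
  have hAc := continuous_oscInt n c hac
  have hk := measurable_rootKernel n hbm hAc c κ δ β
  have hk₂ := memLp_rootKernel (n := n) (c := c) (κ := κ) (δ := δ) (β := β) hAc (hK c hc) hbm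
    hCb hbs
  have hkB := integral_sq_norm_rootKernel_le (n := n) (c := c) (κ := κ) (δ := δ) (β := β)
    (hK c hc) hCb hbs
  constructor
  · simp_rw [← integral_const_mul]
    exact (integrable_mul_kernel hk hk₂ hkB hH hG).integral_prod_left
  · have hsum := hS (D := CJ / (|c| * √|c|)) hδ (by positivity) hH hH₁
      (fun U V hUV => integral_rootKernel_mul_conj_eq_zero (c := c) (κ := κ) (δ := δ) (β := β)
        (A := oscInt n a r₁ r₂ c) hbs hUV)
      (fun U V hUV hα => hJ c κ δ β U V hc hcκ hκ hUV hα)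
    calc _ ≤ _ := sq_norm_integral_mul_integral_kernel_le hk hk₂ hkB hH hG
      _ ≤ (∫ x, ‖G x‖ ^ 2) * _ :=
        mul_le_mul_of_nonneg_left hsum (integral_nonneg fun x => sq_nonneg _)
      _ = _ := by ring

end RootOperator

section Curve

variable {n : ℕ} {a : ℝ → ℂ} {r₁ r₂ c B e : ℝ} {ρ₁ : ℝ → ℝ}

/-- The wave `∫ e^{i (c n r^{n+1} + (B + e y) r^n)} a(r) dr`: the function of `y` whose frequency
`e r^n` carries the phase `c n r^{n+1} + B r^n`. -/
def waveFn (n : ℕ) (a : ℝ → ℂ) (r₁ r₂ c B e y : ℝ) : ℂ :=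
  ∫ r in r₁..r₂, Complex.exp (Complex.I * (c * n * r ^ (n + 1) + (B + e * y) * r ^ n : ℝ)) * a r

lemma waveFn_eq {y p : ℝ} (hp : -(c * (n + 1) * p) = B + e * y) :
    waveFn n a r₁ r₂ c B e y =
      Complex.exp (Complex.I * (-c * p ^ (n + 1) : ℝ)) * oscInt n a r₁ r₂ c p := by
  unfold waveFn oscInt
  rw [← intervalIntegral.integral_const_mul]
  congr 1
  ext r
  rw [← mul_assoc (Complex.exp _) (Complex.exp _), ← Complex.exp_add, ← mul_add,
    ← Complex.ofReal_add, monoPhase, ← hp]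
  congr 4
  ring

lemma waveFn_neg (n : ℕ) (a : ℝ → ℂ) (r₁ r₂ c B e y : ℝ) :
    waveFn n a r₁ r₂ c B e (-y) = waveFn n a r₁ r₂ c B (-e) y := by
  simp only [waveFn, mul_neg, neg_mul]

lemma continuous_waveFn (ha : ContinuousOn a (uIcc r₁ r₂)) (hc : c ≠ 0) (B e : ℝ) :
    Continuous (waveFn n a r₁ r₂ c B e) := by
  have hn : (n : ℝ) + 1 ≠ 0 := by positivity
  have heq : waveFn n a r₁ r₂ c B e = fun y =>
      Complex.exp (Complex.I * (-c * (-(B + e * y) / (c * (n + 1))) ^ (n + 1) : ℝ)) *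
        oscInt n a r₁ r₂ c (-(B + e * y) / (c * (n + 1))) := by
    ext y
    exact waveFn_eq (by field_simp)
  have hosc := continuous_oscInt n c ha
  rw [heq]
  fun_prop

/-- The average of `F(δ U - t) G(U - t^{n+1})` against the weight `ρ(t)`: the bilinear average
along the curve `(t, t^{n+1})`, at the point `U` with dilation `δ` in the first function. -/
def curveAvg (n : ℕ) (F G : ℝ → ℂ) (ρ : ℝ → ℝ) (δ U : ℝ) : ℂ :=
  ∫ t, F (δ * U - t) * G (U - t ^ (n + 1)) * ρ t

/-- The weight `ρ(s) / ((n + 1) s^n)` that comes from the substitution `τ = s^{n+1}`. -/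
def powWeight (n : ℕ) (ρ : ℝ → ℝ) (s : ℝ) : ℝ := ρ s / ((n + 1) * s ^ n)

lemma contDiffOn_powWeight (n : ℕ) {k : WithTop ℕ∞} (hρ : ContDiff ℝ k ρ₁) :
    ContDiffOn ℝ k (powWeight n ρ₁) (Ioi 0) := by
  refine hρ.contDiffOn.div (ContDiff.contDiffOn (by fun_prop)) fun s hs => ?_
  have : (0 : ℝ) < s := hs
  positivity

lemma support_powWeight_subset (n : ℕ) (ρ : ℝ → ℝ) :
    Function.support (powWeight n ρ) ⊆ Function.support ρ := fun s hs hρ =>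
  hs (by rw [powWeight, hρ, zero_div])

lemma waveFn_mul_eq_rootKernel (hc : c ≠ 0) (he : e ≠ 0) (δ U : ℝ) {t : ℝ} (ht : 0 < t) :
    waveFn n a r₁ r₂ c B e (δ * U - t) * ρ₁ t = (n + 1) * t ^ n *
      rootKernel n (powWeight n ρ₁) (oscInt n a r₁ r₂ c) c (e / (c * (n + 1))) δ (B / e)
        (U - t ^ (n + 1)) U := by
  have hlt : U - t ^ (n + 1) < U := sub_lt_self _ (pow_pos ht _)
  have hn : (n : ℝ) + 1 ≠ 0 := by positivity
  have hnC : (n : ℂ) + 1 ≠ 0 := by exact_mod_cast hn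
  have htC : (t : ℂ) ≠ 0 := Complex.ofReal_ne_zero.2 ht.ne'
  rw [rootKernel, if_pos hlt, rootArg, sub_sub_cancel, pow_nthRoot ht.le,
    waveFn_eq (p := e / (c * (n + 1)) * (t - (δ * U + B / e))) (by field_simp; ring), powWeight]
  push_cast
  field_simp

lemma integral_eq_intervalIntegral_of_support_subset {f : ℝ → ℂ} {x₁ x₂ : ℝ} (hx : x₁ ≤ x₂)
    (hf : Function.support f ⊆ Icc x₁ x₂) : ∫ x, f x = ∫ x in x₁..x₂, f x := by
  rw [intervalIntegral.integral_of_le hx, ← integral_Icc_eq_integral_Ioc,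
    setIntegral_eq_integral_of_forall_compl_eq_zero fun x hxs =>
      Function.notMem_support.1 fun h => hxs (hf h)]

lemma curveAvg_eq_integral_rootKernel (hρ : Function.support ρ₁ ⊆ Icc (1 / 2) 2) (hc : c ≠ 0)
    (he : e ≠ 0) (G : ℝ → ℂ) (δ U : ℝ) :
    curveAvg n (waveFn n a r₁ r₂ c B e) G ρ₁ δ U =
      ∫ X, rootKernel n (powWeight n ρ₁) (oscInt n a r₁ r₂ c) c (e / (c * (n + 1))) δ (B / e) X U *
        G X := by
  set k : ℝ → ℂ := fun X =>
    rootKernel n (powWeight n ρ₁) (oscInt n a r₁ r₂ c) c (e / (c * (n + 1))) δ (B / e) X U * G X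
    with hk_def
  have hk : Function.support k ⊆ Icc (U - 2 ^ (n + 1)) (U - (1 / 2) ^ (n + 1)) := by
    rw [← rootDomain_eq_Icc]
    intro X hX
    by_contra hXU
    exact hX (by simp only [hk_def, rootKernel_eq_zero
      ((support_powWeight_subset n ρ₁).trans hρ) _ _ _ _ _ hXU, zero_mul])
  have hle : U - 2 ^ (n + 1) ≤ U - (1 / 2 : ℝ) ^ (n + 1) := by gcongr; norm_num
  have hsubst := intervalIntegral.integral_deriv_smul_comp_of_deriv_nonpos (a := (1 / 2 : ℝ))
    (b := 2) (f := fun t => U - t ^ (n + 1)) (f' := fun t => -((n + 1 : ℕ) * t ^ n)) (g := k)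
    (Continuous.continuousOn (by fun_prop))
    (fun t _ => by simpa using (hasDerivAt_pow (n + 1) t).const_sub U)
    (fun t ht => by
      have : 0 < t := by norm_num at ht; linarith [ht.1]
      exact neg_nonpos.2 (by positivity))
  rw [curveAvg, integral_eq_intervalIntegral_of_support_subset (by norm_num : (1 / 2 : ℝ) ≤ 2)
      fun t ht => hρ fun h => ht (by simp only [h, Complex.ofReal_zero, mul_zero]),
    integral_eq_intervalIntegral_of_support_subset hle hk,
    intervalIntegral.integral_symm (U - (1 / 2) ^ (n + 1)), ← hsubst,
    ← intervalIntegral.integral_neg]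
  refine intervalIntegral.integral_congr fun t ht => ?_
  rw [uIcc_of_le (by norm_num)] at ht
  have ht₀ : 0 < t := by linarith [ht.1]
  simp only [Function.comp, hk_def, Complex.real_smul]
  rw [mul_right_comm, waveFn_mul_eq_rootKernel hc he δ U ht₀]
  push_cast
  ring

lemma curveAvg_comp_neg_of_even (hn : Even (n + 1)) (F G : ℝ → ℂ) (ρ : ℝ → ℝ) (δ U : ℝ) :
    curveAvg n F G (fun t => ρ (-t)) δ U = curveAvg n (fun y => F (-y)) G ρ (-δ) U := by
  rw [curveAvg, ← integral_neg_eq_self, curveAvg]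
  simp only [hn.neg_pow, neg_neg, neg_mul, sub_neg_eq_add, neg_sub, add_comm]

lemma curveAvg_comp_neg_of_odd (hn : Odd (n + 1)) (F G : ℝ → ℂ) (ρ : ℝ → ℝ) (δ U : ℝ) :
    curveAvg n F G (fun t => ρ (-t)) δ (-U) =
      curveAvg n (fun y => F (-y)) (fun x => G (-x)) ρ δ U := by
  rw [curveAvg, ← integral_neg_eq_self, curveAvg]
  simp only [hn.neg_pow, neg_neg, mul_neg, sub_neg_eq_add, neg_sub, neg_add_eq_sub]

lemma integrable_curveAvg_integrand {F G : ℝ → ℂ} (hF : Continuous F) (hG : Continuous G)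
    {ρ : ℝ → ℝ} (hρ : Continuous ρ) (hρc : HasCompactSupport ρ) (δ U : ℝ) :
    Integrable fun t => F (δ * U - t) * G (U - t ^ (n + 1)) * ρ t := by
  refine Continuous.integrable_of_hasCompactSupport (by fun_prop) ?_
  exact (hρc.comp_left Complex.ofReal_zero).mul_left

lemma oddBump_eq (hρ : Function.support ρ₁ ⊆ Ioi 0) (t : ℝ) :
    oddBump ρ₁ t = ρ₁ t - ρ₁ (-t) := by
  have hzero : ∀ s, s ≤ 0 → ρ₁ s = 0 := fun s hs =>
    Function.notMem_support.1 fun h => (hρ h).not_ge hs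
  rcases lt_trichotomy t 0 with ht | rfl | ht
  · rw [oddBump, if_neg ht.not_gt, if_pos ht, hzero t ht.le, zero_sub]
  · simp [oddBump]
  · rw [oddBump, if_pos ht, hzero (-t) (by linarith), sub_zero]

lemma curveAvg_oddBump {F G : ℝ → ℂ} (hF : Continuous F) (hG : Continuous G)
    (hρ : Continuous ρ₁) (hρs : Function.support ρ₁ ⊆ Icc (1 / 2) 2) (δ U : ℝ) :
    curveAvg n F G (oddBump ρ₁) δ U =
      curveAvg n F G ρ₁ δ U - curveAvg n F G (fun t => ρ₁ (-t)) δ U := by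
  have hcpt : HasCompactSupport ρ₁ := .of_support_subset_isCompact isCompact_Icc hρs
  have hcpt' : HasCompactSupport fun t => ρ₁ (-t) := hcpt.comp_homeomorph (Homeomorph.neg ℝ)
  rw [curveAvg, curveAvg, curveAvg, ← integral_sub
    (integrable_curveAvg_integrand hF hG hρ hcpt δ U)
    (integrable_curveAvg_integrand hF hG (by fun_prop) hcpt' δ U)]
  refine integral_congr_ae (.of_forall fun t => ?_)
  simp only [oddBump_eq (hρs.trans fun s hs => (by norm_num : (0 : ℝ) < 1 / 2).trans_le hs.1),
    Complex.ofReal_sub, mul_sub]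

section Estimate

variable {κ₁ κ₂ : ℝ}

lemma exists_sq_norm_integral_mul_curveAvg_le (hn : n ≠ 0) (ha : ContDiffOn ℝ 2 a (Ioi 0))
    (hr₁ : 0 < r₁) (hr : r₁ ≤ r₂) (ha₁ : a r₁ = 0) (ha₂ : a r₂ = 0) (hρ : ContDiff ℝ 1 ρ₁)
    (hρs : Function.support ρ₁ ⊆ Icc (1 / 2) 2) (hκ₁ : 0 < κ₁) (κ₂ : ℝ) :
    ∃ C : ℝ, 0 ≤ C ∧ ∀ {c B e δ : ℝ} {H G : ℝ → ℂ}, c ≠ 0 → κ₁ * |c| ≤ |e| → |e| ≤ κ₂ * |c| →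
      δ ≠ 0 → Integrable H → (∀ᵐ x, ‖H x‖ ≤ 1) → MemLp G 2 →
      Integrable (fun U => H U * curveAvg n (waveFn n a r₁ r₂ c B e) G ρ₁ δ U) ∧
      ‖∫ U, H U * curveAvg n (waveFn n a r₁ r₂ c B e) G ρ₁ δ U‖ ^ 2 ≤
        C / (|c| * √|c|) * ((∫ x, ‖H x‖) + |δ|⁻¹) * ∫ x, ‖G x‖ ^ 2 := by
  have hn₁ : (0 : ℝ) < n + 1 := by positivity
  obtain ⟨C, hC, hbound⟩ := exists_sq_norm_integral_mul_integral_rootKernel_le hn ha hr₁ hr ha₁ ha₂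
    (contDiffOn_powWeight n hρ) ((support_powWeight_subset n ρ₁).trans hρs)
    (div_pos hκ₁ hn₁) (κ₂ / (n + 1))
  refine ⟨C, hC, ?_⟩
  intro c B e δ H G hc hce hec hδ hH hH₁ hG
  have hc₀ : 0 < |c| := abs_pos.2 hc
  have he : e ≠ 0 := abs_pos.1 ((mul_pos hκ₁ hc₀).trans_le hce)
  have hκ : |e / (c * (n + 1))| = |e| / |c| / (n + 1) := by
    rw [abs_div, abs_mul, abs_of_pos hn₁, div_div]
  simp_rw [curveAvg_eq_integral_rootKernel hρs hc he]
  refine hbound hc ?_ ?_ hδ hH hH₁ hG <;> rw [hκ]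
  · gcongr
    rwa [le_div_iff₀ hc₀]
  · gcongr
    rwa [div_le_iff₀ hc₀]

lemma exists_sq_norm_integral_mul_curveAvg_comp_neg_le (hn : n ≠ 0)
    (ha : ContDiffOn ℝ 2 a (Ioi 0)) (hr₁ : 0 < r₁) (hr : r₁ ≤ r₂) (ha₁ : a r₁ = 0) (ha₂ : a r₂ = 0)
    (hρ : ContDiff ℝ 1 ρ₁) (hρs : Function.support ρ₁ ⊆ Icc (1 / 2) 2) (hκ₁ : 0 < κ₁) (κ₂ : ℝ) :
    ∃ C : ℝ, 0 ≤ C ∧ ∀ {c B e δ : ℝ} {H G : ℝ → ℂ}, c ≠ 0 → κ₁ * |c| ≤ |e| → |e| ≤ κ₂ * |c| →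
      δ ≠ 0 → Integrable H → (∀ᵐ x, ‖H x‖ ≤ 1) → MemLp G 2 →
      Integrable (fun U =>
        H U * curveAvg n (waveFn n a r₁ r₂ c B e) G (fun t => ρ₁ (-t)) δ U) ∧
      ‖∫ U, H U * curveAvg n (waveFn n a r₁ r₂ c B e) G (fun t => ρ₁ (-t)) δ U‖ ^ 2 ≤
        C / (|c| * √|c|) * ((∫ x, ‖H x‖) + |δ|⁻¹) * ∫ x, ‖G x‖ ^ 2 := by
  obtain ⟨C, hC, hbound⟩ :=
    exists_sq_norm_integral_mul_curveAvg_le hn ha hr₁ hr ha₁ ha₂ hρ hρs hκ₁ κ₂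
  refine ⟨C, hC, ?_⟩
  intro c B e δ H G hc hce hec hδ hH hH₁ hG
  rw [← abs_neg e] at hce hec
  have hmp := Measure.measurePreserving_neg (volume : Measure ℝ)
  rcases Nat.even_or_odd (n + 1) with hpar | hpar
  · have h := hbound (B := B) hc hce hec (neg_ne_zero.2 hδ) hH hH₁ hG
    simpa only [curveAvg_comp_neg_of_even hpar, waveFn_neg, abs_neg] using h
  · have h := hbound (B := B) hc hce hec hδ hH.comp_neg (hmp.quasiMeasurePreserving.ae hH₁)
      (hG.comp_measurePreserving hmp)
    have hodd : ∀ U, curveAvg n (waveFn n a r₁ r₂ c B (-e)) (G ∘ Neg.neg) ρ₁ δ U =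
        curveAvg n (waveFn n a r₁ r₂ c B e) G (fun t => ρ₁ (-t)) δ (-U) := fun U => by
      simp only [curveAvg_comp_neg_of_odd hpar, waveFn_neg, Function.comp_def]
    simp only [hodd, Function.comp_apply] at h
    rw [integral_neg_eq_self fun x => ‖H x‖, integral_neg_eq_self fun x => ‖G x‖ ^ 2,
      integral_neg_eq_self fun U =>
        H U * curveAvg n (waveFn n a r₁ r₂ c B e) G (fun t => ρ₁ (-t)) δ U] at h
    exact ⟨by simpa using h.1.comp_neg, h.2⟩

lemma sq_norm_sub_le {E : Type*} [SeminormedAddCommGroup E] (x y : E) :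
    ‖x - y‖ ^ 2 ≤ 2 * (‖x‖ ^ 2 + ‖y‖ ^ 2) :=
  (pow_le_pow_left₀ (norm_nonneg _) (norm_sub_le x y) 2).trans add_sq_le

theorem exists_sq_norm_integral_mul_curveAvg_oddBump_le (hn : n ≠ 0)
    (ha : ContDiffOn ℝ 2 a (Ioi 0)) (hr₁ : 0 < r₁) (hr : r₁ ≤ r₂) (ha₁ : a r₁ = 0) (ha₂ : a r₂ = 0)
    (hρ : ContDiff ℝ 1 ρ₁) (hρs : Function.support ρ₁ ⊆ Icc (1 / 2) 2) (hκ₁ : 0 < κ₁) (κ₂ : ℝ) :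
    ∃ C : ℝ, 0 ≤ C ∧ ∀ {c B e δ : ℝ} {H G : ℝ → ℂ}, c ≠ 0 → κ₁ * |c| ≤ |e| → |e| ≤ κ₂ * |c| →
      δ ≠ 0 → Integrable H → (∀ᵐ x, ‖H x‖ ≤ 1) → Continuous G → MemLp G 2 →
      ‖∫ U, H U * curveAvg n (waveFn n a r₁ r₂ c B e) G (oddBump ρ₁) δ U‖ ^ 2 ≤
        C / (|c| * √|c|) * ((∫ x, ‖H x‖) + |δ|⁻¹) * ∫ x, ‖G x‖ ^ 2 := by
  obtain ⟨C₁, hC₁, hpos⟩ :=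
    exists_sq_norm_integral_mul_curveAvg_le hn ha hr₁ hr ha₁ ha₂ hρ hρs hκ₁ κ₂
  obtain ⟨C₂, hC₂, hneg⟩ :=
    exists_sq_norm_integral_mul_curveAvg_comp_neg_le hn ha hr₁ hr ha₁ ha₂ hρ hρs hκ₁ κ₂
  refine ⟨2 * (C₁ + C₂), by positivity, ?_⟩
  intro c B e δ H G hc hce hec hδ hH hH₁ hGc hG
  have hac : ContinuousOn a (uIcc r₁ r₂) := by
    rw [uIcc_of_le hr]
    exact ha.continuousOn.mono fun r hr => hr₁.trans_le hr.1
  obtain ⟨hpos_int, hpos_le⟩ := hpos (B := B) hc hce hec hδ hH hH₁ hG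
  obtain ⟨hneg_int, hneg_le⟩ := hneg (B := B) hc hce hec hδ hH hH₁ hG
  simp_rw [curveAvg_oddBump (continuous_waveFn hac hc B e) hGc hρ.continuous hρs, mul_sub]
  rw [integral_sub hpos_int hneg_int]
  calc _ ≤ _ := sq_norm_sub_le _ _
    _ ≤ 2 * (C₁ / (|c| * √|c|) * ((∫ x, ‖H x‖) + |δ|⁻¹) * (∫ x, ‖G x‖ ^ 2) +
        C₂ / (|c| * √|c|) * ((∫ x, ‖H x‖) + |δ|⁻¹) * ∫ x, ‖G x‖ ^ 2) := by gcongr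
    _ = _ := by ring

end Estimate

end Curve

section FourierInversion

variable {V F : Type*} [NormedAddCommGroup V] [InnerProductSpace ℝ V] [MeasurableSpace V]
  [BorelSpace V] [FiniteDimensional ℝ V]

section L1

variable [NormedAddCommGroup F] [NormedSpace ℂ F]

lemma integral_fourierInv_smul_eq [CompleteSpace F] {f : V → ℂ} {u : V → F} (hf : Integrable f)
    (hu : Integrable u) : ∫ x, 𝓕⁻ f x • u x = ∫ x, f x • 𝓕⁻ u x := by
  have h := VectorFourier.integral_fourierIntegral_smul_eq_flip (L := -innerₗ V)
    Real.continuous_fourierChar (by simpa using! continuous_inner.neg) hf hu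
  have hflip : (-innerₗ V).flip = -innerₗ V := by
    ext x y
    simp [real_inner_comm]
  rwa [hflip] at h

lemma continuous_fourierInv {u : V → F} (hu : Integrable u) : Continuous (𝓕⁻ u) := by
  rw [← Real.Lp.fourierTransformInv_toLp (memLp_one_iff_integrable.2 hu)]
  exact (Real.Lp.fourierTransformInv _).continuous

end L1

lemma integral_sq_norm_Lp {α E : Type*} [MeasurableSpace α] {μ : Measure α}
    [NormedAddCommGroup E] [InnerProductSpace ℂ E] (v : Lp E 2 μ) :
    ∫ x, ‖v x‖ ^ 2 ∂μ = ‖v‖ ^ 2 := by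
  have h := L2.inner_def (𝕜 := ℂ) v v
  simp only [inner_self_eq_norm_sq_to_K] at h
  have hcast : ((‖v‖ ^ 2 : ℝ) : ℂ) = ∫ x, ((‖v x‖ ^ 2 : ℝ) : ℂ) ∂μ := by
    simpa only [Complex.ofReal_pow] using! h
  rw [integral_complex_ofReal] at hcast
  exact (Complex.ofReal_injective hcast).symm

variable [NormedAddCommGroup F] [InnerProductSpace ℂ F] [CompleteSpace F] {u : V → F}

lemma coeFn_fourierInv_toLp (hu₁ : Integrable u) (hu₂ : MemLp u 2) :
    (𝓕⁻ (hu₂.toLp u) : Lp (α := V) F 2) =ᵐ[volume] 𝓕⁻ u := by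
  refine ae_eq_of_integral_contDiff_smul_eq ((Lp.memLp _).locallyIntegrable (by norm_num))
    (continuous_fourierInv hu₁).locallyIntegrable fun g hg hgc => ?_
  set s : 𝓢(V, ℂ) := HasCompactSupport.toSchwartzMap (f := Complex.ofRealCLM ∘ g)
    (hgc.comp_left rfl) (Complex.ofRealCLM.contDiff.comp hg)
  have hs : ∀ x, s x = (g x : ℂ) := fun x => rfl
  have hdist := DFunLike.congr_fun (Lp.fourierInv_toTemperedDistribution_eq (hu₂.toLp u)) s
  rw [TemperedDistribution.fourierInv_apply, Lp.toTemperedDistribution_apply,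
    Lp.toTemperedDistribution_apply] at hdist
  calc ∫ x, g x • (𝓕⁻ (hu₂.toLp u) : Lp F 2 (volume : Measure V)) x
      = ∫ x, s x • (𝓕⁻ (hu₂.toLp u) : Lp F 2 (volume : Measure V)) x := by
        simp only [hs, Complex.coe_smul]
    _ = ∫ x, (𝓕⁻ s) x • hu₂.toLp u x := hdist.symm
    _ = ∫ x, (𝓕⁻ s) x • u x := integral_congr_ae <| by
        filter_upwards [hu₂.coeFn_toLp] with x hx
        rw [hx]
    _ = ∫ x, s x • 𝓕⁻ u x := by
        rw [SchwartzMap.fourierInv_coe]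
        exact integral_fourierInv_smul_eq s.integrable hu₁
    _ = ∫ x, g x • 𝓕⁻ u x := by simp only [hs, Complex.coe_smul]

lemma memLp_fourierInv (hu₁ : Integrable u) (hu₂ : MemLp u 2) : MemLp (𝓕⁻ u) 2 :=
  (memLp_congr_ae (coeFn_fourierInv_toLp hu₁ hu₂)).1 (Lp.memLp _)

lemma norm_fourierInv_Lp (v : Lp (α := V) F 2) : ‖𝓕⁻ v‖ = ‖v‖ := by
  rw [← Lp.norm_fourier_eq, FourierTransform.fourier_fourierInv_eq]

lemma integral_sq_norm_fourierInv (hu₁ : Integrable u) (hu₂ : MemLp u 2) :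
    ∫ x, ‖𝓕⁻ u x‖ ^ 2 = ‖hu₂.toLp u‖ ^ 2 := by
  rw [← norm_fourierInv_Lp, ← integral_sq_norm_Lp]
  refine integral_congr_ae ?_
  filter_upwards [coeFn_fourierInv_toLp hu₁ hu₂] with x hx
  rw [hx]

end FourierInversion

section BoundedRepresentative

variable {V F : Type*} [NormedAddCommGroup V] [InnerProductSpace ℝ V] [MeasurableSpace V]
  [BorelSpace V] [FiniteDimensional ℝ V] [NormedAddCommGroup F] [NormedSpace ℂ F]
  [CompleteSpace F]

lemma ae_norm_le_norm_Lp_top {α E : Type*} [MeasurableSpace α] {μ : Measure α}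
    [NormedAddCommGroup E] (g : Lp E ∞ μ) : ∀ᵐ x ∂μ, ‖g x‖ ≤ ‖g‖ := by
  rw [Lp.norm_def, toReal_eLpNorm (Lp.aestronglyMeasurable g)]
  exact ae_le_lpNorm_exponent_top (Lp.memLp g)

lemma fourierInv_fourierInv_schwartz (s : 𝓢(V, F)) (x : V) :
    𝓕⁻ (𝓕⁻ s) x = s (-x) := by
  rw [SchwartzMap.fourierInv_coe, Real.fourierInv_eq_fourier_neg, ← SchwartzMap.fourier_coe,
    FourierTransform.fourier_fourierInv_eq]

lemma fourierInv_fourierInv_toTemperedDistribution (f : Lp (α := V) F ∞) :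
    𝓕⁻ (𝓕⁻ (f : 𝓢'(V, F))) = (Lp.compMeasurePreserving (Neg.neg : V → V)
      (Measure.measurePreserving_neg volume) f : 𝓢'(V, F)) := by
  have hmp := Measure.measurePreserving_neg (volume : Measure V)
  ext s
  simp only [TemperedDistribution.fourierInv_apply, Lp.toTemperedDistribution_apply,
    fourierInv_fourierInv_schwartz]
  rw [← integral_neg_eq_self]
  refine integral_congr_ae ?_
  filter_upwards [Lp.coeFn_compMeasurePreserving f hmp] with x hx
  rw [hx, neg_neg, Function.comp_apply]

lemma norm_eq_of_toTemperedDistribution_eq_fourierInv_fourierInv {f g : Lp (α := V) F ∞}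
    (h : (g : 𝓢'(V, F)) = 𝓕⁻ (𝓕⁻ (f : 𝓢'(V, F)))) : ‖g‖ = ‖f‖ := by
  rw [fourierInv_fourierInv_toTemperedDistribution] at h
  have hg : g = _ := LinearMap.ker_eq_bot.1 Lp.ker_toTemperedDistributionCLM_eq_bot h
  rw [hg, Lp.norm_compMeasurePreserving]

lemma stronglyMeasurable_linftyRep (u : 𝓢'(ℝ, ℂ)) : StronglyMeasurable (linftyRep u) := by
  unfold linftyRep
  split_ifs with hex
  · exact Lp.stronglyMeasurable _
  · exact stronglyMeasurable_zero

lemma ae_norm_linftyRep_fourierInv_le {u : 𝓢'(ℝ, ℂ)} {f : Lp (α := ℝ) ℂ ∞}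
    (h : 𝓕 u = (f : 𝓢'(ℝ, ℂ))) : ∀ᵐ x, ‖linftyRep (𝓕⁻ u) x‖ ≤ ‖f‖ := by
  unfold linftyRep
  split_ifs with hex
  · rw [← norm_eq_of_toTemperedDistribution_eq_fourierInv_fourierInv (f := f) (g := hex.choose)
      (by rw [hex.choose_spec, ← h, FourierTransform.fourierInv_fourier_eq])]
    exact ae_norm_le_norm_Lp_top _
  · exact .of_forall fun x => by simp

end BoundedRepresentative

section SpaceCutoff

lemma integrable_dilate (φ : 𝓢(ℝ, ℝ)) (k : ℤ) : Integrable (dilate φ k) :=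
  (φ.integrable.comp_mul_left' (by positivity)).const_mul _

lemma integral_abs_dilate (φ : 𝓢(ℝ, ℝ)) (k : ℤ) : ∫ x, |dilate φ k x| = ∫ x, |φ x| := by
  have hk : (0 : ℝ) < 2 ^ (-k) := by positivity
  simp only [dilate, abs_mul, abs_of_pos hk]
  rw [integral_const_mul, Measure.integral_comp_mul_left (fun x => |φ x|), smul_eq_mul,
    abs_of_pos (inv_pos.2 hk), mul_inv_cancel_left₀ hk.ne']

lemma abs_smoothInd_le (φ : 𝓢(ℝ, ℝ)) (k n : ℤ) (x : ℝ) : |smoothInd φ k n x| ≤ ∫ y, |φ y| := by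
  rw [← integral_abs_dilate φ k, ← integral_sub_left_eq_self (fun y => |dilate φ k y|) volume x]
  exact (abs_integral_le_integral_abs).trans (setIntegral_le_integral
    ((integrable_dilate φ k).comp_sub_left x).abs (.of_forall fun y => abs_nonneg _))

lemma smoothInd_eq_convolution (φ : 𝓢(ℝ, ℝ)) (k n : ℤ) :
    smoothInd φ k n = convolution ((Icc ((2 : ℝ) ^ k * n) ((2 : ℝ) ^ k * (n + 1))).indicator 1)
      (dilate φ k) (ContinuousLinearMap.mul ℝ ℝ) volume := by
  ext x
  simp only [smoothInd, convolution, ContinuousLinearMap.mul_apply', ← integral_indicator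
    measurableSet_Icc]
  congr 1 with y
  simp only [indicator_apply, Pi.one_apply, ite_mul, one_mul, zero_mul]

lemma integral_norm_convolution_le {f g : ℝ → ℝ} (hf : Integrable f) (hg : Integrable g) :
    ∫ x, ‖convolution f g (ContinuousLinearMap.mul ℝ ℝ) volume x‖ ≤
      (∫ x, ‖f x‖) * ∫ x, ‖g x‖ := by
  rw [← ContinuousLinearMap.mul_apply' ℝ ℝ, ← integral_convolution _ hf.norm hg.norm]
  refine integral_mono_of_nonneg (.of_forall fun x => norm_nonneg _)
    (hf.norm.integrable_convolution _ hg.norm) (.of_forall fun x => ?_)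
  refine (norm_integral_le_integral_norm _).trans_eq ?_
  simp only [ContinuousLinearMap.mul_apply', norm_mul, convolution]

lemma integrable_indicator_Icc_one (x₁ x₂ : ℝ) :
    Integrable ((Icc x₁ x₂).indicator (1 : ℝ → ℝ)) :=
  (integrable_indicator_iff measurableSet_Icc).2 (integrableOn_const (by simp))

lemma integrable_smoothInd (φ : 𝓢(ℝ, ℝ)) (k n : ℤ) : Integrable (smoothInd φ k n) := by
  rw [smoothInd_eq_convolution]
  exact (integrable_indicator_Icc_one _ _).integrable_convolution _ (integrable_dilate φ k)

lemma integral_abs_smoothInd_le (φ : 𝓢(ℝ, ℝ)) (k n : ℤ) :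
    ∫ x, |smoothInd φ k n x| ≤ 2 ^ k * ∫ x, |φ x| := by
  have hlen : (2 : ℝ) ^ k * (n + 1) - 2 ^ k * n = 2 ^ k := by ring
  have h := integral_norm_convolution_le
    (integrable_indicator_Icc_one ((2 : ℝ) ^ k * n) ((2 : ℝ) ^ k * (n + 1)))
    (integrable_dilate φ k)
  simp only [norm_indicator_eq_indicator_norm, Pi.one_apply, norm_one] at h
  rw [← smoothInd_eq_convolution] at h
  simpa only [Real.norm_eq_abs, integral_abs_dilate, integral_indicator_const _ measurableSet_Icc,
    Real.volume_real_Icc, hlen, max_eq_left (zpow_pos (two_pos (α := ℝ)) k).le, smul_eq_mul,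
    mul_one] using h

end SpaceCutoff

section FrequencyCutoff

variable {n : ℕ} {Φ : 𝓢(ℝ, ℂ)}

lemma norm_fourier_le (Φ : 𝓢(ℝ, ℂ)) (ξ : ℝ) :
    ‖𝓕 Φ ξ‖ ≤ ‖(𝓕 Φ).toBoundedContinuousFunction‖ :=
  (𝓕 Φ).toBoundedContinuousFunction.norm_coe_le_norm ξ

lemma fourierRestrict_fourierInv (Φ : 𝓢(ℝ, ℂ)) (f : Lp (α := ℝ) ℂ 2) :
    fourierRestrict Φ (𝓕⁻ f) = 𝓕⁻ (fun ξ : ℝ => f ξ * 𝓕 Φ ξ) := by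
  rw [fourierRestrict, FourierTransform.fourier_fourierInv_eq]

lemma integrable_mul_fourier (Φ : 𝓢(ℝ, ℂ)) (f : Lp (α := ℝ) ℂ 2) :
    Integrable fun ξ : ℝ => f ξ * 𝓕 Φ ξ :=
  (Lp.memLp f).integrable_mul ((𝓕 Φ).memLp 2)

lemma norm_mul_fourier_le (Φ : 𝓢(ℝ, ℂ)) (f : ℝ → ℂ) (ξ : ℝ) :
    ‖f ξ * 𝓕 Φ ξ‖ ≤ ‖(𝓕 Φ).toBoundedContinuousFunction‖ * ‖f ξ‖ := by
  rw [norm_mul, mul_comm]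
  gcongr
  exact norm_fourier_le Φ ξ

lemma memLp_mul_fourier (Φ : 𝓢(ℝ, ℂ)) (f : Lp (α := ℝ) ℂ 2) :
    MemLp (fun ξ : ℝ => f ξ * 𝓕 Φ ξ) 2 :=
  (Lp.memLp f).of_le_mul (integrable_mul_fourier Φ f).1
    (.of_forall (norm_mul_fourier_le Φ f))

lemma continuous_fourierRestrict (Φ : 𝓢(ℝ, ℂ)) (f : Lp (α := ℝ) ℂ 2) :
    Continuous (fourierRestrict Φ f) :=
  continuous_fourierInv (integrable_mul_fourier Φ (𝓕 f))

lemma memLp_fourierRestrict (Φ : 𝓢(ℝ, ℂ)) (f : Lp (α := ℝ) ℂ 2) :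
    MemLp (fourierRestrict Φ f) 2 :=
  memLp_fourierInv (integrable_mul_fourier Φ (𝓕 f)) (memLp_mul_fourier Φ (𝓕 f))

lemma integral_sq_norm_fourierRestrict_le (Φ : 𝓢(ℝ, ℂ)) (f : Lp (α := ℝ) ℂ 2) :
    ∫ x, ‖fourierRestrict Φ f x‖ ^ 2 ≤
      (‖(𝓕 Φ).toBoundedContinuousFunction‖ * ‖f‖) ^ 2 := by
  have hmem := memLp_mul_fourier Φ (𝓕 f)
  rw [fourierRestrict, integral_sq_norm_fourierInv (integrable_mul_fourier Φ (𝓕 f)) hmem,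
    ← Lp.norm_fourier_eq f]
  gcongr
  refine Lp.norm_le_mul_norm_of_ae_le_mul ?_
  filter_upwards [hmem.coeFn_toLp] with ξ hξ
  rw [hξ]
  exact norm_mul_fourier_le Φ _ ξ

/-- The frequency cutoff `Φ^` in the variable `r = |ξ|^{1/n}` on the half-line `σ ξ > 0`, including
the Jacobian `n r^{n-1}` of `ξ = σ r^n`. -/
def freqAmp (n : ℕ) (Φ : 𝓢(ℝ, ℂ)) (σ r : ℝ) : ℂ := n * r ^ (n - 1) * 𝓕 Φ (σ * r ^ n)

lemma contDiff_freqAmp (n : ℕ) (Φ : 𝓢(ℝ, ℂ)) (σ : ℝ) {k : ℕ} : ContDiff ℝ k (freqAmp n Φ σ) := by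
  have hΦ : ContDiff ℝ k fun r : ℝ => 𝓕 Φ (σ * r ^ n) :=
    ((𝓕 Φ).smooth k).comp (contDiff_const.mul (contDiff_id.pow n))
  have hpow : ContDiff ℝ k fun r : ℝ => (n : ℂ) * (r : ℂ) ^ (n - 1) :=
    contDiff_const.mul (Complex.ofRealCLM.contDiff.pow (n - 1))
  exact hpow.mul hΦ

lemma freqAmp_eq_zero {σ r : ℝ} (h : 𝓕 Φ (σ * r ^ n) = 0) : freqAmp n Φ σ r = 0 := by
  rw [freqAmp, h, mul_zero]

lemma setIntegral_freqInterval {I : Set ℝ} (hI : IsFreqInterval I) :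
    ∃ σ : ℝ, |σ| = 1 ∧ ∀ g : ℝ → ℂ, ∫ x in I, g x = ∫ x in (1 / 16 : ℝ)..(39 / 16), g (σ * x) := by
  rcases hI with rfl | rfl
  · refine ⟨1, by simp, fun g => ?_⟩
    rw [intervalIntegral.integral_of_le (by norm_num), integral_Icc_eq_integral_Ioc]
    simp only [one_mul]
  · refine ⟨-1, by simp, fun g => ?_⟩
    simp only [neg_one_mul]
    rw [intervalIntegral.integral_comp_neg, intervalIntegral.integral_of_le (by norm_num),
      integral_Icc_eq_integral_Ioc]

lemma IsFreqInterval.measurableSet {I : Set ℝ} (hI : IsFreqInterval I) : MeasurableSet I := by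
  rcases hI with rfl | rfl <;> exact measurableSet_Icc

lemma intervalIntegral_pow_eq (n : ℕ) {r₁ r₂ : ℝ} (hr₁ : 0 ≤ r₁) (hr : r₁ ≤ r₂) (g : ℝ → ℂ) :
    ∫ x in r₁ ^ n..r₂ ^ n, g x = ∫ r in r₁..r₂, n * r ^ (n - 1) * g (r ^ n) := by
  have h := intervalIntegral.integral_deriv_smul_comp_of_deriv_nonneg (a := r₁) (b := r₂)
    (f := fun r => r ^ n) (f' := fun r => n * r ^ (n - 1)) (g := g) (by fun_prop)
    (fun r _ => hasDerivAt_pow n r) (fun r hr' => by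
      rw [min_eq_left hr] at hr'
      have : 0 ≤ r := hr₁.trans hr'.1.le
      positivity)
  rw [← h]
  simp only [Function.comp, Complex.real_smul, Complex.ofReal_mul, Complex.ofReal_pow,
    Complex.ofReal_natCast]

lemma abs_mul_pow_rpow_succ_div (hn : n ≠ 0) {σ r : ℝ} (hσ : |σ| = 1) (hr : 0 ≤ r) :
    |σ * r ^ n| ^ ((n + 1 : ℝ) / n) = r ^ (n + 1) := by
  have hn₀ : (n : ℝ) ≠ 0 := by exact_mod_cast hn
  rw [abs_mul, hσ, one_mul, abs_of_nonneg (by positivity), ← Real.rpow_natCast,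
    ← Real.rpow_mul hr, mul_div_cancel₀ _ hn₀, ← Real.rpow_natCast]
  norm_cast

lemma fourierRestrict_fourierInv_apply {I : Set ℝ} (hI : MeasurableSet I) {q : ℝ → ℝ}
    {f : Lp (α := ℝ) ℂ 2}
    (hf : f =ᵐ[volume] I.indicator fun ξ => Complex.exp (Complex.I * (q ξ : ℂ))) (y : ℝ) :
    fourierRestrict Φ (𝓕⁻ f) y =
      ∫ ξ in I, Complex.exp (Complex.I * (q ξ + 2 * Real.pi * ξ * y : ℝ)) * 𝓕 Φ ξ := by
  rw [fourierRestrict_fourierInv, Real.fourierInv_eq', ← integral_indicator hI]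
  refine integral_congr_ae ?_
  filter_upwards [hf] with ξ hξ
  rw [hξ]
  by_cases h : ξ ∈ I
  · rw [indicator_of_mem h, indicator_of_mem h, smul_eq_mul, ← mul_assoc, ← Complex.exp_add]
    congr 2
    simp only [RCLike.inner_apply, conj_trivial]
    push_cast
    ring
  · rw [indicator_of_notMem h, indicator_of_notMem h, zero_mul, smul_zero]

theorem fourierRestrict_eq_waveFn (hn : n ≠ 0) {I : Set ℝ} (hI : IsFreqInterval I) :
    ∃ σ : ℝ, |σ| = 1 ∧ ∀ {Φ : 𝓢(ℝ, ℂ)} {a b r₁ r₂ : ℝ} {f : Lp (α := ℝ) ℂ 2},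
      0 ≤ r₁ → r₁ ≤ r₂ → r₁ ^ n = 1 / 16 → r₂ ^ n = 39 / 16 →
      f =ᵐ[volume] I.indicator (fun ξ => Complex.exp (Complex.I *
        ((a * |ξ| ^ ((n + 1 : ℝ) / n) + b * ξ : ℝ) : ℂ))) →
      fourierRestrict Φ (𝓕⁻ f) =
        waveFn n (freqAmp n Φ σ) r₁ r₂ (a / n) (b * σ) (2 * Real.pi * σ) := by
  obtain ⟨σ, hσ, hint⟩ := setIntegral_freqInterval hI
  refine ⟨σ, hσ, fun {Φ a b r₁ r₂ f} hr₁ hr hpow₁ hpow₂ hf => ?_⟩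
  have hn₀ : (n : ℝ) ≠ 0 := by exact_mod_cast hn
  ext y
  rw [fourierRestrict_fourierInv_apply hI.measurableSet hf, hint, ← hpow₁, ← hpow₂,
    intervalIntegral_pow_eq n hr₁ hr, waveFn]
  refine intervalIntegral.integral_congr fun r hr' => ?_
  rw [uIcc_of_le hr] at hr'
  simp only [abs_mul_pow_rpow_succ_div hn hσ (hr₁.trans hr'.1), freqAmp, div_mul_cancel₀ _ hn₀]
  rw [mul_left_comm]
  congr 4
  ring

end FrequencyCutoff

section TrilinearForm

variable {n : ℕ} {a : ℝ → ℂ} {r₁ r₂ : ℝ}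

lemma exists_sq_norm_integral_mul_curveAvg_oddBump_le_of_bounded {κ₁ : ℝ} {ρ₁ : ℝ → ℝ}
    (hn : n ≠ 0) (ha : ContDiffOn ℝ 2 a (Ioi 0)) (hr₁ : 0 < r₁) (hr : r₁ ≤ r₂) (ha₁ : a r₁ = 0)
    (ha₂ : a r₂ = 0) (hρ : ContDiff ℝ 1 ρ₁) (hρs : Function.support ρ₁ ⊆ Icc (1 / 2) 2)
    (hκ₁ : 0 < κ₁) (κ₂ : ℝ) :
    ∃ C : ℝ, 0 ≤ C ∧ ∀ {c B e δ K : ℝ} {H G : ℝ → ℂ}, c ≠ 0 → κ₁ * |c| ≤ |e| → |e| ≤ κ₂ * |c| →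
      δ ≠ 0 → Integrable H → 0 ≤ K → (∀ᵐ x, ‖H x‖ ≤ K) → Continuous G → MemLp G 2 →
      ‖∫ U, H U * curveAvg n (waveFn n a r₁ r₂ c B e) G (oddBump ρ₁) δ U‖ ^ 2 ≤
        C / (|c| * √|c|) * (K * ((∫ x, ‖H x‖) + K * |δ|⁻¹)) * ∫ x, ‖G x‖ ^ 2 := by
  obtain ⟨C, hC, hbound⟩ :=
    exists_sq_norm_integral_mul_curveAvg_oddBump_le hn ha hr₁ hr ha₁ ha₂ hρ hρs hκ₁ κ₂
  refine ⟨C, hC, fun {c B e δ K H G} hc hce hec hδ hH hK hHK hGc hG => ?_⟩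
  obtain rfl | hK := hK.eq_or_lt
  · have hzero : ∀ᵐ U, H U * curveAvg n (waveFn n a r₁ r₂ c B e) G (oddBump ρ₁) δ U = 0 := by
      filter_upwards [hHK] with U hU
      rw [norm_le_zero_iff.1 hU, zero_mul]
    simp [integral_congr_ae hzero]
  have hHK₁ : ∀ᵐ x, ‖(K : ℂ)⁻¹ * H x‖ ≤ 1 := by
    filter_upwards [hHK] with x hx
    rw [norm_mul, norm_inv, Complex.norm_of_nonneg hK.le]
    exact inv_mul_le_one_of_le₀ hx hK.le
  have h := hbound (B := B) hc hce hec hδ (hH.const_mul _) hHK₁ hGc hG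
  simp only [mul_assoc, norm_mul, norm_inv, Complex.norm_of_nonneg hK.le, integral_const_mul] at h
  rw [mul_pow, inv_pow, inv_mul_le_iff₀ (by positivity)] at h
  refine h.trans_eq ?_
  field_simp

lemma waveFn_const_mul (n : ℕ) (a : ℝ → ℂ) (r₁ r₂ c B e M y : ℝ) :
    waveFn n a r₁ r₂ c B e (M * y) = waveFn n a r₁ r₂ c B (e * M) y := by
  simp only [waveFn, mul_assoc]

lemma curveAvg_comp_const_mul (n : ℕ) (F G : ℝ → ℂ) (ρ : ℝ → ℝ) (δ M U : ℝ) :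
    curveAvg n (fun y => F (M * y)) (fun x => G (M * x)) ρ δ U =
      ∫ t, F (δ * (M * U) - M * t) * G (M * U - M * t ^ (n + 1)) * ρ t := by
  simp only [curveAvg, mul_sub, mul_left_comm]

/-- The weight `1*_{k,l}` times the conjugate of the function `f₃ˇ` in `L^∞`: what is paired with
the average along the curve in `Λ`. -/
def dualWeight (φ : 𝓢(ℝ, ℝ)) (k l : ℤ) (f₃ : 𝓢'(ℝ, ℂ)) (x : ℝ) : ℂ :=
  smoothInd φ k l x * conj (linftyRep (𝓕⁻ f₃) x)

lemma ae_norm_dualWeight_le_mul (φ : 𝓢(ℝ, ℝ)) (k l : ℤ) {f₃ : 𝓢'(ℝ, ℂ)}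
    {f₃hat : Lp (α := ℝ) ℂ ∞} (hf₃ : 𝓕 f₃ = (f₃hat : 𝓢'(ℝ, ℂ))) :
    ∀ᵐ x, ‖dualWeight φ k l f₃ x‖ ≤ ‖f₃hat‖ * |smoothInd φ k l x| := by
  filter_upwards [ae_norm_linftyRep_fourierInv_le hf₃] with x hx
  rw [dualWeight, norm_mul, Complex.norm_real, RCLike.norm_conj, mul_comm, Real.norm_eq_abs]
  gcongr

lemma integrable_dualWeight (φ : 𝓢(ℝ, ℝ)) (k l : ℤ) {f₃ : 𝓢'(ℝ, ℂ)}
    {f₃hat : Lp (α := ℝ) ℂ ∞} (hf₃ : 𝓕 f₃ = (f₃hat : 𝓢'(ℝ, ℂ))) :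
    Integrable (dualWeight φ k l f₃) :=
  ((integrable_smoothInd φ k l).abs.const_mul ‖f₃hat‖).mono'
    ((integrable_smoothInd φ k l).ofReal.1.mul
      (Complex.continuous_conj.comp_stronglyMeasurable
        (stronglyMeasurable_linftyRep _)).aestronglyMeasurable)
    (ae_norm_dualWeight_le_mul φ k l hf₃)

lemma ae_norm_dualWeight_le (φ : 𝓢(ℝ, ℝ)) (k l : ℤ) {f₃ : 𝓢'(ℝ, ℂ)}
    {f₃hat : Lp (α := ℝ) ℂ ∞} (hf₃ : 𝓕 f₃ = (f₃hat : 𝓢'(ℝ, ℂ))) :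
    ∀ᵐ x, ‖dualWeight φ k l f₃ x‖ ≤ ‖f₃hat‖ * ∫ y, |φ y| := by
  filter_upwards [ae_norm_dualWeight_le_mul φ k l hf₃] with x hx
  exact hx.trans (by gcongr; exact abs_smoothInd_le φ k l x)

lemma integral_norm_dualWeight_le (φ : 𝓢(ℝ, ℝ)) (k l : ℤ) {f₃ : 𝓢'(ℝ, ℂ)}
    {f₃hat : Lp (α := ℝ) ℂ ∞} (hf₃ : 𝓕 f₃ = (f₃hat : 𝓢'(ℝ, ℂ))) :
    ∫ x, ‖dualWeight φ k l f₃ x‖ ≤ 2 ^ k * (‖f₃hat‖ * ∫ y, |φ y|) :=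
  calc ∫ x, ‖dualWeight φ k l f₃ x‖
      ≤ ∫ x, ‖f₃hat‖ * |smoothInd φ k l x| :=
        integral_mono_ae (integrable_dualWeight φ k l hf₃).norm
          ((integrable_smoothInd φ k l).abs.const_mul _) (ae_norm_dualWeight_le_mul φ k l hf₃)
    _ = ‖f₃hat‖ * ∫ x, |smoothInd φ k l x| := integral_const_mul _ _
    _ ≤ ‖f₃hat‖ * (2 ^ k * ∫ y, |φ y|) := by gcongr; exact integral_abs_smoothInd_le φ k l
    _ = 2 ^ k * (‖f₃hat‖ * ∫ y, |φ y|) := mul_left_comm _ _ _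

lemma two_rpow_neg_mul_div_two_eq_sqrt (n j : ℕ) :
    (2 : ℝ) ^ (-((n : ℝ) * j / 2)) = √((2 : ℝ) ^ (-((n : ℤ) * j))) := by
  rw [Real.sqrt_eq_rpow, ← Real.rpow_intCast, ← Real.rpow_mul (by norm_num)]
  congr 1
  push_cast
  ring

/-- Scaling `x = 2^m U` turns the curve `(2^m t, 2^m t^d)` into the fixed curve `(t, t^d)`. -/
lemma trilinΛ_succ_eq (n : ℕ) (ρ₁ : ℝ → ℝ) (Φ : 𝓢(ℝ, ℂ)) (φ : 𝓢(ℝ, ℝ)) (j m : ℕ) (l : ℤ)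
    (f₁ f₂ : Lp (α := ℝ) ℂ 2) (f₃ : 𝓢'(ℝ, ℂ)) :
    trilinΛ (n + 1) ρ₁ Φ φ j m l f₁ f₂ f₃ =
      (√((2 : ℝ) ^ (-((n : ℤ) * j))) * 2 ^ m : ℝ) *
        ∫ U, dualWeight φ (n * j + m) l f₃ (2 ^ m * U) *
          curveAvg n (fun y => fourierRestrict Φ (𝓕⁻ f₁) (2 ^ m * y))
            (fun x => fourierRestrict Φ (𝓕⁻ f₂) (2 ^ m * x)) (oddBump ρ₁)
            (2 ^ (-((n : ℤ) * j))) U := by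
  have hM : (0 : ℝ) < 2 ^ m := by positivity
  simp only [curveAvg_comp_const_mul]
  rw [Measure.integral_comp_mul_left (fun x => dualWeight φ (n * j + m) l f₃ x *
    ∫ t, fourierRestrict Φ (𝓕⁻ f₁) (2 ^ (-((n : ℤ) * j)) * x - 2 ^ m * t) *
      fourierRestrict Φ (𝓕⁻ f₂) (x - 2 ^ m * t ^ (n + 1)) * oddBump ρ₁ t) (2 ^ m),
    abs_of_pos (inv_pos.2 hM), Complex.real_smul, ← mul_assoc, ← Complex.ofReal_mul,
    mul_inv_cancel_right₀ hM.ne', ← integral_const_mul, trilinΛ]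
  simp only [bilinB, dualWeight, Nat.cast_add, Nat.cast_one, add_sub_cancel_right,
    two_rpow_neg_mul_div_two_eq_sqrt]
  congr 1 with x
  ring

lemma integral_norm_dualWeight_comp_two_pow_mul_le (φ : 𝓢(ℝ, ℝ)) (k : ℤ) (m : ℕ) (l : ℤ)
    {f₃ : 𝓢'(ℝ, ℂ)} {f₃hat : Lp (α := ℝ) ℂ ∞} (hf₃ : 𝓕 f₃ = (f₃hat : 𝓢'(ℝ, ℂ))) :
    ∫ U, ‖dualWeight φ (k + m) l f₃ (2 ^ m * U)‖ ≤ 2 ^ k * (‖f₃hat‖ * ∫ y, |φ y|) := by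
  have hM : (0 : ℝ) < 2 ^ m := by positivity
  rw [Measure.integral_comp_mul_left (fun x => ‖dualWeight φ (k + m) l f₃ x‖),
    abs_of_pos (inv_pos.2 hM), smul_eq_mul, inv_mul_le_iff₀ hM]
  refine (integral_norm_dualWeight_le φ (k + m) l hf₃).trans_eq ?_
  rw [zpow_add₀ two_ne_zero, zpow_natCast, mul_comm ((2 : ℝ) ^ k), mul_assoc]

lemma integral_sq_norm_fourierRestrict_comp_mul_le (Φ : 𝓢(ℝ, ℂ)) (f : Lp (α := ℝ) ℂ 2) {M : ℝ}
    (hM : 0 < M) :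
    ∫ x, ‖fourierRestrict Φ f (M * x)‖ ^ 2 ≤
      M⁻¹ * (‖(𝓕 Φ).toBoundedContinuousFunction‖ * ‖f‖) ^ 2 := by
  rw [Measure.integral_comp_mul_left (fun x => ‖fourierRestrict Φ f x‖ ^ 2),
    abs_of_pos (inv_pos.2 hM), smul_eq_mul]
  gcongr
  exact integral_sq_norm_fourierRestrict_le Φ f

lemma memLp_fourierRestrict_comp_mul (Φ : 𝓢(ℝ, ℂ)) (f : Lp (α := ℝ) ℂ 2) {M : ℝ} (hM : M ≠ 0) :
    MemLp (fun x => fourierRestrict Φ f (M * x)) 2 := by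
  have hcont := continuous_fourierRestrict Φ f
  exact (memLp_two_iff_integrable_sq_norm
    (hcont.comp (continuous_const_mul M)).aestronglyMeasurable).2
    (((memLp_two_iff_integrable_sq_norm hcont.aestronglyMeasurable).1
      (memLp_fourierRestrict Φ f)).comp_mul_left' hM)

theorem exists_sq_norm_trilinΛ_le_of_eq_waveFn {κ₁ : ℝ} {ρ₁ : ℝ → ℝ} (hn : n ≠ 0)
    (ha : ContDiffOn ℝ 2 a (Ioi 0)) (hr₁ : 0 < r₁) (hr : r₁ ≤ r₂) (ha₁ : a r₁ = 0) (ha₂ : a r₂ = 0)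
    (hρ : ContDiff ℝ 1 ρ₁) (hρs : Function.support ρ₁ ⊆ Icc (1 / 2) 2) (hκ₁ : 0 < κ₁) (κ₂ : ℝ)
    (Φ : 𝓢(ℝ, ℂ)) (φ : 𝓢(ℝ, ℝ)) :
    ∃ C : ℝ, 0 ≤ C ∧ ∀ {j m : ℕ} {l : ℤ} {c B e : ℝ} {f₁ f₂ : Lp (α := ℝ) ℂ 2} {f₃ : 𝓢'(ℝ, ℂ)}
      {f₃hat : Lp (α := ℝ) ℂ ∞}, fourierRestrict Φ (𝓕⁻ f₁) = waveFn n a r₁ r₂ c B e →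
      c ≠ 0 → κ₁ * |c| ≤ |e * 2 ^ m| → |e * 2 ^ m| ≤ κ₂ * |c| → 𝓕 f₃ = (f₃hat : 𝓢'(ℝ, ℂ)) →
      ‖trilinΛ (n + 1) ρ₁ Φ φ j m l f₁ f₂ f₃‖ ^ 2 ≤
        C * (2 ^ m / (|c| * √|c|)) * (‖f₂‖ * ‖f₃hat‖) ^ 2 := by
  obtain ⟨C, hC, hbound⟩ := exists_sq_norm_integral_mul_curveAvg_oddBump_le_of_bounded
    hn ha hr₁ hr ha₁ ha₂ hρ hρs hκ₁ κ₂
  set A := ‖(𝓕 Φ).toBoundedContinuousFunction‖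
  have hP : 0 ≤ ∫ y, |φ y| := integral_nonneg fun _ => abs_nonneg _
  refine ⟨2 * C * (A * ∫ y, |φ y|) ^ 2, by positivity, ?_⟩
  intro j m l c B e f₁ f₂ f₃ f₃hat hf₁ hc hce hec hf₃
  have hM : (0 : ℝ) < 2 ^ m := by positivity
  set δ : ℝ := 2 ^ (-((n : ℤ) * j)) with hδ
  have hδ₀ : 0 < δ := by positivity
  have hδ_inv : (2 : ℝ) ^ ((n : ℤ) * j) = δ⁻¹ := by rw [hδ, zpow_neg, inv_inv]
  set K := ‖f₃hat‖ * ∫ y, |φ y| with hK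
  set H : ℝ → ℂ := fun U => dualWeight φ (n * j + m) l f₃ (2 ^ m * U)
  have hHint : Integrable H := (integrable_dualWeight φ _ l hf₃).comp_mul_left' hM.ne'
  have hH₁ : ∫ U, ‖H U‖ ≤ δ⁻¹ * K :=
    hδ_inv ▸ integral_norm_dualWeight_comp_two_pow_mul_le φ (n * j) m l hf₃
  have hHK : ∀ᵐ U, ‖H U‖ ≤ K :=
    (Measure.quasiMeasurePreserving_smul volume hM.ne').ae (ae_norm_dualWeight_le φ _ l hf₃)
  have hG := integral_sq_norm_fourierRestrict_comp_mul_le Φ (𝓕⁻ f₂) hM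
  rw [norm_fourierInv_Lp] at hG
  have h := hbound (B := B) hc hce hec hδ₀.ne' hHint (by positivity) hHK
    ((continuous_fourierRestrict Φ (𝓕⁻ f₂)).comp (continuous_const_mul _))
    (memLp_fourierRestrict_comp_mul Φ (𝓕⁻ f₂) hM.ne')
  rw [trilinΛ_succ_eq, hf₁, norm_mul, Complex.norm_of_nonneg (by positivity), mul_pow, mul_pow,
    Real.sq_sqrt hδ₀.le]
  simp only [waveFn_const_mul]
  calc _ ≤ δ * (2 ^ m) ^ 2 * (C / (|c| * √|c|) * (K * ((∫ U, ‖H U‖) + K * |δ|⁻¹)) *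
        ∫ x, ‖fourierRestrict Φ (𝓕⁻ f₂) (2 ^ m * x)‖ ^ 2) := by gcongr; exact h
    _ ≤ δ * (2 ^ m) ^ 2 * (C / (|c| * √|c|) * (K * (δ⁻¹ * K + K * |δ|⁻¹)) *
        ((2 ^ m)⁻¹ * (A * ‖f₂‖) ^ 2)) := by gcongr
    _ = _ := by
      rw [abs_of_pos hδ₀, hK]
      field_simp
      ring

end TrilinearForm

section Decay

variable {n : ℕ} {ρ₁ : ℝ → ℝ} {Φ : 𝓢(ℝ, ℂ)}

lemma two_rpow_neg_div_four_sq (m : ℕ) : ((2 : ℝ) ^ (-(m / 4 : ℝ))) ^ 2 = (√(2 ^ m))⁻¹ := by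
  rw [Real.sqrt_eq_rpow, ← Real.rpow_natCast, ← Real.rpow_natCast, ← Real.rpow_mul (by norm_num),
    ← Real.rpow_mul (by norm_num), ← Real.rpow_neg (by norm_num)]
  congr 1
  push_cast
  ring

lemma div_abs_mul_sqrt_abs_le {c c₁ M : ℝ} (hc₁ : 0 < c₁) (hM : 0 < M) (hc : c₁ * M ≤ |c|) :
    M / (|c| * √|c|) ≤ (c₁ * √c₁)⁻¹ * (√M)⁻¹ :=
  calc M / (|c| * √|c|) ≤ M / (c₁ * M * √(c₁ * M)) := by gcongr
    _ = (c₁ * √c₁)⁻¹ * (√M)⁻¹ := by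
      rw [Real.sqrt_mul hc₁.le]
      field_simp

lemma exists_norm_trilinΛ_le_of_eq_waveFn {a : ℝ → ℂ} {r₁ r₂ e c₁ c₂ : ℝ} (hn : n ≠ 0)
    (ha : ContDiffOn ℝ 2 a (Ioi 0)) (hr₁ : 0 < r₁) (hr : r₁ ≤ r₂) (ha₁ : a r₁ = 0) (ha₂ : a r₂ = 0)
    (hρ : ContDiff ℝ 1 ρ₁) (hρs : Function.support ρ₁ ⊆ Icc (1 / 2) 2) (he : e ≠ 0) (hc₁ : 0 < c₁)
    (hc₂ : 0 < c₂) (Φ : 𝓢(ℝ, ℂ)) (φ : 𝓢(ℝ, ℝ)) :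
    ∃ C : ℝ, 0 ≤ C ∧ ∀ {j m : ℕ} {l : ℤ} {c B : ℝ} {f₁ f₂ : Lp (α := ℝ) ℂ 2} {f₃ : 𝓢'(ℝ, ℂ)}
      {f₃hat : Lp (α := ℝ) ℂ ∞}, c₁ * 2 ^ m ≤ |c| → |c| ≤ c₂ * 2 ^ m →
      fourierRestrict Φ (𝓕⁻ f₁) = waveFn n a r₁ r₂ c B e → 𝓕 f₃ = (f₃hat : 𝓢'(ℝ, ℂ)) →
      ‖trilinΛ (n + 1) ρ₁ Φ φ j m l f₁ f₂ f₃‖ ≤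
        C * (2 : ℝ) ^ (-(m / 4 : ℝ)) * ‖f₂‖ * ‖f₃hat‖ := by
  obtain ⟨C, hC, hbound⟩ := exists_sq_norm_trilinΛ_le_of_eq_waveFn hn ha hr₁ hr ha₁ ha₂ hρ hρs
    (div_pos (abs_pos.2 he) hc₂) (|e| / c₁) Φ φ
  refine ⟨√(C * (c₁ * √c₁)⁻¹), by positivity, ?_⟩
  intro j m l c B f₁ f₂ f₃ f₃hat hcl hcu hf₁ hf₃
  have hM : (0 : ℝ) < 2 ^ m := by positivity
  have hc : 0 < |c| := (by positivity : 0 < c₁ * 2 ^ m).trans_le hcl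
  have heM : |e * 2 ^ m| = |e| * 2 ^ m := by rw [abs_mul, abs_of_pos hM]
  refine le_of_sq_le_sq ?_ (by positivity)
  calc ‖trilinΛ (n + 1) ρ₁ Φ φ j m l f₁ f₂ f₃‖ ^ 2
      ≤ C * (2 ^ m / (|c| * √|c|)) * (‖f₂‖ * ‖f₃hat‖) ^ 2 := by
        refine hbound hf₁ (abs_pos.1 hc) ?_ ?_ hf₃
        · rw [heM, div_mul_eq_mul_div, div_le_iff₀ hc₂, mul_assoc, mul_comm _ c₂]
          gcongr
        · rw [heM, div_mul_eq_mul_div, le_div_iff₀ hc₁, mul_assoc, mul_comm _ c₁]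
          gcongr
    _ ≤ C * ((c₁ * √c₁)⁻¹ * (√(2 ^ m))⁻¹) * (‖f₂‖ * ‖f₃hat‖) ^ 2 := by
        gcongr
        exact div_abs_mul_sqrt_abs_le hc₁ hM hcl
    _ = (√(C * (c₁ * √c₁)⁻¹) * (2 : ℝ) ^ (-(m / 4 : ℝ)) * ‖f₂‖ * ‖f₃hat‖) ^ 2 := by
        simp only [mul_pow, Real.sq_sqrt (by positivity : 0 ≤ C * (c₁ * √c₁)⁻¹),
          two_rpow_neg_div_four_sq]
        ring

lemma exists_norm_trilinΛ_le_of_isFreqInterval (hn : n ≠ 0) {I : Set ℝ} (hI : IsFreqInterval I)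
    (hρ : ContDiff ℝ 1 ρ₁) (hρs : Function.support ρ₁ ⊆ Icc (1 / 2) 2)
    (hΦ : ∀ ξ : ℝ, |ξ| = 1 / 16 ∨ |ξ| = 39 / 16 → 𝓕 Φ ξ = 0) (φ : 𝓢(ℝ, ℝ)) :
    ∃ C : ℝ, 0 ≤ C ∧ ∀ {j m : ℕ} {l : ℤ} {q : ℝ → ℝ} {f₁ f₂ : Lp (α := ℝ) ℂ 2} {f₃ : 𝓢'(ℝ, ℂ)}
      {f₃hat : Lp (α := ℝ) ℂ ∞}, q ∈ phasesQ₁ (n + 1) m →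
      f₁ =ᵐ[volume] I.indicator (fun ξ => Complex.exp (Complex.I * (q ξ : ℂ))) →
      𝓕 f₃ = (f₃hat : 𝓢'(ℝ, ℂ)) →
      ‖trilinΛ (n + 1) ρ₁ Φ φ j m l f₁ f₂ f₃‖ ≤
        C * (2 : ℝ) ^ (-(m / 4 : ℝ)) * ‖f₂‖ * ‖f₃hat‖ := by
  have hn₀ : (0 : ℝ) < n := by exact_mod_cast Nat.pos_of_ne_zero hn
  obtain ⟨σ, hσ, hwave⟩ := fourierRestrict_eq_waveFn hn hI
  have hroot {x : ℝ} (hx : 0 ≤ x) : (x ^ (n : ℝ)⁻¹) ^ n = x := Real.rpow_inv_natCast_pow hx hn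
  have habs {x : ℝ} (hx : 0 ≤ x) : |σ * (x ^ (n : ℝ)⁻¹) ^ n| = x := by
    rw [hroot hx, abs_mul, hσ, one_mul, abs_of_nonneg hx]
  have hr : (1 / 16 : ℝ) ^ (n : ℝ)⁻¹ ≤ (39 / 16) ^ (n : ℝ)⁻¹ := by gcongr; norm_num
  obtain ⟨C, hC, hbound⟩ := exists_norm_trilinΛ_le_of_eq_waveFn (ρ₁ := ρ₁) (e := 2 * Real.pi * σ)
    (c₁ := 2 ^ (-100 : ℤ) / n) (c₂ := 2 ^ (100 : ℤ) / n) hn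
    (contDiff_freqAmp n Φ σ).contDiffOn (by positivity) hr
    (freqAmp_eq_zero (hΦ _ (.inl (habs (by norm_num)))))
    (freqAmp_eq_zero (hΦ _ (.inr (habs (by norm_num))))) hρ hρs
    (mul_ne_zero (by positivity) (abs_ne_zero.1 (hσ ▸ one_ne_zero)))
    (by positivity) (by positivity) Φ φ
  refine ⟨C, hC, ?_⟩
  rintro j m l _ f₁ f₂ f₃ f₃hat ⟨a, b, hal, hau, rfl⟩ hf₁ hf₃
  rw [sub_eq_neg_add, zpow_add₀ two_ne_zero, zpow_natCast] at hal
  rw [add_comm, zpow_add₀ two_ne_zero, zpow_natCast] at hau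
  have hac : |a / n| = |a| / n := by rw [abs_div, abs_of_pos hn₀]
  refine hbound (c := a / n) (B := b * σ) ?_ ?_ ?_ hf₃
  · rw [hac, div_mul_eq_mul_div]
    gcongr
  · rw [hac, div_mul_eq_mul_div]
    gcongr
  · refine hwave (by positivity) hr (hroot (by norm_num)) (hroot (by norm_num)) ?_
    simpa only [Nat.cast_add, Nat.cast_one, add_sub_cancel_right] using hf₁

lemma decayExp_le_half {ε : ℝ} (hε : 0 ≤ ε) {ℓ : ℕ} (hℓ : ℓ ≠ 0) : decayExp ε ℓ ≤ 1 / 2 := by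
  have hℓ₁ : (1 : ℝ) ≤ ℓ := by exact_mod_cast Nat.one_le_iff_ne_zero.2 hℓ
  unfold decayExp
  split_ifs <;> exact one_div_le_one_div_of_le two_pos (by linarith)

lemma two_rpow_neg_div_four_le_decayExp {ε : ℝ} (hε : 0 ≤ ε) {ℓ : ℕ} (hℓ : ℓ ≠ 0) (m : ℕ) :
    (2 : ℝ) ^ (-(m / 4 : ℝ)) ≤ 2 ^ (-(decayExp ε ℓ * m / 2)) := by
  refine Real.rpow_le_rpow_of_exponent_le one_le_two (neg_le_neg ?_)
  have h := mul_le_mul_of_nonneg_right (decayExp_le_half hε hℓ) (Nat.cast_nonneg (α := ℝ) m)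
  linarith

lemma IsFreqCutoff.fourier_eq_zero (hΦ : IsFreqCutoff Φ) {ξ : ℝ}
    (hξ : |ξ| = 1 / 16 ∨ |ξ| = 39 / 16) : 𝓕 Φ ξ = 0 := by
  by_contra h
  have hsupp := hΦ.2 ξ h
  rcases hξ with hξ | hξ <;> norm_num [hξ] at hsupp

end Decay

end CurveBHT

end

theorem mainTheorem8_general (d : ℕ) (hd : 2 ≤ d)
    (ρ₁ : ℝ → ℝ) (hρ₁ : ContDiff ℝ 1 ρ₁) (hρ₁s : Function.support ρ₁ ⊆ Icc (1 / 2) 2)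
    (Φ₁ : 𝓢(ℝ, ℂ)) (hΦ₁ : ∀ ξ : ℝ, |ξ| = 1 / 16 ∨ |ξ| = 39 / 16 → 𝓕 Φ₁ ξ = 0) (φ : 𝓢(ℝ, ℝ)) :
    ∃ C : ℝ, 0 ≤ C ∧ ∀ (j m : ℕ) (n : ℤ) (I₁ : Set ℝ), CurveBHT.IsFreqInterval I₁ →
      ∀ q₁ ∈ CurveBHT.phasesQ₁ d m, ∀ f₁ : Lp (α := ℝ) ℂ 2,
      f₁ =ᵐ[volume] I₁.indicator (fun ξ => Complex.exp (Complex.I * (q₁ ξ : ℂ))) →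
      ∀ (f₂ : Lp (α := ℝ) ℂ 2) (f₃ : 𝓢'(ℝ, ℂ)) (f₃hat : Lp (α := ℝ) ℂ ∞),
        𝓕 f₃ = (f₃hat : 𝓢'(ℝ, ℂ)) →
        ‖CurveBHT.trilinΛ d ρ₁ Φ₁ φ j m n f₁ f₂ f₃‖ ≤
          C * (2 : ℝ) ^ (-(m / 4 : ℝ)) * ‖f₂‖ * ‖f₃hat‖ := by
  obtain ⟨N, rfl⟩ : ∃ N, d = N + 1 := ⟨d - 1, by omega⟩
  have hN : N ≠ 0 := by omega
  obtain ⟨C, hC, hpos⟩ := CurveBHT.exists_norm_trilinΛ_le_of_isFreqInterval hN (.inl rfl) hρ₁ hρ₁s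
    hΦ₁ φ
  obtain ⟨C', -, hneg⟩ := CurveBHT.exists_norm_trilinΛ_le_of_isFreqInterval hN (.inr rfl) hρ₁ hρ₁s
    hΦ₁ φ
  refine ⟨max C C', hC.trans (le_max_left _ _), ?_⟩
  rintro j m n _ (rfl | rfl) q₁ hq₁ f₁ hf₁ f₂ f₃ f₃hat hf₃
  · refine (hpos hq₁ hf₁ hf₃).trans ?_
    gcongr
    exact le_max_left _ _
  · refine (hneg hq₁ hf₁ hf₃).trans ?_
    gcongr
    exact le_max_right _ _

theorem mainTheorem8 (d : ℕ) (hd : 2 ≤ d)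
    (ρ₁ : ℝ → ℝ) (hρ₁ : CurveBHT.IsBump ρ₁)
    (Φ₁ : 𝓢(ℝ, ℂ)) (hΦ₁ : CurveBHT.IsFreqCutoff Φ₁)
    (φ : 𝓢(ℝ, ℝ)) (hφ : CurveBHT.IsSpaceCutoff φ)
    (ε : ℝ) (hε : 0 < ε) :
    ∃ C : ℝ, ∀ (j m : ℕ) (n : ℤ), 0 < j →
      ∀ I₁ I₂ : Set ℝ, CurveBHT.IsFreqInterval I₁ → CurveBHT.IsFreqInterval I₂ →
      ∀ q₁ ∈ CurveBHT.phasesQ₁ d m,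
      -- `f₁` is the element of `L²(I₁)` given by `exp (i q₁)`
      ∀ f₁ : Lp (α := ℝ) ℂ 2,
        f₁ =ᵐ[volume] I₁.indicator (fun ξ => Complex.exp (Complex.I * (q₁ ξ : ℂ))) →
      -- `f₂` belongs to `L²(I₂)`
      ∀ f₂ : Lp (α := ℝ) ℂ 2, (∀ᵐ ξ : ℝ, ξ ∉ I₂ → f₂ ξ = 0) →
      -- the Fourier transform of `f₃` is the function `f₃hat` in `L^∞`
      ∀ (f₃ : 𝓢'(ℝ, ℂ)) (f₃hat : Lp (α := ℝ) ℂ ∞), 𝓕 f₃ = (f₃hat : 𝓢'(ℝ, ℂ)) →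
        ‖CurveBHT.trilinΛ d ρ₁ Φ₁ φ j m n f₁ f₂ f₃‖ ≤
          C * (2 : ℝ) ^ (-(CurveBHT.decayExp ε (d - 1) * m / 2)) * ‖f₂‖ * ‖f₃hat‖ := by
  obtain ⟨C, hC, hbound⟩ := mainTheorem8_general d hd ρ₁ (hρ₁.1.of_le (by simp)) hρ₁.2 Φ₁
    (fun _ => hΦ₁.fourier_eq_zero) φ
  refine ⟨C, fun j m n _ I₁ _ hI₁ _ q₁ hq₁ f₁ hf₁ f₂ _ f₃ f₃hat hf₃ =>
    (hbound j m n I₁ hI₁ q₁ hq₁ f₁ hf₁ f₂ f₃ f₃hat hf₃).trans ?_⟩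
  gcongr C * ?_ * ‖f₂‖ * ‖f₃hat‖
  exact CurveBHT.two_rpow_neg_div_four_le_decayExp hε.le (Nat.sub_ne_zero_of_lt hd) m
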